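/- Let \(I=[0,\pi]\) and let \(L^2(I,\mathbb C^2)\) carry the scalar product \(\langle f,h\rangle=\frac1\pi\int_0^\pi (f_1\overline{h_1}+f_2\overline{h_2})\,dx\); put \(\|y\|_\infty=\max(\|y_1\|_{L^\infty(I)},\|y_2\|_{L^\infty(I)})\). Let \(P,Q\in L^2(I)\), \(V(y_1,y_2)^T=(Py_2,Qy_1)^T\), and consider the Dirac operators \[L y=i\begin{pmatrix}1&0\\0&-1\end{pmatrix}y'+Vy,\qquad L^0y=i\begin{pmatrix}1&0\\0&-1\end{pmatrix}y'\] on the domain of all absolutely continuous \(y\) with \(y'\in L^2\) that satisfy a boundary condition \[a_1y_1(0)+b_1y_1(\pi)+a_2y_2(0)+b_2y_2(\pi)=0,\qquad c_1y_1(0)+d_1y_1(\pi)+c_2y_2(0)+d_2y_2(\pi)=0 .\] Let \(A_{ij}\) be the \(2\times2\) matrix formed by columns \(i,j\) of the coefficient matrix \(\begin{pmatrix}a_1&b_1&a_2&b_2\\c_1&d_1&c_2&d_2\end{pmatrix}\), and let the boundary condition be regular: \(|A_{14}|\ne0\) and \(|A_{23}|\neq0\) (determinants). It is strictly regular if also \((|A_{13}|+|A_{24}|)^2\ne4|A_{14}||A_{23}|\).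 Multiplication by \(A_{14}^{-1}\) from the left brings the coefficient matrix to the form \(\begin{pmatrix}1&b&a&0\\0&d&c&1\end{pmatrix}\). Choose \(\tau_1,\tau_2,\alpha_1,\alpha_2,\beta_1,\beta_2\in\mathbb C\) and \(\kappa\in\{0,1\}\) as follows. (1) If the condition is strictly regular: \(\kappa=0\), \(z_\nu=e^{i\pi\tau_\nu}\) are the two distinct roots of \(z^2+(b+c)z+bc-ad=0\), \(|\mathrm{Re}\,\tau_1-\mathrm{Re}\,\tau_2|\le1\), and \((\alpha_1,\alpha_2)^T\), \((\beta_1,\beta_2)^T\) are eigenvectors of \(\begin{pmatrix}b&a\\d&c\end{pmatrix}\) for the eigenvalues \(-z_1\), \(-z_2\). (2) If \(b=c\) and \(a=d=0\): \(\kappa=0\), \(\tau_1=\tau_2\), \(e^{i\pi\tau_1}=-(b+c)/2\), and \((\alpha_1,\alpha_2)\), \((\beta_1,\beta_2)\) are any linearly independent vectors. (3) In the remaining case: \(\kappa=1\), \(\tau_1=\tau_2\), \(e^{i\pi\tau_1}=-(b+c)/2\), and \(\begin{pmatrix}\alpha_1&\beta_1\\\alpha_2&\beta_2\end{pmatrix}\)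 is \(\begin{pmatrix}0&\pi b\\d&0\end{pmatrix}\) if \(a=0\) and \(\begin{pmatrix}a&0\\(c-b)/2&\pi b\end{pmatrix}\) if \(a\ne0\). For \(k\in2\mathbb Z\) let \[\varphi^1_k=\begin{pmatrix}\alpha_1e^{i\tau_1(\pi-x)}e^{-ikx}\\\alpha_2e^{i\tau_1x}e^{ikx}\end{pmatrix},\qquad \varphi^2_k=\begin{pmatrix}(\beta_1-\kappa\alpha_1x)e^{i\tau_2(\pi-x)}e^{-ikx}\\(\beta_2+\kappa\alpha_2x)e^{i\tau_2x}e^{ikx}\end{pmatrix};\] these root functions of \(L^0\) form a Riesz basis of \(L^2(I,\mathbb C^2)\). Let \(\{\tilde\varphi^\nu_k\}\) be the biorthogonal system. The matrix entries \(\langle V\varphi^\nu_k,\tilde\varphi^\eta_j\rangle\) depend on \(j+k\) only; denote them by \(w^{\eta\nu}(j+k)\) and set, for \(m\in2\mathbb Z\), \(r(m)=\max_{\eta,\nu}|w^{\eta\nu}(m)|\). For \(F\in L^2(I,\mathbb C^2)\) and \(k\in2\mathbb Z\) set \(g_k=\max(|\langle F,\tilde\varphi^1_k\rangle|,|\langle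 F,\tilde\varphi^2_k\rangle|)\). For \(N\in2\mathbb N\) and \(T>0\) let \(R_{NT}=\{x+it:\ |x-\mathrm{Re}\,\tfrac{\tau_1+\tau_2}2|<N+1,\ |t|<T\}\), and, with \(R_\lambda=(\lambda-L)^{-1}\), \(R^0_\lambda=(\lambda-L^0)^{-1}\) and \(\partial R_{NT}\) traversed counterclockwise, let \[S_N=\frac1{2\pi i}\int_{\partial R_{NT}}R_\lambda\,d\lambda,\quad S^0_N=\frac1{2\pi i}\int_{\partial R_{NT}}R^0_\lambda\,d\lambda,\quad A_N=\frac1{2\pi i}\int_{\partial R_{NT}}R^0_\lambda VR^0_\lambda\,d\lambda .\] Then there are \(N_0\) and \(T_0>0\), independent of \(F\), such that for all even \(N\ge N_0\) and all \(T\ge T_0\) the contour \(\partial R_{NT}\) does not meet the spectra of \(L\) and \(L^0\), and such that for every \(F\in L^2(I,\mathbb C^2)\) \[\|A_NF\|_\infty\to0\quad\text{and}\quad\|(S_N-S^0_N)F\|_\infty\to0\qquad(N\to\infty,\ N\ \text{even}),\] uniformly in \(T\ge T_0\), whenever one of the following conditions holds: (a) there is \(p\in(1,2)\) with \(\sum_{k\in2\mathbb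 Z}g_k^p<\infty\); (b) there is \(p\in(1,2)\) with \(\sum_{k\in2\mathbb Z}r(k)^p<\infty\); (c) there is \(\delta>1\) with \(\sum_{k\in2\mathbb Z}g_k^2[\log(|k|+e)]^\delta<\infty\); (d) there is \(\delta>1\) with \(\sum_{k\in2\mathbb Z}r(k)^2[\log(|k|+e)]^\delta<\infty\). -/

import Mathlib

open MeasureTheory Filter Topology

noncomputable section

namespace Dirac1D

/-! ### The space `L²([0,π], ℂ²)` -/

/-- Lebesgue measure on `[0, π]`. -/
abbrev μI : Measure ℝ := volume.restrict (Set.Icc 0 Real.pi)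

/-- The Hilbert space `L²([0,π], ℂ²)`. -/
abbrev H : Type := Lp (EuclideanSpace ℂ (Fin 2)) 2 μI

/-- `‖(y₁, y₂)‖_∞ = max (‖y₁‖_∞, ‖y₂‖_∞)` with essential suprema over `[0,π]`
(it is `∞` when `y` is not essentially bounded). -/
def supNorm (u : H) : ENNReal :=
  max (eLpNorm (fun x => u x 0) ⊤ μI) (eLpNorm (fun x => u x 1) ⊤ μI)

/-! ### Boundary conditions

A boundary condition is a `2 × 4` matrix `[a₁ b₁ a₂ b₂; c₁ d₁ c₂ d₂]`, which stands for the two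
equations `M (y₁(0), y₁(π), y₂(0), y₂(π))ᵀ = 0`. -/

/-- The `2 × 2` matrix formed by the columns `i` and `j` (numbered from `0`). -/
def cols (M : Matrix (Fin 2) (Fin 4) ℂ) (i j : Fin 4) : Matrix (Fin 2) (Fin 2) ℂ :=
  M.submatrix id ![i, j]

/-- Regular boundary conditions: `|A₁₄| ≠ 0` and `|A₂₃| ≠ 0`. -/
def IsRegular (M : Matrix (Fin 2) (Fin 4) ℂ) : Prop :=
  (cols M 0 3).det ≠ 0 ∧ (cols M 1 2).det ≠ 0

/-- Strictly regular boundary conditions: regular and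
`(|A₁₃| + |A₂₄|)² ≠ 4 |A₁₄| |A₂₃|`. -/
def IsStrictlyRegular (M : Matrix (Fin 2) (Fin 4) ℂ) : Prop :=
  IsRegular M ∧
    ((cols M 0 2).det + (cols M 1 3).det) ^ 2 ≠ 4 * (cols M 0 3).det * (cols M 1 2).det

/-- The equivalent normalized matrix `A₁₄⁻¹ M`; for a regular boundary condition it is
`[1 b a 0; 0 d c 1]`. -/
def normalized (M : Matrix (Fin 2) (Fin 4) ℂ) : Matrix (Fin 2) (Fin 4) ℂ :=
  (cols M 0 3)⁻¹ * M

/-- The entry `b` of the normalized matrix `[1 b a 0; 0 d c 1]`. -/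
def bcb (M : Matrix (Fin 2) (Fin 4) ℂ) : ℂ := normalized M 0 1

/-- The entry `a` of the normalized matrix `[1 b a 0; 0 d c 1]`. -/
def bca (M : Matrix (Fin 2) (Fin 4) ℂ) : ℂ := normalized M 0 2

/-- The entry `d` of the normalized matrix `[1 b a 0; 0 d c 1]`. -/
def bcd (M : Matrix (Fin 2) (Fin 4) ℂ) : ℂ := normalized M 1 1

/-- The entry `c` of the normalized matrix `[1 b a 0; 0 d c 1]`. -/
def bcc (M : Matrix (Fin 2) (Fin 4) ℂ) : ℂ := normalized M 1 2

/-- Periodic-type boundary conditions: `b = c`, `a = 0`, `d = 0`. -/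
def IsPeriodicType (M : Matrix (Fin 2) (Fin 4) ℂ) : Prop :=
  bcb M = bcc M ∧ bca M = 0 ∧ bcd M = 0

/-! ### The Dirac operator and its resolvent -/

/-- `DiracRel M P Q u w` says that `u` lies in the domain of the operator
`L y = i [1 0; 0 -1] y' + [0 P; Q 0] y` under the boundary condition `M`, and that `L u = w`.
The domain consists of the (classes of) absolutely continuous `y = (y₁, y₂)` on `[0,π]` with
`y₁', y₂' ∈ L²` that satisfy the boundary condition. -/
def DiracRel (M : Matrix (Fin 2) (Fin 4) ℂ) (P Q : ℝ → ℂ) (u w : H) : Prop :=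
  ∃ y₁ y₂ : ℝ → ℂ,
    AbsolutelyContinuousOnInterval y₁ 0 Real.pi ∧
    AbsolutelyContinuousOnInterval y₂ 0 Real.pi ∧
    MemLp (deriv y₁) 2 μI ∧ MemLp (deriv y₂) 2 μI ∧
    M.mulVec ![y₁ 0, y₁ Real.pi, y₂ 0, y₂ Real.pi] = 0 ∧
    (∀ᵐ x ∂μI, u x 0 = y₁ x ∧ u x 1 = y₂ x) ∧
    (∀ᵐ x ∂μI, w x 0 = Complex.I * deriv y₁ x + P x * y₂ x ∧
      w x 1 = -(Complex.I * deriv y₂ x) + Q x * y₁ x)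

/-- `R` is a bounded two-sided inverse of `z - L`:
for all `F`, `u = R F` is the unique `u` in the domain with `z u - L u = F`. -/
def IsResolventAt (M : Matrix (Fin 2) (Fin 4) ℂ) (P Q : ℝ → ℂ) (z : ℂ) (R : H →L[ℂ] H) : Prop :=
  ∀ F u : H, u = R F ↔ DiracRel M P Q u (z • u - F)

/-- The resolvent set of `L`, i.e. the complement of its spectrum. -/
def resSet (M : Matrix (Fin 2) (Fin 4) ℂ) (P Q : ℝ → ℂ) : Set ℂ :=
  {z | ∃ R : H →L[ℂ] H, IsResolventAt M P Q z R}

open Classical in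
/-- The resolvent `(z - L)⁻¹` for `z` in the resolvent set (and `0` elsewhere). -/
def resolv (M : Matrix (Fin 2) (Fin 4) ℂ) (P Q : ℝ → ℂ) (z : ℂ) : H →L[ℂ] H :=
  if h : ∃ R : H →L[ℂ] H, IsResolventAt M P Q z R then h.choose else 0

/-- The resolvent of the free operator `L⁰`. -/
def resolv₀ (M : Matrix (Fin 2) (Fin 4) ℂ) (z : ℂ) : H →L[ℂ] H := resolv M 0 0 z

open Classical in
/-- Multiplication by the potential, `V (u₁, u₂) = (P u₂, Q u₁)`, for those `u` for which the
result is in `L²` (in particular for all bounded `u`), and `0` for other `u`. -/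
def mulV (P Q : ℝ → ℂ) (u : H) : H :=
  if h : MemLp (fun x => (WithLp.toLp 2 ![P x * u x 1, Q x * u x 0] : EuclideanSpace ℂ (Fin 2)))
    2 μI then h.toLp _ else 0

/-! ### The basis of root functions of the free operator -/

/-- The numbers `τ₁, τ₂, α₁, α₂, β₁, β₂` from which a basis of root functions is built; `κ` is `0`
when the basis consists of eigenfunctions, and `1` when there are associated functions. -/
structure RootData where
  τ₁ : ℂ
  τ₂ : ℂ
  α₁ : ℂ
  α₂ : ℂ
  β₁ : ℂ
  β₂ : ℂ
  κ : ℂ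

/-- Strictly regular case: `zᵥ = exp (iπτᵥ)` are such that `-z₁ ≠ -z₂` are the eigenvalues of
`[b a; d c]`, with eigenvectors `(α₁, α₂)` and `(β₁, β₂)`, and `|Re τ₁ - Re τ₂| ≤ 1`. -/
def RootData.IsStrict (D : RootData) (M : Matrix (Fin 2) (Fin 4) ℂ) : Prop :=
  IsStrictlyRegular M ∧ D.κ = 0 ∧
  Complex.exp (Complex.I * Real.pi * D.τ₁) ≠ Complex.exp (Complex.I * Real.pi * D.τ₂) ∧
  |D.τ₁.re - D.τ₂.re| ≤ 1 ∧
  ![D.α₁, D.α₂] ≠ 0 ∧ ![D.β₁, D.β₂] ≠ 0 ∧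
  Matrix.mulVec !![bcb M, bca M; bcd M, bcc M] ![D.α₁, D.α₂]
    = -Complex.exp (Complex.I * Real.pi * D.τ₁) • ![D.α₁, D.α₂] ∧
  Matrix.mulVec !![bcb M, bca M; bcd M, bcc M] ![D.β₁, D.β₂]
    = -Complex.exp (Complex.I * Real.pi * D.τ₂) • ![D.β₁, D.β₂]

/-- Periodic-type case: `τ₁ = τ₂ = τ⁎` with `exp (iπτ⁎) = -(b+c)/2`, and any two linearly
independent vectors `(α₁, α₂)`, `(β₁, β₂)`. -/
def RootData.IsPeriodic (D : RootData) (M : Matrix (Fin 2) (Fin 4) ℂ) : Prop :=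
  IsRegular M ∧ IsPeriodicType M ∧ D.κ = 0 ∧ D.τ₁ = D.τ₂ ∧
  Complex.exp (Complex.I * Real.pi * D.τ₁) = -(bcb M + bcc M) / 2 ∧
  D.α₁ * D.β₂ - D.α₂ * D.β₁ ≠ 0

/-- The remaining regular boundary conditions: `τ₁ = τ₂ = τ⁎` with `exp (iπτ⁎) = -(b+c)/2`, and
`[α₁ β₁; α₂ β₂]` is `[0 πb; d 0]` if `a = 0`, and `[a 0; (c-b)/2 πb]` if `a ≠ 0`. -/
def RootData.IsAssociated (D : RootData) (M : Matrix (Fin 2) (Fin 4) ℂ) : Prop :=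
  IsRegular M ∧ ¬ IsStrictlyRegular M ∧ ¬ IsPeriodicType M ∧ D.κ = 1 ∧ D.τ₁ = D.τ₂ ∧
  Complex.exp (Complex.I * Real.pi * D.τ₁) = -(bcb M + bcc M) / 2 ∧
  ((bca M = 0 ∧ D.α₁ = 0 ∧ D.α₂ = bcd M ∧ D.β₁ = Real.pi * bcb M ∧ D.β₂ = 0) ∨
   (bca M ≠ 0 ∧ D.α₁ = bca M ∧ D.α₂ = (bcc M - bcb M) / 2 ∧ D.β₁ = 0 ∧
      D.β₂ = Real.pi * bcb M))

/-- `D` is an admissible choice of root data for the regular boundary condition `M`. -/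
def RootData.IsFor (D : RootData) (M : Matrix (Fin 2) (Fin 4) ℂ) : Prop :=
  D.IsStrict M ∨ D.IsPeriodic M ∨ D.IsAssociated M

/-- The root functions `φ_k^1` (`ν = 0`) and `φ_k^2` (`ν = 1`), for even `k`. -/
def rootFun (D : RootData) (ν : Fin 2) (k : ℤ) (x : ℝ) : Fin 2 → ℂ :=
  ![![D.α₁ * Complex.exp (Complex.I * D.τ₁ * (Real.pi - x)) * Complex.exp (-(Complex.I * k * x)),
      D.α₂ * Complex.exp (Complex.I * D.τ₁ * x) * Complex.exp (Complex.I * k * x)],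
    ![(D.β₁ - D.κ * D.α₁ * x) * Complex.exp (Complex.I * D.τ₂ * (Real.pi - x)) *
        Complex.exp (-(Complex.I * k * x)),
      (D.β₂ + D.κ * D.α₂ * x) * Complex.exp (Complex.I * D.τ₂ * x) *
        Complex.exp (Complex.I * k * x)]] ν

/-- `Δ = α₁β₂ - α₂β₁ + κ π α₁ α₂`. -/
def RootData.Δ (D : RootData) : ℂ :=
  D.α₁ * D.β₂ - D.α₂ * D.β₁ + D.κ * Real.pi * D.α₁ * D.α₂

/-- Column minors of `M` in terms of those of the normalized matrix. -/
theorem det_cols_eq (M : Matrix (Fin 2) (Fin 4) ℂ) (hM : IsRegular M) (i j : Fin 4) :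
    (cols M i j).det = (cols M 0 3).det * (cols (normalized M) i j).det := by
  have h : cols M i j = cols M 0 3 * cols (normalized M) i j := by
    have : M = cols M 0 3 * normalized M := by
      rw [normalized, ← Matrix.mul_assoc, Matrix.mul_nonsing_inv _ (isUnit_iff_ne_zero.mpr hM.1),
        Matrix.one_mul]
    conv_lhs => rw [this]
    rfl
  conv_lhs => rw [h]
  rw [Matrix.det_mul]

/-- The normalized matrix has the form `[1 b a 0; 0 d c 1]`. -/
theorem normalized_cols (M : Matrix (Fin 2) (Fin 4) ℂ) (hM : IsRegular M) :
    normalized M 0 0 = 1 ∧ normalized M 1 0 = 0 ∧ normalized M 0 3 = 0 ∧ normalized M 1 3 = 1 := by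
  have h : cols (normalized M) 0 3 = 1 := by
    have : cols (normalized M) 0 3 = (cols M 0 3)⁻¹ * cols M 0 3 := rfl
    rw [this, Matrix.nonsing_inv_mul _ (isUnit_iff_ne_zero.mpr hM.1)]
  have e := fun i j => congrFun (congrFun h i) j
  exact ⟨by simpa [cols] using e 0 0, by simpa [cols] using e 1 0, by simpa [cols] using e 0 1,
    by simpa [cols] using e 1 1⟩

/-- Strict regularity in terms of the normalized matrix. -/
theorem isStrictlyRegular_iff (M : Matrix (Fin 2) (Fin 4) ℂ) (hM : IsRegular M) :
    IsStrictlyRegular M ↔ (bcb M - bcc M) ^ 2 + 4 * bca M * bcd M ≠ 0 := by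
  obtain ⟨h1, h2, h3, h4⟩ := normalized_cols M hM
  have h0 := hM.1
  rw [IsStrictlyRegular, and_iff_right hM, det_cols_eq M hM 0 2, det_cols_eq M hM 1 3, det_cols_eq M hM 1 2]
  rw [not_iff_not]
  simp only [Matrix.det_fin_two, cols, Matrix.submatrix_apply, Matrix.cons_val_zero,
    Matrix.cons_val_one, id, Matrix.cons_val_fin_one, h1, h2, h3, h4, bca, bcb, bcc, bcd] at h0 ⊢
  set k := M 0 0 * M 1 3 - M 0 3 * M 1 0
  constructor
  · intro h
    have : k ^ 2 * ((normalized M 0 1 - normalized M 1 2) ^ 2 + 4 * normalized M 0 2 * normalized M 1 1) = 0 := by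
      linear_combination h
    rcases mul_eq_zero.mp this with h | h
    · exact absurd (pow_eq_zero_iff (two_ne_zero) |>.mp h) h0
    · exact h
  · intro h
    linear_combination k^2 * h

/-- `Δ ≠ 0` for all admissible data. -/
theorem RootData.Δ_ne_zero (D : RootData) (M : Matrix (Fin 2) (Fin 4) ℂ) (h : D.IsFor M) :
    D.Δ ≠ 0 := by
  have hpi : (Real.pi : ℂ) ≠ 0 := by exact_mod_cast Real.pi_ne_zero
  rcases h with ⟨hM, hk, hz, -, ha, hb, ea, eb⟩ | ⟨-, -, hk, -, -, h⟩ | ⟨hM, hs, hp, hk, -, he, h⟩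
  · intro h0
    simp only [RootData.Δ, hk, zero_mul, add_zero] at h0
    have a0 := congrFun ea 0; have a1 := congrFun ea 1
    have b0 := congrFun eb 0; have b1 := congrFun eb 1
    simp [Matrix.mulVec, dotProduct, Fin.sum_univ_two] at a0 a1 b0 b1
    have hz' := sub_ne_zero.mpr hz
    have c1 : D.α₁ * D.β₁ = 0 := by
      apply (mul_eq_zero.mp (?_ : _ * (D.α₁ * D.β₁) = 0)).resolve_left hz'
      linear_combination D.β₁ * a0 - D.α₁ * b0 + bca M * h0
    have c2 : D.α₂ * D.β₂ = 0 := by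
      apply (mul_eq_zero.mp (?_ : _ * (D.α₂ * D.β₂) = 0)).resolve_left hz'
      linear_combination D.β₂ * a1 - D.α₂ * b1 - bcd M * h0
    have c3 : D.α₁ * D.β₂ = 0 := by
      apply (mul_eq_zero.mp (?_ : _ * (D.α₁ * D.β₂) = 0)).resolve_left hz'
      linear_combination D.β₂ * a0 - D.α₂ * b0 - bcb M * h0 - Complex.exp (Complex.I * Real.pi * D.τ₂) * h0
    have c4 : D.α₂ * D.β₁ = 0 := by linear_combination c3 - h0
    simp at ha hb
    rcases mul_eq_zero.mp c1 with h1 | h1 <;> rcases mul_eq_zero.mp c2 with h2 | h2 <;>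
      rcases mul_eq_zero.mp c3 with h3 | h3 <;> rcases mul_eq_zero.mp c4 with h4 | h4 <;> simp_all
  · simpa [RootData.Δ, hk] using h
  · have hd : (bcb M - bcc M) ^ 2 + 4 * bca M * bcd M = 0 := by
      by_contra hh; exact hs ((isStrictlyRegular_iff M hM).mpr hh)
    have hbc : bcb M + bcc M ≠ 0 := by
      intro hh; rw [hh] at he; simp at he
    rcases h with ⟨ha, r1, r2, r3, r4⟩ | ⟨ha, r1, r2, r3, r4⟩
    · rw [ha] at hd
      have hb : bcb M = bcc M := by
        have : (bcb M - bcc M) ^ 2 = 0 := by linear_combination hd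
        exact sub_eq_zero.mp (pow_eq_zero_iff (two_ne_zero) |>.mp this)
      have hdd : bcd M ≠ 0 := fun h => hp ⟨hb, ha, h⟩
      have hb0 : bcb M ≠ 0 := by
        intro h; apply hbc; rw [← hb, h, add_zero]
      simp [RootData.Δ, r1, r2, r3, r4, hdd, hb0]
    · have : D.Δ = Real.pi * bca M * (bcb M + bcc M) / 2 := by
        rw [RootData.Δ, r1, r2, r3, r4, hk]; ring
      rw [this]
      simp [ha, hbc]

/-- The complex conjugates of the functions `φ̃_k^ν` of the system biorthogonal to the root
functions (see `pairing_rootFun_dualConj`). -/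
def dualConj (D : RootData) (ν : Fin 2) (k : ℤ) (x : ℝ) : Fin 2 → ℂ :=
  ![![(D.β₂ + D.κ * D.α₂ * (Real.pi - x)) / D.Δ *
        Complex.exp (-(Complex.I * D.τ₁ * (Real.pi - x))) * Complex.exp (Complex.I * k * x),
      -(D.β₁ - D.κ * D.α₁ * (Real.pi - x)) / D.Δ *
        Complex.exp (-(Complex.I * D.τ₁ * x)) * Complex.exp (-(Complex.I * k * x))],
    ![-D.α₂ / D.Δ *
        Complex.exp (-(Complex.I * D.τ₂ * (Real.pi - x))) * Complex.exp (Complex.I * k * x),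
      D.α₁ / D.Δ *
        Complex.exp (-(Complex.I * D.τ₂ * x)) * Complex.exp (-(Complex.I * k * x))]] ν

/-- `(1/π) ∫₀^π (f₁ h₁ + f₂ h₂)`, which is the scalar product `⟨f, h̄⟩` of `L²([0,π], ℂ²)`. -/
def pairing (f h : ℝ → Fin 2 → ℂ) : ℂ :=
  (1 / Real.pi : ℂ) * ∫ x in (0 : ℝ)..Real.pi, (f x 0 * h x 0 + f x 1 * h x 1)

/-- The system `dualConj` is biorthogonal to the system of root functions. -/
theorem pairing_rootFun_dualConj (D : RootData) (hΔ : D.Δ ≠ 0) (ν η : Fin 2) (m n : ℤ) :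
    pairing (rootFun D ν (2 * m)) (dualConj D η (2 * n)) = if ν = η ∧ m = n then 1 else 0 := by
  have hpi : (Real.pi : ℂ) ≠ 0 := by exact_mod_cast Real.pi_ne_zero
  have key : ∀ u v : ℝ → ℂ, Continuous u → Continuous v →
      ∫ x in (0 : ℝ)..Real.pi, (u x + v x) =
        ∫ x in (0 : ℝ)..Real.pi, (u (Real.pi - x) + v x) := by
    intro u v hu hv
    have hu' : Continuous fun x : ℝ => u (Real.pi - x) := by fun_prop
    rw [intervalIntegral.integral_add (hu.intervalIntegrable _ _) (hv.intervalIntegrable _ _),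
      intervalIntegral.integral_add (hu'.intervalIntegrable _ _)
        (hv.intervalIntegrable _ _), intervalIntegral.integral_comp_sub_left]
    simp
  have hper : ∀ (l : ℤ), Complex.exp (Complex.I * (2 * l) * Real.pi) = 1 := by
    intro l
    rw [Complex.exp_eq_one_iff]
    exact ⟨l, by ring⟩
  have main : ∀ x : ℝ,
      rootFun D ν (2 * m) (Real.pi - x) 0 * dualConj D η (2 * n) (Real.pi - x) 0
        + rootFun D ν (2 * m) x 1 * dualConj D η (2 * n) x 1
      = (if ν = η then 1 else 0) * Complex.exp (Complex.I * (2 * (m - n)) * x) := by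
    intro x
    have e1 : Complex.exp (-(Complex.I * ((2 * m : ℤ) : ℂ) * ((Real.pi - x : ℝ) : ℂ)))
        = Complex.exp (Complex.I * (2 * m) * x) := by
      have := hper (-m)
      rw [← mul_one (Complex.exp (Complex.I * (2 * m) * x)), ← this, ← Complex.exp_add]
      congr 1; push_cast; ring
    have e2 : Complex.exp (Complex.I * ((2 * n : ℤ) : ℂ) * ((Real.pi - x : ℝ) : ℂ))
        = Complex.exp (-(Complex.I * (2 * n) * x)) := by
      have := hper n
      rw [← mul_one (Complex.exp (-(Complex.I * (2 * n) * x))), ← this, ← Complex.exp_add]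
      congr 1; push_cast; ring
    have e3 : Complex.exp (Complex.I * (2 * (m - n)) * x)
        = Complex.exp (Complex.I * (2 * m) * x) * Complex.exp (-(Complex.I * (2 * n) * x)) := by
      rw [← Complex.exp_add]; congr 1; ring
    have e4 : (Real.pi : ℂ) - ((Real.pi - x : ℝ) : ℂ) = x := by push_cast; ring
    have e5 : ∀ τ : ℂ, Complex.exp (Complex.I * τ * x) * Complex.exp (-(Complex.I * τ * x)) = 1 := by
      intro τ; rw [← Complex.exp_add]; simp
    fin_cases ν <;> fin_cases η <;>
      simp only [rootFun, dualConj, Fin.zero_eta, Fin.mk_one, Matrix.cons_val_zero,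
        Matrix.cons_val_one, Matrix.cons_val_fin_one, e1, e2, e3, e4] <;>
      push_cast
    · have h : ∀ p q : ℂ, (D.α₁ * (D.β₂ + D.κ * D.α₂ * x)
          - D.α₂ * (D.β₁ - D.κ * D.α₁ * (Real.pi - x))) / D.Δ * 1 * (p * q) = 1 * (p * q) := by
        intro p q
        rw [mul_one, show D.α₁ * (D.β₂ + D.κ * D.α₂ * x)
          - D.α₂ * (D.β₁ - D.κ * D.α₁ * (Real.pi - x)) = D.Δ by rw [RootData.Δ]; ring, div_self hΔ]
      rw [← h, ← e5 D.τ₁]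
      ring
    · ring
    · ring
    · have h : ∀ p q : ℂ, ((D.β₂ + D.κ * D.α₂ * x) * D.α₁
          - (D.β₁ - D.κ * D.α₁ * (Real.pi - x)) * D.α₂) / D.Δ * 1 * (p * q) = 1 * (p * q) := by
        intro p q
        rw [mul_one, show (D.β₂ + D.κ * D.α₂ * x) * D.α₁
          - (D.β₁ - D.κ * D.α₁ * (Real.pi - x)) * D.α₂ = D.Δ by rw [RootData.Δ]; ring, div_self hΔ]
      rw [← h, ← e5 D.τ₂]
      ring
  rw [pairing, key _ _ (by fin_cases ν <;> fin_cases η <;> simp [rootFun, dualConj] <;> fun_prop)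
    (by fin_cases ν <;> fin_cases η <;> simp [rootFun, dualConj] <;> fun_prop)]
  simp only [main]
  rw [intervalIntegral.integral_const_mul]
  by_cases hν : ν = η
  · by_cases hmn : m = n
    · subst hmn
      simp [hν, hpi]
    · have hc : Complex.I * (2 * ((m : ℂ) - n)) ≠ 0 := by
        have : (m : ℂ) - n ≠ 0 := sub_ne_zero.mpr (by exact_mod_cast hmn)
        simp [this]
      rw [integral_exp_mul_complex hc]
      have := hper (m - n)
      push_cast at this
      simp [hmn, this]
  · simp [hν]

/-- The coefficient `F_k^ν = ⟨F, φ̃_k^ν⟩` of `F` with respect to the basis of root functions. -/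
def coef (D : RootData) (F : H) (ν : Fin 2) (k : ℤ) : ℂ :=
  pairing (fun x i => F x i) (dualConj D ν k)

/-- `g_k = max (|F_k^1|, |F_k^2|)`. -/
def gSeq (D : RootData) (F : H) (k : ℤ) : ℝ := max ‖coef D F 0 k‖ ‖coef D F 1 k‖

/-- The matrix entry `V_{jk}^{ην} = ⟨V φ_k^ν, φ̃_j^η⟩` of the potential. -/
def entryV (D : RootData) (P Q : ℝ → ℂ) (η ν : Fin 2) (j k : ℤ) : ℂ :=
  pairing (fun x => ![P x * rootFun D ν k x 1, Q x * rootFun D ν k x 0]) (dualConj D η j)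

/-- `w^{ην}(m)`, the common value of all entries `V_{jk}^{ην}` with `j + k = m`
(see `entryV_eq_wSeq`). -/
def wSeq (D : RootData) (P Q : ℝ → ℂ) (η ν : Fin 2) (m : ℤ) : ℂ := entryV D P Q η ν m 0

/-- `V_{jk}^{ην}` depends on `j + k` only. -/
theorem entryV_eq_wSeq (D : RootData) (P Q : ℝ → ℂ) (η ν : Fin 2) (j k : ℤ) :
    entryV D P Q η ν j k = wSeq D P Q η ν (j + k) := by
  have h1 : ∀ x : ℝ, Complex.exp (Complex.I * ((j + k : ℤ) : ℂ) * x)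
      = Complex.exp (Complex.I * j * x) * Complex.exp (Complex.I * k * x) := by
    intro x; rw [← Complex.exp_add]; congr 1; push_cast; ring
  have h2 : ∀ x : ℝ, Complex.exp (-(Complex.I * ((j + k : ℤ) : ℂ) * x))
      = Complex.exp (-(Complex.I * j * x)) * Complex.exp (-(Complex.I * k * x)) := by
    intro x; rw [← Complex.exp_add]; congr 1; push_cast; ring
  unfold wSeq entryV pairing
  congr 2
  funext x
  fin_cases ν <;> fin_cases η <;>
    simp only [rootFun, dualConj, Fin.zero_eta, Fin.mk_one, Matrix.cons_val_zero,
      Matrix.cons_val_one, Matrix.cons_val_fin_one, h1, h2, Int.cast_zero, mul_zero, zero_mul,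
      neg_zero, Complex.exp_zero] <;>
    ring

/-- `r(m) = max {|w^{ην}(m)| : η, ν = 1, 2}`. -/
def rSeq (D : RootData) (P Q : ℝ → ℂ) (m : ℤ) : ℝ :=
  max (max ‖wSeq D P Q 0 0 m‖ ‖wSeq D P Q 0 1 m‖) (max ‖wSeq D P Q 1 0 m‖ ‖wSeq D P Q 1 1 m‖)

/-- A sequence on the even integers is in `ℓ^p`. -/
def InEllP (p : ℝ) (s : ℤ → ℝ) : Prop := Summable fun n : ℤ => |s (2 * n)| ^ p

/-- A sequence on the even integers satisfies `∑ |s(k)|² (log (|k| + e))^δ < ∞`. -/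
def InLogEllTwo (δ : ℝ) (s : ℤ → ℝ) : Prop :=
  Summable fun n : ℤ => |s (2 * n)| ^ 2 * Real.log (|((2 * n : ℤ) : ℝ)| + Real.exp 1) ^ δ

/-! ### Contour integrals -/

/-- The rectangle `R_{NT} = {x + it : |x - Re (τ₁ + τ₂)/2| < N + 1, |t| < T}`. -/
def rect (D : RootData) (N : ℕ) (T : ℝ) : Set ℂ :=
  {z | |z.re - ((D.τ₁ + D.τ₂) / 2).re| < N + 1 ∧ |z.im| < T}

/-- `(1 / 2πi) ∫_{∂R_{NT}} f(z) dz`, the boundary being traversed counterclockwise. -/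
def contour (D : RootData) (N : ℕ) (T : ℝ) (f : ℂ → H) : H :=
  let l : ℝ := ((D.τ₁ + D.τ₂) / 2).re - (N + 1)
  let r : ℝ := ((D.τ₁ + D.τ₂) / 2).re + (N + 1)
  (1 / (2 * Real.pi * Complex.I) : ℂ) •
    ((∫ x in l..r, f ((x : ℂ) + ((-T : ℝ) : ℂ) * Complex.I))
      - (∫ x in l..r, f ((x : ℂ) + (T : ℂ) * Complex.I))
      + Complex.I • (∫ t in (-T)..T, f ((r : ℂ) + (t : ℂ) * Complex.I))
      - Complex.I • (∫ t in (-T)..T, f ((l : ℂ) + (t : ℂ) * Complex.I)))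

/-- `S_N F = (1 / 2πi) ∫_{∂R_{NT}} (z - L)⁻¹ F dz`. -/
def SN (M : Matrix (Fin 2) (Fin 4) ℂ) (P Q : ℝ → ℂ) (D : RootData) (N : ℕ) (T : ℝ) (F : H) : H :=
  contour D N T fun z => resolv M P Q z F

/-- `S_N^0 F = (1 / 2πi) ∫_{∂R_{NT}} (z - L⁰)⁻¹ F dz`. -/
def SN₀ (M : Matrix (Fin 2) (Fin 4) ℂ) (D : RootData) (N : ℕ) (T : ℝ) (F : H) : H :=
  contour D N T fun z => resolv₀ M z F

/-- `A_N F = (1 / 2πi) ∫_{∂R_{NT}} R⁰_z V R⁰_z F dz`. -/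
def AN (M : Matrix (Fin 2) (Fin 4) ℂ) (P Q : ℝ → ℂ) (D : RootData) (N : ℕ) (T : ℝ) (F : H) : H :=
  contour D N T fun z => resolv₀ M z (mulV P Q (resolv₀ M z F))

end Dirac1D

end

open Dirac1D

noncomputable section

namespace Dirac1D

open scoped ENNReal

/-! ### Weighted sums over the even integers -/

/-! In coordinates with respect to the root functions the free resolvent R⁰ is block diagonal, and
on the contours its n-th block at z has size comparable with 1/(1 + |x - 2n| + |t|), where x is Re z
measured from the centre of the rectangle and t = Im z. The potential V is a Hankel matrix with
entries w(j + k). Throughout, an integer n stands for the even index 2n, which explains the factors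
2 in the weights. The ℓ¹ norm of the coefficients of R⁰VR⁰F is therefore at most a constant times
the double sum `dblSum` of wt(j) r(j + k) wt(k) g(k), and this ℓ¹ norm dominates the sup norm
(`supNorm_synthL_le`).

Cauchy–Schwarz bounds the double sum by a single sum over either g or r, with weight (1 +
|t|)^(-1/2) wt (`tsum_tsum_le_left`, `tsum_tsum_le_right`). Integrated over a vertical line this
weight becomes (1 + |x - 2k|)^(-1/2), up to a constant (`lintegral_decay_mul_wt_le`). So it suffices
that the convolution of g, or of r, with the inverse square root tends to zero at infinity.
Membership in ℓ² does not guarantee this, but each of the conditions (a)–(d) does, by Hölder's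
inequality (`tendsto_tsum_of_ellP`, `tendsto_tsum_of_log`).

For large |Im z| the integrands are holomorphic and O((1 + |t|)^(-1/2)). The horizontal sides can
thus be pushed to infinity, where they contribute nothing; only the two vertical lines remain, and
the bound does not depend on T (`enorm_rectInt_le_of_decay`).

For S_N - S_N⁰ one writes (z - L)⁻¹ = R⁰(1 - VR⁰)⁻¹. On far vertical lines VR⁰ is merely bounded,
but (VR⁰)² = V(R⁰VR⁰) is small because r is in ℓ² (`exists_isFar`), so 1 - VR⁰ is invertible. With S
its inverse, SF = F + VR⁰F + S(VR⁰)²F, whence the difference of the resolvents is R⁰VR⁰F +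
R⁰SV(R⁰VR⁰F), again controlled by the ℓ¹ norm of R⁰VR⁰F (`enorm_resDiff_le`).

V is in general unbounded on L². The space ℓ¹ of coefficients circumvents this: R⁰ maps L² into ℓ¹
(`freeRes`), and V maps ℓ¹, whose expansions are bounded functions, into L² (`potL`). Of the basis
property only biorthogonality, Bessel's inequality and completeness are needed; the last two follow
from Fourier series on [0, π] through `fold`. -/

/-- Hölder's inequality for sums in `[0, ∞]`. -/
theorem tsum_mul_le_Lp_mul_Lq {ι : Type*} {p q : ℝ} (hpq : p.HolderConjugate q)
    (f g : ι → ℝ≥0∞) :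
    ∑' i, f i * g i ≤ (∑' i, f i ^ p) ^ (1 / p) * (∑' i, g i ^ q) ^ (1 / q) := by
  let _ : MeasurableSpace ι := ⊤
  simpa [lintegral_count] using ENNReal.lintegral_mul_le_Lp_mul_Lq (Measure.count : Measure ι) hpq
    (f := f) (g := g) measurable_from_top.aemeasurable measurable_from_top.aemeasurable

/-- The `ℓ²` norm of a sequence in `[0, ∞]`. -/
def ellTwo {ι : Type*} (f : ι → ℝ≥0∞) : ℝ≥0∞ := (∑' i, f i ^ (2 : ℝ)) ^ (1 / (2 : ℝ))

theorem tsum_mul_le_ellTwo {ι : Type*} (f g : ι → ℝ≥0∞) :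
    ∑' i, f i * g i ≤ ellTwo f * ellTwo g :=
  tsum_mul_le_Lp_mul_Lq Real.HolderConjugate.two_two f g

theorem ellTwo_comp_equiv {ι κ : Type*} (e : κ ≃ ι) (f : ι → ℝ≥0∞) :
    ellTwo (fun i => f (e i)) = ellTwo f := by
  rw [ellTwo, ellTwo, e.tsum_eq (fun i => f i ^ (2 : ℝ))]

/-- A sum of a decreasing function over the even integers is controlled by its sum over `ℕ`. -/
theorem tsum_abs_sub_two_mul_le {u : ℝ → ℝ≥0∞} (hu : AntitoneOn u (Set.Ici 0)) (x : ℝ) :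
    ∑' k : ℤ, u |x - 2 * k| ≤ 2 * ∑' n : ℕ, u n := by
  -- With k = m - n the distance |x - 2k| is at least 2n for n ≥ 0, and with k = m + n + 1 it is
  -- again at least 2n. Each half of the sum is therefore dominated by the sum over ℕ.
  set m : ℤ := ⌊x / 2⌋
  have h1 : (m : ℝ) ≤ x / 2 := Int.floor_le _
  have h2 : x / 2 < m + 1 := Int.lt_floor_add_one _
  rw [← (Equiv.subLeft m).tsum_eq, tsum_of_nat_of_neg_add_one ENNReal.summable ENNReal.summable,
    two_mul]
  refine add_le_add (ENNReal.tsum_le_tsum fun n => ?_) (ENNReal.tsum_le_tsum fun n => ?_) <;>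
    refine hu (Set.mem_Ici.mpr n.cast_nonneg) (Set.mem_Ici.mpr (abs_nonneg _)) ?_
  · refine le_trans ?_ (le_abs_self _)
    have := n.cast_nonneg (α := ℝ)
    simp only [Equiv.subLeft_apply]
    push_cast
    linarith
  · refine le_trans ?_ (neg_le_abs _)
    have := n.cast_nonneg (α := ℝ)
    simp only [Equiv.subLeft_apply]
    push_cast
    linarith

/-- `(1 + |x - 2k| + |t|)⁻¹`, comparable with the size of `(x + it - 2k)⁻¹`. -/
def wt (x t : ℝ) (k : ℤ) : ℝ≥0∞ := ENNReal.ofReal ((1 + |x - 2 * k| + |t|)⁻¹)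

/-- `(1 + |t|)^(-1/2)`. -/
def decay (t : ℝ) : ℝ≥0∞ := ENNReal.ofReal ((1 + |t|) ^ (-(1 / 2) : ℝ))

theorem decay_sq (t : ℝ) : decay t ^ (2 : ℝ) = ENNReal.ofReal ((1 + |t|)⁻¹) := by
  have : 0 < 1 + |t| := by positivity
  rw [decay, ENNReal.ofReal_rpow_of_nonneg (by positivity) (by norm_num), ← Real.rpow_mul this.le]
  norm_num [Real.rpow_neg_one]

/-- Telescoping: since s ≥ 1 gives s + n + 1 ≤ 2(s + n), each term is at most 2((s + n)⁻¹ - (s + n +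
1)⁻¹). -/
theorem tsum_inv_sq_le {s : ℝ} (hs : 1 ≤ s) :
    ∑' n : ℕ, ENNReal.ofReal ((s + n)⁻¹ ^ 2) ≤ ENNReal.ofReal (2 * s⁻¹) := by
  refine ENNReal.tsum_le_of_sum_range_le fun N => ?_
  rw [← ENNReal.ofReal_sum_of_nonneg fun _ _ => by positivity]
  refine ENNReal.ofReal_le_ofReal ?_
  suffices ∑ n ∈ Finset.range N, (s + n)⁻¹ ^ 2 ≤ 2 * s⁻¹ - 2 * (s + N)⁻¹ by
    have : 0 ≤ 2 * (s + N)⁻¹ := by positivity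
    linarith
  induction N with
  | zero => simp
  | succ N ih =>
    rw [Finset.sum_range_succ]
    refine (add_le_add_left ih _).trans ?_
    have hN : (0 : ℝ) ≤ N := N.cast_nonneg
    have e : 2 * (s + N)⁻¹ - 2 * (s + (N + 1 : ℕ))⁻¹ = 2 * ((s + N)⁻¹ * (s + N + 1)⁻¹) := by
      push_cast
      field_simp
      ring
    have : (s + N)⁻¹ ≤ 2 * (s + N + 1)⁻¹ := by
      rw [← div_eq_mul_inv, inv_eq_one_div, div_le_div_iff₀ (by linarith) (by linarith)]
      linarith
    have h3 : 0 ≤ (s + N)⁻¹ := by positivity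
    nlinarith [mul_le_mul_of_nonneg_left this h3]

/-- The squared weights sum to O(1/(1 + |t|)). The square root of this is the gain (1 + |t|)^(-1/2)
that accompanies every use of Cauchy–Schwarz below. -/
theorem ellTwo_wt_le (x t : ℝ) : ellTwo (wt x t) ≤ 2 * decay t := by
  have hs : 1 ≤ 1 + |t| := by simp
  have h : ∑' k, wt x t k ^ (2 : ℝ) ≤ 4 * decay t ^ (2 : ℝ) := by
    have e : ∀ k, wt x t k ^ (2 : ℝ) =
        (fun y => ENNReal.ofReal ((1 + |t| + y)⁻¹ ^ 2)) |x - 2 * k| := fun k => by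
      rw [wt, ENNReal.rpow_ofNat, ← ENNReal.ofReal_pow (by positivity)]
      congr 3
      ring
    simp_rw [e]
    refine (tsum_abs_sub_two_mul_le (u := fun y => ENNReal.ofReal ((1 + |t| + y)⁻¹ ^ 2)) ?_ x).trans ?_
    · intro a ha b hb hab
      simp only [Set.mem_Ici] at ha hb
      refine ENNReal.ofReal_le_ofReal ?_
      gcongr
    · rw [decay_sq]
      refine (mul_le_mul_right (tsum_inv_sq_le hs) _).trans_eq ?_
      rw [ENNReal.ofReal_mul (by norm_num), ← mul_assoc]
      norm_num
  calc ellTwo (wt x t) ≤ (4 * decay t ^ (2 : ℝ)) ^ (1 / (2 : ℝ)) :=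
        ENNReal.rpow_le_rpow h (by norm_num)
    _ = 2 * decay t := by
        rw [ENNReal.mul_rpow_of_nonneg _ _ (by norm_num), ← ENNReal.rpow_mul]
        norm_num
        rw [show (4 : ℝ≥0∞) = 2 ^ (2 : ℝ) by norm_num, ← ENNReal.rpow_mul]
        norm_num

theorem tsum_wt_mul_le (x t : ℝ) (g : ℤ → ℝ≥0∞) :
    ∑' k, wt x t k * g k ≤ 2 * decay t * ellTwo g :=
  (tsum_mul_le_ellTwo _ _).trans (mul_le_mul_left (ellTwo_wt_le x t) _)

/-- Partial fractions, 1/(AB) = (1/A + 1/B)/(A + B), and the triangle inequality for (x - 2j) + (x -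
2k) = 2x - 2(j + k). This produces a weight in j + k, the variable on which the Hankel matrix
depends. -/
theorem wt_mul_wt_le (x t : ℝ) (j k : ℤ) :
    wt x t j * wt x t k ≤ wt (2 * x) t (j + k) * (wt x t j + wt x t k) := by
  have hj : 0 < 1 + |x - 2 * j| + |t| := by positivity
  have hk : 0 < 1 + |x - 2 * k| + |t| := by positivity
  have hm : 0 < 1 + |2 * x - 2 * (j + k : ℤ)| + |t| := by positivity
  simp only [wt]
  rw [← ENNReal.ofReal_mul (by positivity), ← ENNReal.ofReal_add (by positivity) (by positivity),
    ← ENNReal.ofReal_mul (by positivity)]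
  refine ENNReal.ofReal_le_ofReal ?_
  rw [inv_add_inv hj.ne' hk.ne', ← mul_inv, ← div_eq_inv_mul, div_div, inv_eq_one_div,
    div_le_div_iff₀ (by positivity) (by positivity)]
  have : |2 * x - 2 * (j + k : ℤ)| ≤ |x - 2 * j| + |x - 2 * k| := by
    refine le_trans (le_of_eq ?_) (abs_add_le _ _)
    push_cast
    congr 1
    ring
  have ht := abs_nonneg t
  nlinarith [mul_pos hj hk]

/-- The double sums that control `R⁰ V R⁰`, estimated in terms of the coefficients of the function. -/
theorem tsum_tsum_le_left (x t : ℝ) (r g : ℤ → ℝ≥0∞) :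
    ∑' j, wt x t j * ∑' k, r (j + k) * (wt x t k * g k) ≤
      2 * ellTwo r * ∑' k, g k * (decay t * wt x t k) := by
  have : ∀ j, wt x t j * ∑' k, r (j + k) * (wt x t k * g k) =
      ∑' k, wt x t j * r (j + k) * (wt x t k * g k) := fun j => by
    rw [← ENNReal.tsum_mul_left]
    simp_rw [mul_assoc]
  simp_rw [this]
  -- For fixed k the sum over j is estimated by Cauchy–Schwarz; the translate of r has the same ℓ²
  -- norm as r, and the weight at k survives.
  rw [ENNReal.tsum_comm, ← ENNReal.tsum_mul_left]
  refine ENNReal.tsum_le_tsum fun k => ?_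
  rw [ENNReal.tsum_mul_right]
  refine (mul_le_mul_left (tsum_wt_mul_le x t fun j => r (j + k)) _).trans_eq ?_
  rw [show (ellTwo fun j => r (j + k)) = ellTwo r from ellTwo_comp_equiv (Equiv.addRight k) r]
  ring

/-- The double sums that control `R⁰ V R⁰`, estimated in terms of those of the potential. -/
theorem tsum_tsum_le_right (x t : ℝ) (r g : ℤ → ℝ≥0∞) :
    ∑' j, wt x t j * ∑' k, r (j + k) * (wt x t k * g k) ≤
      4 * ellTwo g * ∑' m, r m * (decay t * wt (2 * x) t m) := by
  have h1 : ∀ j, wt x t j * ∑' k, r (j + k) * (wt x t k * g k) ≤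
      ∑' k, r (j + k) * wt (2 * x) t (j + k) * ((wt x t j + wt x t k) * g k) := fun j => by
    rw [← ENNReal.tsum_mul_left]
    refine ENNReal.tsum_le_tsum fun k => ?_
    calc wt x t j * (r (j + k) * (wt x t k * g k))
        = r (j + k) * g k * (wt x t j * wt x t k) := by ring
      _ ≤ r (j + k) * g k * (wt (2 * x) t (j + k) * (wt x t j + wt x t k)) :=
          mul_le_mul_right (wt_mul_wt_le x t j k) _
      _ = _ := by ring
  refine (ENNReal.tsum_le_tsum h1).trans ?_
  -- Substitution m = j + k. The factor depending on m alone comes out of the sum over k, and what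
  -- is left there is twice a Cauchy–Schwarz sum of g against weights.
  have h2 : ∀ k, ∑' j, r (j + k) * wt (2 * x) t (j + k) * ((wt x t j + wt x t k) * g k) =
      ∑' m, r m * wt (2 * x) t m * ((wt x t (m - k) + wt x t k) * g k) := fun k => by
    rw [← (Equiv.addRight k).tsum_eq
      fun m => r m * wt (2 * x) t m * ((wt x t (m - k) + wt x t k) * g k)]
    simp
  rw [ENNReal.tsum_comm]
  simp_rw [h2]
  rw [ENNReal.tsum_comm, ← ENNReal.tsum_mul_left]
  refine ENNReal.tsum_le_tsum fun m => ?_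
  rw [ENNReal.tsum_mul_left]
  simp_rw [add_mul]
  rw [ENNReal.tsum_add]
  have h3 : ∑' k, wt x t (m - k) * g k ≤ 2 * decay t * ellTwo g := by
    refine (tsum_mul_le_ellTwo _ _).trans (mul_le_mul_left ?_ _)
    exact (ellTwo_comp_equiv (Equiv.subLeft m) (wt x t)).trans_le (ellTwo_wt_le x t)
  refine (mul_le_mul_right (add_le_add h3 (tsum_wt_mul_le x t g)) _).trans_eq ?_
  ring

/-! ### Integrals along vertical lines -/

theorem lintegral_comp_abs_le {f : ℝ → ℝ≥0∞} (hf : Measurable f) :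
    ∫⁻ t, f |t| = 2 * ∫⁻ t in Set.Ioi 0, f t := by
  have hm : Measurable fun t : ℝ => f |t| := hf.comp measurable_abs
  rw [← lintegral_add_compl (μ := volume) _ (measurableSet_Ioi (a := (0 : ℝ))), Set.compl_Ioi, two_mul]
  congr 1
  · exact setLIntegral_congr_fun measurableSet_Ioi fun t ht => by
      simp [abs_of_pos (Set.mem_Ioi.mp ht)]
  · have := (Measure.measurePreserving_neg (volume : Measure ℝ)).setLIntegral_comp_preimage
      (measurableSet_Ici (a := (0 : ℝ))) hm
    simp only [Set.neg_preimage, Set.neg_Ici, neg_zero, abs_neg] at this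
    rw [this, setLIntegral_congr Ioi_ae_eq_Ici.symm]
    exact setLIntegral_congr_fun measurableSet_Ioi fun t ht => by
      simp [abs_of_pos (Set.mem_Ioi.mp ht)]

/-- An explicit arctangent integral. The exponent 1/2 on the right is what makes ℓ² the borderline
case for the convergence of the sums below. -/
theorem lintegral_decay_mul_wt_le (x : ℝ) (k : ℤ) :
    ∫⁻ t, decay t * wt x t k ≤
      ENNReal.ofReal (4 * Real.pi) * ENNReal.ofReal ((1 + |x - 2 * k|) ^ (-(1 / 2) : ℝ)) := by
  set b : ℝ := 1 + |x - 2 * k| with hb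
  have hb1 : 1 ≤ b := by simp [hb]
  have hb0 : 0 < b := by linarith
  have e : ∀ t, decay t * wt x t k =
      (fun s => ENNReal.ofReal ((1 + s) ^ (-(1 / 2) : ℝ) * (b + s)⁻¹)) |t| := fun t => by
    rw [decay, wt, ← ENNReal.ofReal_mul (by positivity)]
  simp_rw [e]
  rw [lintegral_comp_abs_le (f := fun s => ENNReal.ofReal ((1 + s) ^ (-(1 / 2) : ℝ) * (b + s)⁻¹))
    (by fun_prop)]
  -- G' dominates the integrand on the half-line because b ≥ 1 gives b + 1 + s ≤ 2(b + s). The limit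
  -- of G at infinity is 2π/√b, and the two half-lines together yield 4π/√b.
  set G : ℝ → ℝ := fun s => 4 * (√b)⁻¹ * Real.arctan (√(1 + s) * (√b)⁻¹) with hG
  set G' : ℝ → ℝ := fun s => 2 * (√(1 + s))⁻¹ * (b + 1 + s)⁻¹ with hG'
  have hbs : 0 < √b := Real.sqrt_pos.mpr hb0
  have hbb : √b ^ 2 = b := Real.sq_sqrt hb0.le
  have hder : ∀ s ∈ Set.Ioi (0 : ℝ), HasDerivAt G (G' s) s := fun s hs => by
    have hs : 0 < s := hs
    have h1 : 0 < 1 + s := by linarith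
    have h1s : 0 < √(1 + s) := Real.sqrt_pos.mpr h1
    have h1b : √(1 + s) ^ 2 = 1 + s := Real.sq_sqrt h1.le
    have := ((((((hasDerivAt_id s).const_add 1).sqrt h1.ne').mul_const (√b)⁻¹).arctan).const_mul
      (4 * (√b)⁻¹))
    refine HasDerivAt.congr_deriv (f' := _) this ?_
    simp only [hG', id]
    rw [mul_pow, inv_pow, hbb, h1b]
    have : (0:ℝ) < b + 1 + s := by linarith
    field_simp
    rw [hbb]
    ring
  have hpos : ∀ s ∈ Set.Ioi (0 : ℝ), 0 ≤ G' s := fun s hs => by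
    have hs : 0 < s := hs
    simp only [hG']
    positivity
  have hlim : Tendsto G atTop (𝓝 (4 * (√b)⁻¹ * (Real.pi / 2))) := by
    refine Tendsto.const_mul _ ?_
    refine (tendsto_nhdsWithin_iff.mp Real.tendsto_arctan_atTop).1.comp ?_
    refine Tendsto.atTop_mul_const (by positivity) ?_
    exact Real.tendsto_sqrt_atTop.comp (tendsto_const_nhds.add_atTop tendsto_id)
  have hc : ContinuousWithinAt G (Set.Ici 0) 0 := by
    refine Continuous.continuousWithinAt ?_
    simp only [hG]
    fun_prop
  have hint := integral_Ioi_of_hasDerivAt_of_nonneg hc hder hpos hlim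
  have hinb := integrableOn_Ioi_deriv_of_nonneg hc hder hpos hlim
  have hle : ∫⁻ s in Set.Ioi 0, ENNReal.ofReal ((1 + s) ^ (-(1 / 2) : ℝ) * (b + s)⁻¹) ≤
      ∫⁻ s in Set.Ioi 0, ENNReal.ofReal (G' s) := by
    refine setLIntegral_mono' measurableSet_Ioi fun s hs => ENNReal.ofReal_le_ofReal ?_
    have hs : 0 < s := hs
    have h1 : 0 < 1 + s := by linarith
    rw [Real.rpow_neg h1.le, ← Real.sqrt_eq_rpow]
    simp only [hG']
    rw [mul_comm 2, mul_assoc]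
    refine mul_le_mul_of_nonneg_left ?_ (by positivity)
    rw [← div_eq_mul_inv, inv_eq_one_div, div_le_div_iff₀ (by linarith) (by linarith)]
    linarith
  refine (mul_le_mul_right hle _).trans ?_
  rw [← ofReal_integral_eq_lintegral_ofReal hinb
    ((ae_restrict_iff' measurableSet_Ioi).mpr (ae_of_all _ hpos)), hint,
    show (2 : ℝ≥0∞) = ENNReal.ofReal 2 by norm_num, ← ENNReal.ofReal_mul (by norm_num),
    ← ENNReal.ofReal_mul (by positivity)]
  refine ENNReal.ofReal_le_ofReal ?_
  rw [Real.rpow_neg hb0.le, ← Real.sqrt_eq_rpow]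
  have h0 : 0 ≤ G 0 := by
    simp only [hG]
    exact mul_nonneg (by positivity) (Real.arctan_nonneg.mpr (by positivity))
  have : 2 * (4 * (√b)⁻¹ * (Real.pi / 2)) = 4 * Real.pi * (√b)⁻¹ := by ring
  linarith

/-! ### Weighted sums that tend to zero -/

theorem sum_add_tsum_notMem {ι : Type*} (f : ι → ℝ≥0∞) (K : Finset ι) :
    ∑ k ∈ K, f k + ∑' k : {k // k ∉ K}, f k = ∑' k, f k := by
  have := Summable.tsum_add_tsum_compl (f := f) (s := {k | k ∈ K}) ENNReal.summable ENNReal.summable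
  rw [← this, ← Finset.tsum_subtype]
  rfl

/-- A weighted sum with uniformly bounded dual weights tends to zero if each of its terms does. -/
theorem tendsto_tsum_of_holder {α : Type*} {l : Filter α} {p q : ℝ} (hpq : p.HolderConjugate q)
    (s v : ℤ → ℝ≥0∞) (W : α → ℤ → ℝ≥0∞) (hs : ∀ k, s k ≠ ⊤) (hv0 : ∀ k, v k ≠ 0)
    (hv : ∀ k, v k ≠ ⊤) (hsv : ∑' k, (s k * v k) ^ p ≠ ⊤) {C : ℝ≥0∞} (hC : C ≠ ⊤)
    (hW : ∀ x, ∑' k, (W x k * (v k)⁻¹) ^ q ≤ C) (hlim : ∀ k, Tendsto (fun x => W x k) l (𝓝 0)) :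
    Tendsto (fun x => ∑' k, s k * W x k) l (𝓝 0) := by
  rw [ENNReal.tendsto_nhds_zero]
  intro ε hε
  -- Outside a large finite set Hölder's inequality makes the sum small uniformly in the parameter;
  -- on the finite set the termwise limits suffice.
  have htail : Tendsto (fun K : Finset ℤ =>
      (∑' k : {k // k ∉ K}, (s k * v k) ^ p) ^ (1 / p) * C ^ (1 / q)) atTop (𝓝 0) := by
    have h1 := (ENNReal.continuous_rpow_const (y := 1 / p)).continuousAt.tendsto.comp
      (ENNReal.tendsto_tsum_compl_atTop_zero hsv)
    rw [ENNReal.zero_rpow_of_pos (one_div_pos.mpr hpq.pos)] at h1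
    simpa using ENNReal.Tendsto.mul_const (b := C ^ (1 / q)) h1
      (Or.inr (ENNReal.rpow_ne_top_of_nonneg (one_div_pos.mpr hpq.symm.pos).le hC))
  obtain ⟨K, hK⟩ := ((ENNReal.tendsto_nhds_zero.mp htail) (ε / 2) (ENNReal.half_pos hε.ne')).exists
  have hfin : Tendsto (fun x => ∑ k ∈ K, s k * W x k) l (𝓝 0) := by
    have := tendsto_finsetSum K fun k _ =>
      ENNReal.Tendsto.const_mul (a := s k) (hlim k) (Or.inr (hs k))
    simpa using this
  filter_upwards [(ENNReal.tendsto_nhds_zero.mp hfin) (ε / 2) (ENNReal.half_pos hε.ne')] with x hx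
  rw [← sum_add_tsum_notMem _ K, ← ENNReal.add_halves ε]
  refine add_le_add hx (le_trans (b := (∑' k : {k // k ∉ K}, (s k * v k) ^ p) ^ (1 / p) *
    C ^ (1 / q)) ?_ hK)
  have hCk : ∑' k : {k // k ∉ K}, (W x k * (v k)⁻¹) ^ q ≤ C :=
    (ENNReal.tsum_comp_le_tsum_of_injective Subtype.val_injective
      fun k => (W x k * (v k)⁻¹) ^ q).trans (hW x)
  -- The weight v is moved from one Hölder factor to the other.
  have e : ∀ k : {k // k ∉ K}, s k * W x k = (s k * v k) * (W x k * (v k)⁻¹) := fun k => by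
    rw [mul_mul_mul_comm, mul_comm (v k), mul_assoc (s k),
      ENNReal.inv_mul_cancel (hv0 k) (hv k), mul_one]
  simp_rw [e]
  exact (tsum_mul_le_Lp_mul_Lq hpq _ _).trans (mul_le_mul_right
    (ENNReal.rpow_le_rpow hCk (one_div_pos.mpr hpq.symm.pos).le) _)

theorem tendsto_one_add_abs_rpow {a : ℝ} (ha : 0 < a) (k : ℤ) :
    Tendsto (fun x : ℝ => ENNReal.ofReal ((1 + |x - 2 * k|) ^ (-a))) (cocompact ℝ) (𝓝 0) := by
  rw [← ENNReal.ofReal_zero]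
  refine (ENNReal.continuous_ofReal.tendsto 0).comp ((tendsto_rpow_neg_atTop ha).comp ?_)
  refine tendsto_const_nhds.add_atTop ?_
  have h1 : Tendsto (fun x : ℝ => |x| - |2 * (k : ℝ)|) (cocompact ℝ) atTop :=
    tendsto_atTop_add_const_right _ _ tendsto_norm_cocompact_atTop
  exact tendsto_atTop_mono (fun x => abs_sub_abs_le_abs_sub _ _) h1

theorem tsum_nat_one_add_rpow_ne_top {a : ℝ} (ha : 1 < a) :
    ∑' n : ℕ, ENNReal.ofReal ((1 + (n : ℝ)) ^ (-a)) ≠ ⊤ := by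
  have h : Summable fun n : ℕ => (1 + (n : ℝ)) ^ (-a) := by
    have := (summable_nat_add_iff 1).mpr (Real.summable_nat_rpow.mpr (neg_lt_neg ha))
    refine this.congr fun n => ?_
    push_cast
    rw [add_comm]
  exact h.tsum_ofReal_ne_top

/-- Decay of weighted sums of a sequence in `ℓ^p`. -/
theorem tendsto_tsum_of_ellP {p q a : ℝ} (hpq : p.HolderConjugate q) (ha : 1 < a * q)
    (s : ℤ → ℝ≥0∞) (hs : ∑' k, s k ^ p ≠ ⊤) :
    Tendsto (fun x : ℝ => ∑' k, s k * ENNReal.ofReal ((1 + |x - 2 * k|) ^ (-a)))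
      (cocompact ℝ) (𝓝 0) := by
  have hq := hpq.symm.pos
  have ha0 : 0 < a := pos_of_mul_pos_left (by linarith) hq.le
  -- No auxiliary weight is needed: a q > 1 alone bounds the dual sums uniformly in x.
  refine tendsto_tsum_of_holder hpq s (fun _ => 1) _ (fun k hk => ?_) (by simp) (by simp)
    (by simpa using hs) (C := 2 * ∑' n : ℕ, ENNReal.ofReal ((1 + (n : ℝ)) ^ (-(a * q))))
    (ENNReal.mul_ne_top (by simp) (tsum_nat_one_add_rpow_ne_top ha)) (fun x => ?_)
    (tendsto_one_add_abs_rpow ha0)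
  · refine ENNReal.ne_top_of_tsum_ne_top hs k ?_
    rw [hk, ENNReal.top_rpow_of_pos hpq.pos]
  · have e : ∀ k : ℤ, (ENNReal.ofReal ((1 + |x - 2 * k|) ^ (-a)) * 1⁻¹) ^ q =
        (fun y => ENNReal.ofReal ((1 + y) ^ (-(a * q)))) |x - 2 * k| := fun k => by
      rw [inv_one, mul_one, ENNReal.ofReal_rpow_of_nonneg (by positivity) hq.le,
        ← Real.rpow_mul (by positivity), neg_mul]
    simp_rw [e]
    refine tsum_abs_sub_two_mul_le (u := fun y => ENNReal.ofReal ((1 + y) ^ (-(a * q)))) ?_ x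
    intro y hy z hz hyz
    simp only [Set.mem_Ici] at hy hz
    exact ENNReal.ofReal_le_ofReal
      (Real.rpow_le_rpow_of_nonpos (by linarith) (by linarith) (by linarith))

theorem one_le_log_add_exp_one {y : ℝ} (hy : 0 ≤ y) : 1 ≤ Real.log (y + Real.exp 1) := by
  rw [Real.le_log_iff_exp_le (by positivity)]
  linarith

/-- `1 / ((1 + y) log (y + e) ^ δ)`. -/
def logWt (δ y : ℝ) : ℝ≥0∞ := ENNReal.ofReal ((1 + y)⁻¹ * (Real.log (y + Real.exp 1) ^ δ)⁻¹)

theorem antitoneOn_logWt {δ : ℝ} (hδ : 0 ≤ δ) : AntitoneOn (logWt δ) (Set.Ici 0) := by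
  intro y hy z hz hyz
  simp only [Set.mem_Ici] at hy hz
  have h1 := one_le_log_add_exp_one hy
  have : Real.log (y + Real.exp 1) ≤ Real.log (z + Real.exp 1) :=
    Real.log_le_log (by positivity) (by linarith)
  refine ENNReal.ofReal_le_ofReal ?_
  have h2 : 0 < Real.log (z + Real.exp 1) := by linarith
  gcongr

/-- Cauchy condensation: the k-th condensed term is at most (k log 2)^(-δ), which is summable
exactly because δ > 1. -/
theorem tsum_logWt_ne_top {δ : ℝ} (hδ : 1 < δ) : ∑' n : ℕ, logWt δ n ≠ ⊤ := by
  have hl : ∀ n : ℕ, 1 ≤ Real.log (n + Real.exp 1) := fun n => one_le_log_add_exp_one n.cast_nonneg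
  have h : Summable fun n : ℕ => (1 + (n : ℝ))⁻¹ * (Real.log (n + Real.exp 1) ^ δ)⁻¹ := by
    refine (summable_condensed_iff_of_nonneg (fun n => ?_) fun m n _ hmn => ?_).mp ?_
    · have := hl n
      positivity
    · have h1 := hl m
      have h2 : (m : ℝ) ≤ n := by exact_mod_cast hmn
      have : Real.log (m + Real.exp 1) ≤ Real.log (n + Real.exp 1) :=
        Real.log_le_log (by positivity) (by linarith)
      have h3 : 0 < Real.log (n + Real.exp 1) := by linarith
      gcongr
    · have hs : Summable fun k : ℕ => (Real.log 2 ^ δ)⁻¹ * (k : ℝ) ^ (-δ) :=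
        (Real.summable_nat_rpow.mpr (neg_lt_neg hδ)).mul_left _
      -- The shift by one removes k = 0, where the majorant has the default value 0 and dominates
      -- nothing.
      refine (summable_nat_add_iff 1).mp (Summable.of_nonneg_of_le (fun k => ?_) (fun k => ?_)
        ((summable_nat_add_iff 1).mpr hs))
      · have := hl (2 ^ (k + 1))
        positivity
      · have h0 : 0 < Real.log 2 := Real.log_pos one_lt_two
        have hk : 0 < ((k + 1 : ℕ) : ℝ) := by positivity
        have h1 : (k + 1 : ℕ) * Real.log 2 ≤ Real.log ((2 ^ (k + 1) : ℕ) + Real.exp 1) := by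
          rw [← Real.log_pow]
          refine Real.log_le_log (by positivity) ?_
          push_cast
          have := Real.exp_pos 1
          linarith
        calc (2 : ℝ) ^ (k + 1) * ((1 + ((2 ^ (k + 1) : ℕ) : ℝ))⁻¹ *
              (Real.log ((2 ^ (k + 1) : ℕ) + Real.exp 1) ^ δ)⁻¹)
            = ((2 : ℝ) ^ (k + 1) * (1 + 2 ^ (k + 1))⁻¹) *
              (Real.log ((2 ^ (k + 1) : ℕ) + Real.exp 1) ^ δ)⁻¹ := by push_cast; ring
          _ ≤ 1 * (((k + 1 : ℕ) * Real.log 2) ^ δ)⁻¹ := by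
              refine mul_le_mul ?_ ?_ (by have := hl (2 ^ (k + 1)); positivity) zero_le_one
              · rw [← div_eq_mul_inv, div_le_one (by positivity)]
                linarith
              · have := Real.rpow_le_rpow (by positivity) h1 (by linarith : 0 ≤ δ)
                gcongr
          _ = (Real.log 2 ^ δ)⁻¹ * ((k + 1 : ℕ) : ℝ) ^ (-δ) := by
              rw [Real.mul_rpow hk.le h0.le, Real.rpow_neg hk.le, mul_inv]
              ring
  exact h.tsum_ofReal_ne_top

/-- Decay of weighted sums of a sequence in `ℓ²` with a logarithmic weight. -/
theorem tendsto_tsum_of_log {δ : ℝ} (hδ : 1 < δ) (s : ℤ → ℝ≥0∞)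
    (hs : ∑' k : ℤ, s k ^ (2 : ℝ) *
      ENNReal.ofReal (Real.log (|((2 * k : ℤ) : ℝ)| + Real.exp 1) ^ δ) ≠ ⊤) :
    Tendsto (fun x : ℝ => ∑' k, s k * ENNReal.ofReal ((1 + |x - 2 * k|) ^ (-(1 / 2) : ℝ)))
      (cocompact ℝ) (𝓝 0) := by
  set L : ℤ → ℝ := fun k => Real.log (|((2 * k : ℤ) : ℝ)| + Real.exp 1) with hL
  have hL1 : ∀ k, 1 ≤ L k := fun k => one_le_log_add_exp_one (abs_nonneg _)
  have hL0 : ∀ k, 0 < L k := fun k => zero_lt_one.trans_le (hL1 k)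
  have hv : ∀ k, ENNReal.ofReal (L k ^ (δ / 2)) ^ (2 : ℝ) = ENNReal.ofReal (L k ^ δ) := fun k => by
    rw [ENNReal.ofReal_rpow_of_nonneg (Real.rpow_nonneg (hL0 k).le _) (by norm_num),
      ← Real.rpow_mul (hL0 k).le, div_mul_cancel₀ _ two_ne_zero]
  have hpos : ∀ k, 0 < L k ^ δ := fun k => Real.rpow_pos_of_pos (hL0 k) _
  -- The auxiliary weight is the square root of the logarithmic weight of the hypothesis, so that
  -- Hölder with p = q = 2 reproduces that hypothesis.
  refine tendsto_tsum_of_holder Real.HolderConjugate.two_two s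
    (fun k => ENNReal.ofReal (L k ^ (δ / 2))) _ (fun k hk => ?_)
    (fun k => (ENNReal.ofReal_pos.mpr (Real.rpow_pos_of_pos (hL0 k) _)).ne')
    (fun k => ENNReal.ofReal_ne_top) ?_ (C := 4 * ∑' n : ℕ, logWt δ n)
    (ENNReal.mul_ne_top (by simp) (tsum_logWt_ne_top hδ)) (fun x => ?_)
    (tendsto_one_add_abs_rpow (by norm_num))
  · refine ENNReal.ne_top_of_tsum_ne_top hs k ?_
    rw [hk, ENNReal.top_rpow_of_pos two_pos]
    exact ENNReal.top_mul (ENNReal.ofReal_pos.mpr (hpos k)).ne'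
  · simp_rw [ENNReal.mul_rpow_of_nonneg _ _ zero_le_two, hv]
    exact hs
  · have hb : ∀ k : ℤ, (ENNReal.ofReal ((1 + |x - 2 * k|) ^ (-(1 / 2) : ℝ)) *
        (ENNReal.ofReal (L k ^ (δ / 2)))⁻¹) ^ (2 : ℝ) ≤
          logWt δ |x - 2 * k| + logWt δ |0 - 2 * k| := fun k => by
      rw [ENNReal.mul_rpow_of_nonneg _ _ zero_le_two, ENNReal.inv_rpow, hv,
        ← ENNReal.ofReal_inv_of_pos (hpos k), ENNReal.ofReal_rpow_of_nonneg (by positivity)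
          zero_le_two, ← Real.rpow_mul (by positivity), ← ENNReal.ofReal_mul (by positivity)]
      norm_num only [Real.rpow_neg_one]
      have e : L k = Real.log (|0 - 2 * (k : ℝ)| + Real.exp 1) := by
        simp only [hL]
        push_cast
        rw [zero_sub, abs_neg]
      have h3 : 1 ≤ Real.log (|x - 2 * k| + Real.exp 1) := one_le_log_add_exp_one (abs_nonneg _)
      -- The dual term mixes the distances of 2k to x and to 0. Replacing the larger by the smaller
      -- increases it to a value of `logWt`, centred at x or at 0.
      rcases le_total |x - 2 * k| |0 - 2 * (k : ℝ)| with h | h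
      · refine le_trans (ENNReal.ofReal_le_ofReal ?_) le_self_add
        have : Real.log (|x - 2 * k| + Real.exp 1) ≤ L k := by
          rw [e]
          exact Real.log_le_log (by positivity) (by linarith)
        gcongr
      · refine le_trans (ENNReal.ofReal_le_ofReal ?_) le_add_self
        rw [e]
        have := hpos k
        rw [e] at this
        gcongr
    refine (ENNReal.tsum_le_tsum hb).trans ?_
    rw [ENNReal.tsum_add, show (4 : ℝ≥0∞) = 2 + 2 by norm_num, add_mul]
    exact add_le_add (tsum_abs_sub_two_mul_le (antitoneOn_logWt (by linarith)) x)
      (tsum_abs_sub_two_mul_le (antitoneOn_logWt (by linarith)) 0)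

/-! ### Fourier coefficients on `[0, π]` -/

theorem memLp_Ioc_iff {f : ℝ → ℂ} {p : ℝ≥0∞} :
    MemLp f p (volume.restrict (Set.Ioc 0 Real.pi)) ↔ MemLp f p μI := by
  rw [μI, Measure.restrict_congr_set Ioc_ae_eq_Icc]

theorem ae_Ioc_iff {p : ℝ → Prop} :
    (∀ᵐ x ∂volume.restrict (Set.Ioc 0 Real.pi), p x) ↔ ∀ᵐ x ∂μI, p x := by
  rw [μI, Measure.restrict_congr_set Ioc_ae_eq_Icc]

theorem intervalIntegrable_of_memLp {f : ℝ → ℂ} (hf : MemLp f 2 μI) :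
    IntervalIntegrable f volume 0 Real.pi :=
  (intervalIntegrable_iff_integrableOn_Icc_of_le Real.pi_pos.le).mpr (hf.integrable (by norm_num))

theorem memLp_mul_continuous {f g : ℝ → ℂ} (hf : MemLp f 2 μI) (hg : Continuous g) :
    MemLp (fun x => f x * g x) 2 μI := by
  obtain ⟨C, hC⟩ := isCompact_Icc.exists_bound_of_continuousOn (s := Set.Icc 0 Real.pi)
    hg.continuousOn
  refine MemLp.of_le_mul (c := C) hf (hf.1.mul hg.aestronglyMeasurable) ?_
  refine (ae_restrict_iff' measurableSet_Icc).mpr (ae_of_all _ fun x hx => ?_)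
  rw [norm_mul, mul_comm]
  exact mul_le_mul_of_nonneg_right (hC x hx) (norm_nonneg _)

theorem measurePreserving_pi_sub :
    MeasurePreserving (fun x : ℝ => Real.pi - x) μI μI := by
  have := (Measure.measurePreserving_sub_left (volume : Measure ℝ) Real.pi).restrict_preimage
    (measurableSet_Icc (a := (0 : ℝ)) (b := Real.pi))
  simpa using this

theorem fourierCoeffOn_pi (h : ℝ → ℂ) (n : ℤ) :
    fourierCoeffOn Real.pi_pos h n =
      (1 / Real.pi : ℂ) * ∫ x in (0 : ℝ)..Real.pi, Complex.exp (-(2 * Complex.I * n * x)) * h x := by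
  rw [fourierCoeffOn_eq_integral, Complex.real_smul]
  congr 1
  · simp
  · refine intervalIntegral.integral_congr fun x _ => ?_
    have hpi : (Real.pi : ℂ) ≠ 0 := by exact_mod_cast Real.pi_ne_zero
    simp only [fourier_coe_apply, smul_eq_mul, sub_zero]
    congr 2
    push_cast
    field_simp

theorem tsum_enorm_fourierCoeffOn_sq {h : ℝ → ℂ} (hh : MemLp h 2 μI) :
    ∑' n, ‖fourierCoeffOn Real.pi_pos h n‖ₑ ^ (2 : ℝ) =
      ENNReal.ofReal Real.pi⁻¹ * eLpNorm h 2 μI ^ (2 : ℝ) := by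
  have hs := hasSum_sq_fourierCoeffOn Real.pi_pos (memLp_Ioc_iff.mpr hh)
  have e1 : ∀ n, ‖fourierCoeffOn Real.pi_pos h n‖ₑ ^ (2 : ℝ) =
      ENNReal.ofReal (‖fourierCoeffOn Real.pi_pos h n‖ ^ 2) := fun n => by
    rw [ENNReal.rpow_ofNat, ENNReal.ofReal_pow (norm_nonneg _), ofReal_norm]
  simp_rw [e1]
  rw [← ENNReal.ofReal_tsum_of_nonneg (fun _ => by positivity) hs.summable, hs.tsum_eq,
    smul_eq_mul, ENNReal.ofReal_mul (by simpa using Real.pi_pos.le), sub_zero]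
  congr 1
  rw [intervalIntegral.integral_of_le Real.pi_pos.le, ← integral_Icc_eq_integral_Ioc,
    ofReal_integral_eq_lintegral_ofReal (hh.integrable_norm_pow (by norm_num))
      (ae_of_all _ fun _ => by positivity),
    eLpNorm_eq_lintegral_rpow_enorm_toReal (by norm_num) (by norm_num), ← ENNReal.rpow_mul]
  norm_num

/-! ### Coefficients with respect to the root functions -/

theorem exp_two_int_pi (n : ℤ) : Complex.exp (2 * Complex.I * n * Real.pi) = 1 :=
  Complex.exp_eq_one_iff.mpr ⟨n, by ring⟩

theorem dualConj_zero_eq (D : RootData) (ν : Fin 2) (n : ℤ) (x : ℝ) :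
    dualConj D ν (2 * n) x 0 = dualConj D ν 0 x 0 * Complex.exp (2 * Complex.I * n * x) := by
  have : Complex.I * (2 * (n : ℂ)) * x = 2 * Complex.I * n * x := by ring
  fin_cases ν <;> simp [dualConj, this]

theorem dualConj_one_eq (D : RootData) (ν : Fin 2) (n : ℤ) (x : ℝ) :
    dualConj D ν (2 * n) x 1 = dualConj D ν 0 x 1 * Complex.exp (-(2 * Complex.I * n * x)) := by
  have : Complex.I * (2 * (n : ℂ)) * x = 2 * Complex.I * n * x := by ring
  fin_cases ν <;> simp [dualConj, this]

theorem continuous_dualConj (D : RootData) (ν : Fin 2) (k : ℤ) (i : Fin 2) :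
    Continuous fun x => dualConj D ν k x i := by
  fin_cases ν <;> fin_cases i <;> simp [dualConj] <;> fun_prop

/-- The function on `[0, π]` whose Fourier coefficients are the coefficients of `f` with respect to
the root functions: the first component is reflected and added to the second. -/
def fold (D : RootData) (ν : Fin 2) (f : ℝ → Fin 2 → ℂ) (x : ℝ) : ℂ :=
  f (Real.pi - x) 0 * dualConj D ν 0 (Real.pi - x) 0 + f x 1 * dualConj D ν 0 x 1

theorem memLp_fold_left (D : RootData) (ν : Fin 2) {f : ℝ → Fin 2 → ℂ}
    (h0 : MemLp (fun x => f x 0) 2 μI) :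
    MemLp (fun x => f (Real.pi - x) 0 * dualConj D ν 0 (Real.pi - x) 0) 2 μI :=
  (memLp_mul_continuous h0 (continuous_dualConj D ν 0 0)).comp_measurePreserving
    measurePreserving_pi_sub

theorem memLp_fold (D : RootData) (ν : Fin 2) {f : ℝ → Fin 2 → ℂ}
    (h0 : MemLp (fun x => f x 0) 2 μI) (h1 : MemLp (fun x => f x 1) 2 μI) :
    MemLp (fold D ν f) 2 μI :=
  (memLp_fold_left D ν h0).add (memLp_mul_continuous h1 (continuous_dualConj D ν 0 1))

/-- Reflection x ↦ π - x turns exp(2inx) into exp(-2inx), as exp(2inπ) = 1. Both components then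
carry the same exponential and merge into one Fourier coefficient. -/
theorem pairing_dualConj (D : RootData) (ν : Fin 2) {f : ℝ → Fin 2 → ℂ}
    (h0 : MemLp (fun x => f x 0) 2 μI) (h1 : MemLp (fun x => f x 1) 2 μI) (n : ℤ) :
    pairing f (dualConj D ν (2 * n)) = fourierCoeffOn Real.pi_pos (fold D ν f) n := by
  rw [pairing, fourierCoeffOn_pi]
  congr 1
  have i0 : IntervalIntegrable (fun x => f x 0 * dualConj D ν (2 * n) x 0) volume 0 Real.pi :=
    (intervalIntegrable_of_memLp h0).mul_continuousOn (continuous_dualConj D ν _ 0).continuousOn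
  have i1 : IntervalIntegrable (fun x => f x 1 * dualConj D ν (2 * n) x 1) volume 0 Real.pi :=
    (intervalIntegrable_of_memLp h1).mul_continuousOn (continuous_dualConj D ν _ 1).continuousOn
  have i0' : IntervalIntegrable (fun x => f (Real.pi - x) 0 * dualConj D ν (2 * n) (Real.pi - x) 0)
      volume 0 Real.pi := by
    simpa using (i0.comp_sub_left Real.pi).symm
  rw [intervalIntegral.integral_add i0 i1]
  have hr := intervalIntegral.integral_comp_sub_left (a := 0) (b := Real.pi)
    (fun x => f x 0 * dualConj D ν (2 * n) x 0) Real.pi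
  rw [sub_self, sub_zero] at hr
  rw [← hr, ← intervalIntegral.integral_add i0' i1]
  refine intervalIntegral.integral_congr fun x _ => ?_
  have e : Complex.exp (2 * Complex.I * n * ((Real.pi - x : ℝ) : ℂ)) =
      Complex.exp (-(2 * Complex.I * n * x)) := by
    rw [Complex.ofReal_sub, mul_sub, sub_eq_add_neg, Complex.exp_add, exp_two_int_pi, one_mul]
  simp only [dualConj_zero_eq, dualConj_one_eq, e, fold]
  ring

theorem exists_bound_dualConj (D : RootData) :
    ∃ C : ℝ, ∀ (ν i : Fin 2), ∀ x ∈ Set.Icc 0 Real.pi, ‖dualConj D ν 0 x i‖ ≤ C := by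
  have hb : ∀ ν i : Fin 2, ∃ C : ℝ, ∀ x ∈ Set.Icc 0 Real.pi, ‖dualConj D ν 0 x i‖ ≤ C := fun ν i =>
    isCompact_Icc.exists_bound_of_continuousOn (continuous_dualConj D ν 0 i).continuousOn
  choose B hB using hb
  refine ⟨max (max (B 0 0) (B 0 1)) (max (B 1 0) (B 1 1)), fun ν i x hx => (hB ν i x hx).trans ?_⟩
  fin_cases ν <;> fin_cases i <;> simp

theorem exists_eLpNorm_fold_le (D : RootData) :
    ∃ C : ℝ≥0∞, C ≠ ⊤ ∧ ∀ (ν : Fin 2) (f : ℝ → Fin 2 → ℂ), MemLp (fun x => f x 0) 2 μI →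
      MemLp (fun x => f x 1) 2 μI →
      eLpNorm (fold D ν f) 2 μI ≤
        C * (eLpNorm (fun x => f x 0) 2 μI + eLpNorm (fun x => f x 1) 2 μI) := by
  obtain ⟨C, hC⟩ := exists_bound_dualConj D
  have hmul : ∀ (ν i : Fin 2) (g : ℝ → ℂ),
      eLpNorm (fun x => g x * dualConj D ν 0 x i) 2 μI ≤ ENNReal.ofReal C * eLpNorm g 2 μI := by
    intro ν i g
    refine eLpNorm_le_mul_eLpNorm_of_ae_le_mul ?_ 2
    refine (ae_restrict_iff' measurableSet_Icc).mpr (ae_of_all _ fun x hx => ?_)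
    rw [norm_mul, mul_comm]
    exact mul_le_mul_of_nonneg_right (hC ν i x hx) (norm_nonneg _)
  refine ⟨ENNReal.ofReal C, ENNReal.ofReal_ne_top, fun ν f h0 h1 => ?_⟩
  refine (eLpNorm_add_le (memLp_fold_left D ν h0).1
    (memLp_mul_continuous h1 (continuous_dualConj D ν 0 1)).1 (by norm_num)).trans ?_
  rw [mul_add]
  refine add_le_add ?_ (hmul ν 1 _)
  have := eLpNorm_comp_measurePreserving (p := 2)
    (memLp_mul_continuous h0 (continuous_dualConj D ν 0 0)).1 measurePreserving_pi_sub
  exact this.trans_le (hmul ν 0 _)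

/-- Parseval for the folded function. The bound serves twice: for the coefficients of F and for the
entries of the potential. -/
theorem exists_ellTwo_pairing_le (D : RootData) :
    ∃ C : ℝ≥0∞, C ≠ ⊤ ∧ ∀ (ν : Fin 2) (f : ℝ → Fin 2 → ℂ), MemLp (fun x => f x 0) 2 μI →
      MemLp (fun x => f x 1) 2 μI →
      ellTwo (fun n : ℤ => ‖pairing f (dualConj D ν (2 * n))‖ₑ) ≤
        C * (eLpNorm (fun x => f x 0) 2 μI + eLpNorm (fun x => f x 1) 2 μI) := by
  obtain ⟨C, hC, h⟩ := exists_eLpNorm_fold_le D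
  refine ⟨ENNReal.ofReal Real.pi⁻¹ ^ (1 / (2 : ℝ)) * C,
    ENNReal.mul_ne_top (ENNReal.rpow_ne_top_of_nonneg (by norm_num) ENNReal.ofReal_ne_top) hC,
    fun ν f h0 h1 => ?_⟩
  simp_rw [pairing_dualConj D ν h0 h1]
  rw [ellTwo, tsum_enorm_fourierCoeffOn_sq (memLp_fold D ν h0 h1),
    ENNReal.mul_rpow_of_nonneg _ _ (by norm_num), ← ENNReal.rpow_mul, mul_assoc,
    show (2 : ℝ) * (1 / 2) = 1 by norm_num, ENNReal.rpow_one]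
  exact mul_le_mul_right (h ν f h0 h1) _

/-- Completeness. Both folded functions have vanishing Fourier coefficients, hence vanish; they are
obtained from the pair (f₁(π - x), f₂(x)) by a 2 × 2 matrix whose determinant is Δ⁻¹ times
exponentials, so that pair vanishes too. -/
theorem ae_eq_zero_of_pairing_eq_zero (D : RootData) (hΔ : D.Δ ≠ 0) {f : ℝ → Fin 2 → ℂ}
    (h0 : MemLp (fun x => f x 0) 2 μI) (h1 : MemLp (fun x => f x 1) 2 μI)
    (h : ∀ (ν : Fin 2) (n : ℤ), pairing f (dualConj D ν (2 * n)) = 0) :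
    ∀ᵐ x ∂μI, f x 0 = 0 ∧ f x 1 = 0 := by
  have hz : ∀ ν, ∀ᵐ x ∂μI, fold D ν f x = 0 := fun ν => by
    have hm := memLp_fold D ν h0 h1
    have hs := tsum_enorm_fourierCoeffOn_sq hm
    simp_rw [← pairing_dualConj D ν h0 h1, h] at hs
    simp only [enorm_zero, ENNReal.zero_rpow_of_pos two_pos, tsum_zero] at hs
    rcases mul_eq_zero.mp hs.symm with h' | h'
    · exact absurd h' (ENNReal.ofReal_pos.mpr (inv_pos.mpr Real.pi_pos)).ne'
    · rw [ENNReal.rpow_eq_zero_iff_of_pos two_pos, eLpNorm_eq_zero_iff hm.1 (by norm_num)] at h'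
      exact h'
  have hdet : ∀ x : ℝ, dualConj D 0 0 (Real.pi - x) 0 * dualConj D 1 0 x 1 -
      dualConj D 1 0 (Real.pi - x) 0 * dualConj D 0 0 x 1 ≠ 0 := fun x => by
    have e : dualConj D 0 0 (Real.pi - x) 0 * dualConj D 1 0 x 1 -
        dualConj D 1 0 (Real.pi - x) 0 * dualConj D 0 0 x 1 =
        D.Δ⁻¹ * (Complex.exp (-(Complex.I * D.τ₁ * x)) * Complex.exp (-(Complex.I * D.τ₂ * x))) := by
      have e1 : (Real.pi : ℂ) - ((Real.pi - x : ℝ) : ℂ) = x := by push_cast; ring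
      simp only [dualConj, Matrix.cons_val_zero, Matrix.cons_val_one, Matrix.cons_val_fin_one, e1,
        Int.cast_zero, mul_zero, zero_mul, neg_zero, Complex.exp_zero, mul_one]
      have e2 : (D.β₂ + D.κ * D.α₂ * x) * D.α₁ - D.α₂ * (D.β₁ - D.κ * D.α₁ * (Real.pi - x)) = D.Δ := by
        rw [RootData.Δ]; ring
      have e3 : D.Δ⁻¹ = ((D.β₂ + D.κ * D.α₂ * x) * D.α₁ -
          D.α₂ * (D.β₁ - D.κ * D.α₁ * (Real.pi - x))) / D.Δ / D.Δ := by
        rw [e2, div_self hΔ, one_div]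
      rw [e3]
      ring
    rw [e]
    exact mul_ne_zero (inv_ne_zero hΔ) (mul_ne_zero (Complex.exp_ne_zero _) (Complex.exp_ne_zero _))
  have hb : ∀ᵐ x ∂μI, f (Real.pi - x) 0 = 0 ∧ f x 1 = 0 := by
    filter_upwards [hz 0, hz 1] with x hx0 hx1
    simp only [fold] at hx0 hx1
    constructor
    · refine (mul_eq_zero.mp (?_ : f (Real.pi - x) 0 * _ = 0)).resolve_right (hdet x)
      linear_combination dualConj D 1 0 x 1 * hx0 - dualConj D 0 0 x 1 * hx1
    · refine (mul_eq_zero.mp (?_ : f x 1 * _ = 0)).resolve_right (hdet x)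
      linear_combination dualConj D 0 0 (Real.pi - x) 0 * hx1 -
        dualConj D 1 0 (Real.pi - x) 0 * hx0
  have hr := measurePreserving_pi_sub.quasiMeasurePreserving.ae (hb.mono fun x hx => hx.1)
  filter_upwards [hb, hr] with x h1 h2
  rw [sub_sub_cancel] at h2
  exact ⟨h2, h1.2⟩

/-! ### The coefficient functionals on `L²` -/

theorem memLp_apply (F : H) (i : Fin 2) : MemLp (fun x => F x i) 2 μI := by
  refine MemLp.of_le (Lp.memLp F) ?_ (ae_of_all _ fun x => PiLp.norm_apply_le (F x) i)
  exact (EuclideanSpace.proj (𝕜 := ℂ) i).continuous.comp_aestronglyMeasurable (Lp.memLp F).1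

theorem eLpNorm_apply_le (F : H) (i : Fin 2) : eLpNorm (fun x => F x i) 2 μI ≤ ‖F‖ₑ := by
  rw [Lp.enorm_def]
  exact eLpNorm_mono_ae (ae_of_all _ fun x => PiLp.norm_apply_le (F x) i)

theorem exists_ellTwo_coef_le (D : RootData) :
    ∃ C : ℝ, 0 ≤ C ∧ ∀ (ν : Fin 2) (F : H),
      ellTwo (fun n : ℤ => ‖coef D F ν (2 * n)‖ₑ) ≤ ENNReal.ofReal C * ‖F‖ₑ := by
  obtain ⟨C, hC, h⟩ := exists_ellTwo_pairing_le D
  refine ⟨(C * 2).toReal, ENNReal.toReal_nonneg, fun ν F => ?_⟩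
  rw [ENNReal.ofReal_toReal (ENNReal.mul_ne_top hC (by simp)), mul_assoc, two_mul]
  exact (h ν _ (memLp_apply F 0) (memLp_apply F 1)).trans
    (mul_le_mul_right (add_le_add (eLpNorm_apply_le F 0) (eLpNorm_apply_le F 1)) _)

theorem le_ellTwo {ι : Type*} (f : ι → ℝ≥0∞) (i : ι) : f i ≤ ellTwo f := by
  have : f i ^ (2 : ℝ) ≤ ∑' i, f i ^ (2 : ℝ) := ENNReal.le_tsum i
  calc f i = (f i ^ (2 : ℝ)) ^ (1 / (2 : ℝ)) := by rw [← ENNReal.rpow_mul]; norm_num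
    _ ≤ _ := ENNReal.rpow_le_rpow this (by norm_num)

theorem intervalIntegrable_coef (D : RootData) (F : H) (ν : Fin 2) (k : ℤ) (i : Fin 2) :
    IntervalIntegrable (fun x => F x i * dualConj D ν k x i) volume 0 Real.pi :=
  (intervalIntegrable_of_memLp (memLp_apply F i)).mul_continuousOn
    (continuous_dualConj D ν k i).continuousOn

theorem pairing_congr {f g h : ℝ → Fin 2 → ℂ}
    (hfg : ∀ᵐ x ∂μI, f x 0 = g x 0 ∧ f x 1 = g x 1) : pairing f h = pairing g h := by
  rw [pairing, pairing]
  congr 1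
  refine intervalIntegral.integral_congr_ae_restrict ?_
  rw [Set.uIoc_of_le Real.pi_pos.le]
  refine (ae_Ioc_iff.mpr hfg).mono fun x hx => ?_
  simp only [hx.1, hx.2]

theorem coef_add (D : RootData) (F G : H) (ν : Fin 2) (k : ℤ) :
    coef D (F + G) ν k = coef D F ν k + coef D G ν k := by
  have : coef D (F + G) ν k = pairing (fun x i => F x i + G x i) (dualConj D ν k) := by
    refine pairing_congr ?_
    filter_upwards [Lp.coeFn_add F G] with x hx
    constructor <;> rw [hx] <;> rfl
  rw [this, coef, coef, pairing, pairing, pairing, ← mul_add,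
    ← intervalIntegral.integral_add ((intervalIntegrable_coef D F ν k 0).add
      (intervalIntegrable_coef D F ν k 1)) ((intervalIntegrable_coef D G ν k 0).add
      (intervalIntegrable_coef D G ν k 1))]
  congr 2
  funext x
  ring

theorem coef_smul (D : RootData) (c : ℂ) (F : H) (ν : Fin 2) (k : ℤ) :
    coef D (c • F) ν k = c * coef D F ν k := by
  have : coef D (c • F) ν k = pairing (fun x i => c * F x i) (dualConj D ν k) := by
    refine pairing_congr ?_
    filter_upwards [Lp.coeFn_smul c F] with x hx
    constructor <;> rw [hx] <;> rfl
  rw [this, coef, pairing, pairing, mul_left_comm, ← intervalIntegral.integral_const_mul c]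
  congr 2
  funext x
  ring

/-- The coefficients `(⟨F, φ̃_k^1⟩, ⟨F, φ̃_k^2⟩)`, `k = 2n`, as a bounded linear map. -/
def coefL (D : RootData) (n : ℤ) : H →L[ℂ] (Fin 2 → ℂ) :=
  LinearMap.mkContinuous
    { toFun := fun F ν => coef D F ν (2 * n)
      map_add' := fun F G => funext fun ν => coef_add D F G ν _
      map_smul' := fun c F => funext fun ν => coef_smul D c F ν _ }
    (exists_ellTwo_coef_le D).choose
    fun F => by
      obtain ⟨h0, h⟩ := (exists_ellTwo_coef_le D).choose_spec
      refine (pi_norm_le_iff_of_nonneg (by positivity)).mpr fun ν => ?_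
      have := (le_ellTwo _ n).trans (h ν F)
      rw [← ofReal_norm, ← ofReal_norm, ← ENNReal.ofReal_mul h0] at this
      exact (ENNReal.ofReal_le_ofReal_iff (by positivity)).mp this

theorem coefL_apply (D : RootData) (n : ℤ) (F : H) (ν : Fin 2) :
    coefL D n F ν = coef D F ν (2 * n) := rfl

theorem gSeq_eq_norm (D : RootData) (F : H) (n : ℤ) : gSeq D F (2 * n) = ‖coefL D n F‖ := by
  simp [gSeq, Pi.norm_def, coefL_apply, Fin.univ_succ]

theorem enorm_fin_two_le (v : Fin 2 → ℂ) : ‖v‖ₑ ≤ ‖v 0‖ₑ + ‖v 1‖ₑ := by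
  simp only [← ofReal_norm]
  rw [← ENNReal.ofReal_add (norm_nonneg _) (norm_nonneg _)]
  refine ENNReal.ofReal_le_ofReal ((pi_norm_le_iff_of_nonneg (by positivity)).mpr fun i => ?_)
  fin_cases i <;> simp

theorem ellTwo_add_le {ι : Type*} (f g : ι → ℝ≥0∞) :
    ellTwo (fun i => f i + g i) ≤ ellTwo f + ellTwo g := by
  let _ : MeasurableSpace ι := ⊤
  have := ENNReal.lintegral_Lp_add_le (μ := (Measure.count : Measure ι)) (p := 2) (f := f) (g := g)
    measurable_from_top.aemeasurable measurable_from_top.aemeasurable one_le_two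
  simpa [lintegral_count, ellTwo] using this

theorem ellTwo_mono {ι : Type*} {f g : ι → ℝ≥0∞} (h : ∀ i, f i ≤ g i) : ellTwo f ≤ ellTwo g :=
  ENNReal.rpow_le_rpow (ENNReal.tsum_le_tsum fun i => ENNReal.rpow_le_rpow (h i) zero_le_two)
    (by norm_num)

/-- Bessel's inequality for the system of root functions. -/
theorem exists_ellTwo_coefL_le (D : RootData) :
    ∃ C : ℝ≥0∞, C ≠ ⊤ ∧ ∀ F : H, ellTwo (fun n : ℤ => ‖coefL D n F‖ₑ) ≤ C * ‖F‖ₑ := by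
  obtain ⟨C, -, h⟩ := exists_ellTwo_coef_le D
  refine ⟨ENNReal.ofReal C * 2, ENNReal.mul_ne_top (by simp) (by simp), fun F => ?_⟩
  refine (ellTwo_mono fun n => enorm_fin_two_le _).trans ((ellTwo_add_le _ _).trans ?_)
  exact (add_le_add (h 0 F) (h 1 F)).trans_eq (by ring)

/-- Reduces identities in L² to identities of coefficients, with no need for a convergent expansion
of a general element of L². -/
theorem eq_of_coefL_eq (D : RootData) (hΔ : D.Δ ≠ 0) {F G : H}
    (h : ∀ n, coefL D n F = coefL D n G) : F = G := by
  rw [← sub_eq_zero]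
  have hz := ae_eq_zero_of_pairing_eq_zero D hΔ (memLp_apply (F - G) 0) (memLp_apply (F - G) 1)
    fun ν n => by
      change coefL D n (F - G) ν = 0
      rw [map_sub, h, sub_self, Pi.zero_apply]
  rw [Lp.eq_zero_iff_ae_eq_zero]
  filter_upwards [hz] with x hx
  ext i
  fin_cases i
  exacts [hx.1, hx.2]

/-! ### The coefficients of the potential -/

theorem continuous_rootFun (D : RootData) (ν : Fin 2) (k : ℤ) (i : Fin 2) :
    Continuous fun x => rootFun D ν k x i := by
  fin_cases ν <;> fin_cases i <;> simp [rootFun] <;> fun_prop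

/-- By definition w^{ην}(m) is a dual coefficient of the single L² function Vφ_0^ν, so Bessel's
inequality applies to each of the four sequences. -/
theorem ellTwo_rSeq_ne_top (D : RootData) {P Q : ℝ → ℂ} (hP : MemLp P 2 μI) (hQ : MemLp Q 2 μI) :
    ellTwo (fun m : ℤ => ENNReal.ofReal (rSeq D P Q (2 * m))) ≠ ⊤ := by
  obtain ⟨C, hC, h⟩ := exists_ellTwo_pairing_le D
  have hw : ∀ η ν, ellTwo (fun m : ℤ => ‖wSeq D P Q η ν (2 * m)‖ₑ) ≠ ⊤ := fun η ν => by
    have m0 := memLp_mul_continuous hP (continuous_rootFun D ν 0 1)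
    have m1 := memLp_mul_continuous hQ (continuous_rootFun D ν 0 0)
    refine ne_top_of_le_ne_top (ENNReal.mul_ne_top hC (ENNReal.add_ne_top.mpr ⟨m0.2.ne, m1.2.ne⟩))
      (h η (fun x => ![P x * rootFun D ν 0 x 1, Q x * rootFun D ν 0 x 0]) m0 m1)
  refine ne_top_of_le_ne_top (b := (ellTwo (fun m : ℤ => ‖wSeq D P Q 0 0 (2 * m)‖ₑ) +
    ellTwo (fun m : ℤ => ‖wSeq D P Q 0 1 (2 * m)‖ₑ)) + (ellTwo (fun m : ℤ => ‖wSeq D P Q 1 0 (2 * m)‖ₑ) +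
    ellTwo (fun m : ℤ => ‖wSeq D P Q 1 1 (2 * m)‖ₑ))) ?_ ?_
  · simp only [ENNReal.add_ne_top]
    exact ⟨⟨hw 0 0, hw 0 1⟩, hw 1 0, hw 1 1⟩
  · refine (ellTwo_mono (g := fun m : ℤ => (‖wSeq D P Q 0 0 (2 * m)‖ₑ + ‖wSeq D P Q 0 1 (2 * m)‖ₑ) +
      (‖wSeq D P Q 1 0 (2 * m)‖ₑ + ‖wSeq D P Q 1 1 (2 * m)‖ₑ)) fun m => ?_).trans
      ((ellTwo_add_le _ _).trans (add_le_add (ellTwo_add_le _ _) (ellTwo_add_le _ _)))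
    simp only [← ofReal_norm]
    rw [← ENNReal.ofReal_add (by positivity) (by positivity),
      ← ENNReal.ofReal_add (by positivity) (by positivity),
      ← ENNReal.ofReal_add (by positivity) (by positivity)]
    exact ENNReal.ofReal_le_ofReal ((max_le_add_of_nonneg (by positivity) (by positivity)).trans
      (add_le_add (max_le_add_of_nonneg (by positivity) (by positivity))
        (max_le_add_of_nonneg (by positivity) (by positivity))))

theorem norm_wSeq_le_rSeq (D : RootData) (P Q : ℝ → ℂ) (η ν : Fin 2) (m : ℤ) :
    ‖wSeq D P Q η ν m‖ ≤ rSeq D P Q m := by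
  fin_cases η <;> fin_cases ν <;> simp [rSeq]

/-! ### Elements of `L²` given by their components -/

theorem memLp_pair {f₀ f₁ : ℝ → ℂ} (h₀ : MemLp f₀ 2 μI) (h₁ : MemLp f₁ 2 μI) :
    MemLp (fun x => (WithLp.toLp 2 ![f₀ x, f₁ x] : EuclideanSpace ℂ (Fin 2))) 2 μI := by
  refine MemLp.of_eval_piLp fun i => ?_
  fin_cases i
  exacts [h₀, h₁]

/-- The element of `L²([0,π], ℂ²)` with the given components. -/
def pairH {f₀ f₁ : ℝ → ℂ} (h₀ : MemLp f₀ 2 μI) (h₁ : MemLp f₁ 2 μI) : H :=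
  (memLp_pair h₀ h₁).toLp _

theorem pairH_ae {f₀ f₁ : ℝ → ℂ} (h₀ : MemLp f₀ 2 μI) (h₁ : MemLp f₁ 2 μI) :
    ∀ᵐ x ∂μI, pairH h₀ h₁ x 0 = f₀ x ∧ pairH h₀ h₁ x 1 = f₁ x := by
  filter_upwards [(memLp_pair h₀ h₁).coeFn_toLp] with x hx
  constructor <;> rw [pairH, hx] <;> simp

theorem ext_ae {F G : H} (h : ∀ᵐ x ∂μI, F x 0 = G x 0 ∧ F x 1 = G x 1) : F = G := by
  refine Lp.ext ?_
  filter_upwards [h] with x hx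
  ext i
  fin_cases i
  exacts [hx.1, hx.2]

theorem enorm_le_of_ae {F : H} {f₀ f₁ : ℝ → ℂ} (h₀ : MemLp f₀ 2 μI) (h₁ : MemLp f₁ 2 μI)
    (h : ∀ᵐ x ∂μI, F x 0 = f₀ x ∧ F x 1 = f₁ x) : ‖F‖ₑ ≤ eLpNorm f₀ 2 μI + eLpNorm f₁ 2 μI := by
  rw [Lp.enorm_def, ← eLpNorm_norm f₀, ← eLpNorm_norm f₁]
  refine le_trans (eLpNorm_mono_ae (g := fun x => ‖f₀ x‖ + ‖f₁ x‖) ?_)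
    (eLpNorm_add_le h₀.1.norm h₁.1.norm (by norm_num))
  filter_upwards [h] with x hx
  rw [EuclideanSpace.norm_eq, Fin.sum_univ_two, hx.1, hx.2, Real.norm_eq_abs]
  refine Real.sqrt_le_iff.mpr ⟨abs_nonneg _, ?_⟩
  rw [sq_abs]
  nlinarith [mul_nonneg (norm_nonneg (f₀ x)) (norm_nonneg (f₁ x))]

/-- A linear map with a bound in terms of extended norms, as a continuous linear map. -/
def clmOfEnorm {E G : Type*} [NormedAddCommGroup E] [NormedSpace ℂ E] [NormedAddCommGroup G]
    [NormedSpace ℂ G] (f : E →ₗ[ℂ] G) {C : ℝ≥0∞} (hC : C ≠ ⊤) (h : ∀ x, ‖f x‖ₑ ≤ C * ‖x‖ₑ) :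
    E →L[ℂ] G :=
  f.mkContinuous C.toReal fun x => by
    have := h x
    rw [← ofReal_norm, ← ofReal_norm, ← ENNReal.ofReal_toReal hC,
      ← ENNReal.ofReal_mul ENNReal.toReal_nonneg] at this
    exact (ENNReal.ofReal_le_ofReal_iff (by positivity)).mp this

/-! ### Absolutely convergent expansions -/

/-- The space `ℓ¹` of absolutely summable sequences of coefficients. -/
abbrev X : Type := lp (fun _ : ℤ => Fin 2 → ℂ) 1

theorem summable_norm_X (a : X) : Summable fun n => ‖a n‖ := by
  simpa using (lp.memℓp a).summable (by norm_num)

theorem norm_X (a : X) : ‖a‖ = ∑' n, ‖a n‖ := by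
  rw [lp.norm_eq_tsum_rpow (by norm_num)]
  simp

theorem enorm_X (a : X) : ‖a‖ₑ = ∑' n, ‖a n‖ₑ := by
  rw [← ofReal_norm, norm_X, ENNReal.ofReal_tsum_of_nonneg (fun _ => norm_nonneg _)
    (summable_norm_X a)]
  simp_rw [ofReal_norm]

theorem rootFun_zero_eq (D : RootData) (ν : Fin 2) (n : ℤ) (x : ℝ) :
    rootFun D ν (2 * n) x 0 = rootFun D ν 0 x 0 * Complex.exp (-(2 * Complex.I * n * x)) := by
  have : Complex.I * (2 * (n : ℂ)) * x = 2 * Complex.I * n * x := by ring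
  fin_cases ν <;> simp [rootFun, this]

theorem rootFun_one_eq (D : RootData) (ν : Fin 2) (n : ℤ) (x : ℝ) :
    rootFun D ν (2 * n) x 1 = rootFun D ν 0 x 1 * Complex.exp (2 * Complex.I * n * x) := by
  have : Complex.I * (2 * (n : ℂ)) * x = 2 * Complex.I * n * x := by ring
  fin_cases ν <;> simp [rootFun, this]

/-- The dependence on n is through factors of modulus one, so a bound for n = 0 serves all n. -/
theorem exists_bound_rootFun (D : RootData) :
    ∃ C : ℝ, 0 ≤ C ∧ ∀ (ν i : Fin 2) (n : ℤ), ∀ x ∈ Set.Icc 0 Real.pi,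
      ‖rootFun D ν (2 * n) x i‖ ≤ C := by
  have hb : ∀ ν i : Fin 2, ∃ C : ℝ, ∀ x ∈ Set.Icc 0 Real.pi, ‖rootFun D ν 0 x i‖ ≤ C := fun ν i =>
    isCompact_Icc.exists_bound_of_continuousOn (continuous_rootFun D ν 0 i).continuousOn
  choose B hB using hb
  have e : ∀ (ν i : Fin 2) (n : ℤ) (x : ℝ), ‖rootFun D ν (2 * n) x i‖ = ‖rootFun D ν 0 x i‖ := by
    intro ν i n x
    have h1 : ‖Complex.exp (2 * Complex.I * n * x)‖ = 1 := by
      rw [Complex.norm_exp]; simp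
    have h2 : ‖Complex.exp (-(2 * Complex.I * n * x))‖ = 1 := by
      rw [Complex.norm_exp]; simp
    fin_cases i
    · simp only [Fin.zero_eta, rootFun_zero_eq, norm_mul, h2, mul_one]
    · simp only [Fin.mk_one, rootFun_one_eq, norm_mul, h1, mul_one]
  have hle : ∀ ν i, B ν i ≤ max (max (B 0 0) (B 0 1)) (max (B 1 0) (B 1 1)) := fun ν i => by
    fin_cases ν <;> fin_cases i <;> simp
  refine ⟨max (max (B 0 0) (B 0 1)) (max (B 1 0) (B 1 1)), ?_, fun ν i n x hx => ?_⟩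
  · exact (norm_nonneg _).trans ((hB 0 0 0 ⟨le_rfl, Real.pi_pos.le⟩).trans (hle 0 0))
  · rw [e]
    exact (hB ν i x hx).trans (hle ν i)

/-- A bound for all root functions on `[0, π]`. -/
def rootBound (D : RootData) : ℝ := (exists_bound_rootFun D).choose

theorem rootBound_nonneg (D : RootData) : 0 ≤ rootBound D := (exists_bound_rootFun D).choose_spec.1

theorem norm_rootFun_le (D : RootData) (ν i : Fin 2) (n : ℤ) {x : ℝ} (hx : x ∈ Set.Icc 0 Real.pi) :
    ‖rootFun D ν (2 * n) x i‖ ≤ rootBound D := (exists_bound_rootFun D).choose_spec.2 ν i n x hx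

/-- The function with the given absolutely summable coefficients. -/
def synth (D : RootData) (a : X) (i : Fin 2) (x : ℝ) : ℂ :=
  ∑' n, (a n 0 * rootFun D 0 (2 * n) x i + a n 1 * rootFun D 1 (2 * n) x i)

theorem norm_synth_term_le (D : RootData) (a : X) (i : Fin 2) (n : ℤ) {x : ℝ}
    (hx : x ∈ Set.Icc 0 Real.pi) :
    ‖a n 0 * rootFun D 0 (2 * n) x i + a n 1 * rootFun D 1 (2 * n) x i‖ ≤
      2 * rootBound D * ‖a n‖ := by
  have h0 := norm_le_pi_norm (a n) 0
  have h1 := norm_le_pi_norm (a n) 1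
  refine (norm_add_le _ _).trans ?_
  rw [norm_mul, norm_mul]
  have := mul_le_mul h0 (norm_rootFun_le D 0 i n hx) (norm_nonneg _) (norm_nonneg _)
  have := mul_le_mul h1 (norm_rootFun_le D 1 i n hx) (norm_nonneg _) (norm_nonneg _)
  linarith

theorem summable_synth (D : RootData) (a : X) (i : Fin 2) {x : ℝ} (hx : x ∈ Set.Icc 0 Real.pi) :
    Summable fun n => a n 0 * rootFun D 0 (2 * n) x i + a n 1 * rootFun D 1 (2 * n) x i :=
  Summable.of_norm_bounded ((summable_norm_X a).mul_left _) fun n => norm_synth_term_le D a i n hx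

theorem norm_synth_le (D : RootData) (a : X) (i : Fin 2) {x : ℝ} (hx : x ∈ Set.Icc 0 Real.pi) :
    ‖synth D a i x‖ ≤ 2 * rootBound D * ‖a‖ := by
  refine tsum_of_norm_bounded ?_ fun n => norm_synth_term_le D a i n hx
  rw [norm_X]
  exact (summable_norm_X a).hasSum.mul_left _

theorem continuousOn_synth (D : RootData) (a : X) (i : Fin 2) :
    ContinuousOn (synth D a i) (Set.Icc 0 Real.pi) := by
  refine continuousOn_tsum (fun n => ?_) ((summable_norm_X a).mul_left (2 * rootBound D))
    fun n x hx => norm_synth_term_le D a i n hx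
  exact (((continuous_rootFun D 0 _ i).const_mul _).add
    ((continuous_rootFun D 1 _ i).const_mul _)).continuousOn

theorem synth_add (D : RootData) (a b : X) (i : Fin 2) {x : ℝ} (hx : x ∈ Set.Icc 0 Real.pi) :
    synth D (a + b) i x = synth D a i x + synth D b i x := by
  rw [synth, synth, synth, ← (summable_synth D a i hx).tsum_add (summable_synth D b i hx)]
  refine tsum_congr fun n => ?_
  rw [lp.coeFn_add]
  simp only [Pi.add_apply]
  ring

theorem synth_smul (D : RootData) (c : ℂ) (a : X) (i : Fin 2) (x : ℝ) :
    synth D (c • a) i x = c * synth D a i x := by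
  rw [synth, synth, ← tsum_mul_left]
  refine tsum_congr fun n => ?_
  rw [lp.coeFn_smul]
  simp only [Pi.smul_apply, smul_eq_mul]
  ring

theorem synth_single (D : RootData) (m : ℤ) (v : Fin 2 → ℂ) (i : Fin 2) (x : ℝ) :
    synth D (lp.single 1 m v) i x =
      v 0 * rootFun D 0 (2 * m) x i + v 1 * rootFun D 1 (2 * m) x i := by
  rw [synth, tsum_eq_single m fun n hn => ?_, lp.single_apply_self]
  rw [lp.single_apply_ne _ _ _ hn]
  simp

theorem ae_mem_Icc : ∀ᵐ x ∂μI, x ∈ Set.Icc 0 Real.pi := ae_restrict_mem measurableSet_Icc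

theorem memLp_mul_synth (D : RootData) {f : ℝ → ℂ} (hf : MemLp f 2 μI) (a : X) (i : Fin 2) :
    MemLp (fun x => f x * synth D a i x) 2 μI := by
  refine MemLp.of_le_mul (c := 2 * rootBound D * ‖a‖) hf
    (hf.1.mul ((continuousOn_synth D a i).aestronglyMeasurable measurableSet_Icc)) ?_
  filter_upwards [ae_mem_Icc] with x hx
  rw [norm_mul, mul_comm]
  exact mul_le_mul_of_nonneg_right (norm_synth_le D a i hx) (norm_nonneg _)

theorem eLpNorm_mul_synth_le (D : RootData) (f : ℝ → ℂ) (a : X) (i : Fin 2) :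
    eLpNorm (fun x => f x * synth D a i x) 2 μI ≤
      ENNReal.ofReal (2 * rootBound D) * eLpNorm f 2 μI * ‖a‖ₑ := by
  have : eLpNorm (fun x => f x * synth D a i x) 2 μI ≤
      ENNReal.ofReal (2 * rootBound D * ‖a‖) * eLpNorm f 2 μI := by
    refine eLpNorm_le_mul_eLpNorm_of_ae_le_mul ?_ 2
    filter_upwards [ae_mem_Icc] with x hx
    rw [norm_mul, mul_comm]
    exact mul_le_mul_of_nonneg_right (norm_synth_le D a i hx) (norm_nonneg _)
  refine this.trans_eq ?_
  rw [ENNReal.ofReal_mul (mul_nonneg zero_le_two (rootBound_nonneg D)), ofReal_norm]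
  ring

/-- Multiplication of an absolutely convergent expansion by `[0 P; Q 0]` (if `s = 1`) or by
`[P 0; 0 Q]` (if `s = 0`). -/
def mulSynth (D : RootData) {P Q : ℝ → ℂ} (hP : MemLp P 2 μI) (hQ : MemLp Q 2 μI) (s : Fin 2) :
    X →L[ℂ] H :=
  clmOfEnorm
    { toFun := fun a => pairH (memLp_mul_synth D hP a s) (memLp_mul_synth D hQ a (1 - s))
      map_add' := fun a b => ext_ae <| by
        filter_upwards [ae_mem_Icc, Lp.coeFn_add (pairH (memLp_mul_synth D hP a s)
          (memLp_mul_synth D hQ a (1 - s))) (pairH (memLp_mul_synth D hP b s)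
          (memLp_mul_synth D hQ b (1 - s))), pairH_ae (memLp_mul_synth D hP a s)
          (memLp_mul_synth D hQ a (1 - s)), pairH_ae (memLp_mul_synth D hP b s)
          (memLp_mul_synth D hQ b (1 - s)), pairH_ae (memLp_mul_synth D hP (a + b) s)
          (memLp_mul_synth D hQ (a + b) (1 - s))] with x hx h ha hb hab
        rw [h, hab.1, hab.2, Pi.add_apply, PiLp.add_apply, PiLp.add_apply, ha.1, ha.2, hb.1, hb.2,
          synth_add D a b _ hx, synth_add D a b _ hx]
        constructor <;> ring
      map_smul' := fun c a => ext_ae <| by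
        filter_upwards [Lp.coeFn_smul c (pairH (memLp_mul_synth D hP a s)
          (memLp_mul_synth D hQ a (1 - s))), pairH_ae (memLp_mul_synth D hP a s)
          (memLp_mul_synth D hQ a (1 - s)), pairH_ae (memLp_mul_synth D hP (c • a) s)
          (memLp_mul_synth D hQ (c • a) (1 - s))] with x h ha hca
        rw [RingHom.id_apply, h, hca.1, hca.2, Pi.smul_apply, PiLp.smul_apply, PiLp.smul_apply,
          ha.1, ha.2, synth_smul, synth_smul, smul_eq_mul, smul_eq_mul]
        constructor <;> ring }
    (C := ENNReal.ofReal (2 * rootBound D) * (eLpNorm P 2 μI + eLpNorm Q 2 μI))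
    (ENNReal.mul_ne_top ENNReal.ofReal_ne_top (ENNReal.add_ne_top.mpr ⟨hP.2.ne, hQ.2.ne⟩))
    fun a => by
      refine (enorm_le_of_ae (memLp_mul_synth D hP a s) (memLp_mul_synth D hQ a (1 - s))
        (pairH_ae (memLp_mul_synth D hP a s) (memLp_mul_synth D hQ a (1 - s)))).trans ?_
      refine (add_le_add (eLpNorm_mul_synth_le D P a s)
        (eLpNorm_mul_synth_le D Q a (1 - s))).trans_eq ?_
      ring

theorem mulSynth_ae (D : RootData) {P Q : ℝ → ℂ} (hP : MemLp P 2 μI) (hQ : MemLp Q 2 μI) (s : Fin 2)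
    (a : X) : ∀ᵐ x ∂μI, mulSynth D hP hQ s a x 0 = P x * synth D a s x ∧
      mulSynth D hP hQ s a x 1 = Q x * synth D a (1 - s) x :=
  pairH_ae (memLp_mul_synth D hP a s) (memLp_mul_synth D hQ a (1 - s))

/-- The embedding of `ℓ¹` into `L²` by expansion in root functions. -/
def synthL (D : RootData) : X →L[ℂ] H :=
  mulSynth D (memLp_const (1 : ℂ)) (memLp_const (1 : ℂ)) 0

theorem synthL_ae (D : RootData) (a : X) :
    ∀ᵐ x ∂μI, synthL D a x 0 = synth D a 0 x ∧ synthL D a x 1 = synth D a 1 x := by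
  filter_upwards [mulSynth_ae D (memLp_const (1 : ℂ)) (memLp_const (1 : ℂ)) 0 a] with x hx
  rw [one_mul, one_mul] at hx
  exact hx

/-- The multiplication by the potential as a bounded operator from `ℓ¹` to `L²`. -/
def potL (D : RootData) {P Q : ℝ → ℂ} (hP : MemLp P 2 μI) (hQ : MemLp Q 2 μI) : X →L[ℂ] H :=
  mulSynth D hP hQ 1

theorem potL_ae (D : RootData) {P Q : ℝ → ℂ} (hP : MemLp P 2 μI) (hQ : MemLp Q 2 μI) (a : X) :
    ∀ᵐ x ∂μI, potL D hP hQ a x 0 = P x * synth D a 1 x ∧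
      potL D hP hQ a x 1 = Q x * synth D a 0 x :=
  mulSynth_ae D hP hQ 1 a

/-- Absolutely convergent expansions are bounded functions, so on them the product lies in L² and
`mulV` does not take its default value 0. -/
theorem mulV_synthL (D : RootData) {P Q : ℝ → ℂ} (hP : MemLp P 2 μI) (hQ : MemLp Q 2 μI) (a : X) :
    mulV P Q (synthL D a) = potL D hP hQ a := by
  have hae : (fun x => (WithLp.toLp 2 ![P x * synthL D a x 1, Q x * synthL D a x 0] :
      EuclideanSpace ℂ (Fin 2))) =ᵐ[μI]
      fun x => WithLp.toLp 2 ![P x * synth D a 1 x, Q x * synth D a 0 x] := by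
    filter_upwards [synthL_ae D a] with x hx
    rw [hx.1, hx.2]
  have hm := (memLp_congr_ae hae).mpr
    (memLp_pair (memLp_mul_synth D hP a 1) (memLp_mul_synth D hQ a 0))
  rw [mulV, dif_pos hm]
  refine ext_ae ?_
  filter_upwards [hm.coeFn_toLp, hae, potL_ae D hP hQ a] with x h1 h2 h3
  rw [h1, h2, h3.1, h3.2]
  simp

/-- The only passage to the sup norm: everything else is estimated in ℓ¹. -/
theorem supNorm_synthL_le (D : RootData) (a : X) :
    supNorm (synthL D a) ≤ ENNReal.ofReal (2 * rootBound D) * ‖a‖ₑ := by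
  have h : ∀ i, eLpNorm (synth D a i) ⊤ μI ≤ ENNReal.ofReal (2 * rootBound D) * ‖a‖ₑ := fun i => by
    rw [← ofReal_norm, ← ENNReal.ofReal_mul (mul_nonneg zero_le_two (rootBound_nonneg D))]
    refine (eLpNorm_le_of_ae_bound (C := 2 * rootBound D * ‖a‖) ?_).trans (by simp)
    filter_upwards [ae_mem_Icc] with x hx using norm_synth_le D a i hx
  refine max_le ?_ ?_
  · exact (eLpNorm_congr_ae ((synthL_ae D a).mono fun x hx => hx.1)).trans_le (h 0)
  · exact (eLpNorm_congr_ae ((synthL_ae D a).mono fun x hx => hx.2)).trans_le (h 1)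

/-! ### Coefficients of expansions -/

theorem pairing_lincomb {f g h : ℝ → Fin 2 → ℂ} (c d : ℂ)
    (hf : ∀ i, IntervalIntegrable (fun x => f x i * h x i) volume 0 Real.pi)
    (hg : ∀ i, IntervalIntegrable (fun x => g x i * h x i) volume 0 Real.pi) :
    pairing (fun x i => c * f x i + d * g x i) h = c * pairing f h + d * pairing g h := by
  rw [pairing, pairing, pairing, mul_left_comm c, mul_left_comm d, ← mul_add,
    ← intervalIntegral.integral_const_mul c, ← intervalIntegral.integral_const_mul d,
    ← intervalIntegral.integral_add (((hf 0).add (hf 1)).const_mul c)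
      (((hg 0).add (hg 1)).const_mul d)]
  congr 2
  funext x
  ring

theorem coefL_synthL_single (D : RootData) (hΔ : D.Δ ≠ 0) (n m : ℤ) (v : Fin 2 → ℂ) :
    coefL D n (synthL D (lp.single 1 m v)) = (lp.single 1 m v : X) n := by
  have hi : ∀ ν η i, IntervalIntegrable (fun x => rootFun D ν (2 * m) x i * dualConj D η (2 * n) x i)
      volume 0 Real.pi := fun ν η i =>
    ((continuous_rootFun D ν _ i).mul (continuous_dualConj D η _ i)).intervalIntegrable _ _
  funext η
  have : coefL D n (synthL D (lp.single 1 m v)) η = pairing (fun x i =>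
      v 0 * rootFun D 0 (2 * m) x i + v 1 * rootFun D 1 (2 * m) x i) (dualConj D η (2 * n)) := by
    refine pairing_congr ?_
    filter_upwards [synthL_ae D (lp.single 1 m v)] with x hx
    rw [hx.1, hx.2, synth_single, synth_single]
    exact ⟨rfl, rfl⟩
  rw [this, pairing_lincomb _ _ (hi 0 η) (hi 1 η), pairing_rootFun_dualConj D hΔ,
    pairing_rootFun_dualConj D hΔ]
  by_cases hmn : m = n
  · subst hmn
    rw [lp.single_apply_self]
    fin_cases η <;> simp
  · rw [lp.single_apply_ne _ _ _ (Ne.symm hmn)]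
    simp [hmn]

/-- Biorthogonality on single terms, extended to all of ℓ¹ by continuity of both sides. -/
theorem coefL_synthL (D : RootData) (hΔ : D.Δ ≠ 0) (n : ℤ) (a : X) :
    coefL D n (synthL D a) = a n := by
  have hs := lp.hasSum_single ENNReal.one_ne_top a
  have h1 := hs.mapL ((coefL D n).comp (synthL D))
  have h2 := hs.mapL (lp.evalCLM ℂ (fun _ : ℤ => Fin 2 → ℂ) 1 n)
  refine h1.unique (h2.congr_fun ?_)
  intro m
  exact coefL_synthL_single D hΔ n m (a m)

theorem coefL_potL_single (D : RootData) {P Q : ℝ → ℂ} (hP : MemLp P 2 μI) (hQ : MemLp Q 2 μI)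
    (n m : ℤ) (v : Fin 2 → ℂ) (η : Fin 2) :
    coefL D n (potL D hP hQ (lp.single 1 m v)) η =
      v 0 * wSeq D P Q η 0 (2 * (n + m)) + v 1 * wSeq D P Q η 1 (2 * (n + m)) := by
  have hi : ∀ ν i, IntervalIntegrable (fun x =>
      ![P x * rootFun D ν (2 * m) x 1, Q x * rootFun D ν (2 * m) x 0] i * dualConj D η (2 * n) x i)
      volume 0 Real.pi := fun ν i => by
    refine IntervalIntegrable.mul_continuousOn ?_ (continuous_dualConj D η _ i).continuousOn
    fin_cases i
    · exact (intervalIntegrable_of_memLp hP).mul_continuousOn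
        (continuous_rootFun D ν _ 1).continuousOn
    · exact (intervalIntegrable_of_memLp hQ).mul_continuousOn
        (continuous_rootFun D ν _ 0).continuousOn
  have : coefL D n (potL D hP hQ (lp.single 1 m v)) η = pairing (fun x i =>
      v 0 * ![P x * rootFun D 0 (2 * m) x 1, Q x * rootFun D 0 (2 * m) x 0] i +
      v 1 * ![P x * rootFun D 1 (2 * m) x 1, Q x * rootFun D 1 (2 * m) x 0] i)
      (dualConj D η (2 * n)) := by
    refine pairing_congr ?_
    filter_upwards [potL_ae D hP hQ (lp.single 1 m v)] with x hx
    rw [hx.1, hx.2, synth_single, synth_single]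
    constructor <;> simp <;> ring
  rw [this, pairing_lincomb _ _ (hi 0) (hi 1), mul_add, ← entryV_eq_wSeq, ← entryV_eq_wSeq]
  rfl

/-- The matrix of V is Hankel by `entryV_eq_wSeq`. The factor 2 counts the two root functions per
index, the norm on pairs being the maximum. -/
theorem enorm_coefL_potL_le (D : RootData) {P Q : ℝ → ℂ} (hP : MemLp P 2 μI) (hQ : MemLp Q 2 μI)
    (n : ℤ) (a : X) :
    ‖coefL D n (potL D hP hQ a)‖ₑ ≤
      2 * ∑' m, ENNReal.ofReal (rSeq D P Q (2 * (n + m))) * ‖a m‖ₑ := by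
  have h1 := (lp.hasSum_single ENNReal.one_ne_top a).mapL ((coefL D n).comp (potL D hP hQ))
  have h2 : coefL D n (potL D hP hQ a) = ∑' m, coefL D n (potL D hP hQ (lp.single 1 m (a m))) :=
    h1.tsum_eq.symm
  rw [h2, ← ENNReal.tsum_mul_left]
  refine enorm_tsum_le_tsum_enorm.trans (ENNReal.tsum_le_tsum fun m => ?_)
  have hr : 0 ≤ rSeq D P Q (2 * (n + m)) :=
    (norm_nonneg _).trans (norm_wSeq_le_rSeq D P Q 0 0 _)
  have h3 : 2 * (ENNReal.ofReal (rSeq D P Q (2 * (n + m))) * ‖a m‖ₑ) =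
      ENNReal.ofReal (2 * (rSeq D P Q (2 * (n + m)) * ‖a m‖)) := by
    rw [ENNReal.ofReal_mul zero_le_two, ENNReal.ofReal_mul hr, ofReal_norm, ENNReal.ofReal_ofNat]
  rw [h3, ← ofReal_norm]
  refine ENNReal.ofReal_le_ofReal ((pi_norm_le_iff_of_nonneg (by positivity)).mpr fun η => ?_)
  rw [coefL_potL_single]
  refine (norm_add_le _ _).trans ?_
  rw [norm_mul, norm_mul]
  have := mul_le_mul (norm_le_pi_norm (a m) 0) (norm_wSeq_le_rSeq D P Q η 0 (2 * (n + m)))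
    (norm_nonneg _) (norm_nonneg _)
  have := mul_le_mul (norm_le_pi_norm (a m) 1) (norm_wSeq_le_rSeq D P Q η 1 (2 * (n + m)))
    (norm_nonneg _) (norm_nonneg _)
  linarith

/-! ### Absolutely continuous complex-valued functions -/

/-- A contraction only decreases the sums in the definition. Applied to real and imaginary parts,
this carries the real theory over to complex-valued functions. -/
theorem _root_.AbsolutelyContinuousOnInterval.comp_lipschitz {Y Z : Type*} [PseudoMetricSpace Y]
    [PseudoMetricSpace Z] {f : ℝ → Y} {a b : ℝ} (hf : AbsolutelyContinuousOnInterval f a b)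
    {g : Y → Z} (hg : ∀ x y, dist (g x) (g y) ≤ dist x y) :
    AbsolutelyContinuousOnInterval (fun x => g (f x)) a b :=
  squeeze_zero (fun _ => Finset.sum_nonneg fun _ _ => dist_nonneg)
    (fun _ => Finset.sum_le_sum fun _ _ => hg _ _) hf

theorem dist_re_le (z w : ℂ) : dist z.re w.re ≤ dist z w := by
  rw [dist_eq_norm, dist_eq_norm, ← Complex.sub_re]
  exact Complex.abs_re_le_norm _

theorem dist_im_le (z w : ℂ) : dist z.im w.im ≤ dist z w := by
  rw [dist_eq_norm, dist_eq_norm, ← Complex.sub_im]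
  exact Complex.abs_im_le_norm _

theorem _root_.AbsolutelyContinuousOnInterval.of_re_im {f : ℝ → ℂ} {a b : ℝ}
    (hr : AbsolutelyContinuousOnInterval (fun x => (f x).re) a b)
    (hi : AbsolutelyContinuousOnInterval (fun x => (f x).im) a b) :
    AbsolutelyContinuousOnInterval f a b := by
  have h1 := hr.comp_lipschitz (g := fun r : ℝ => (r : ℂ)) fun x y => by simp [dist_eq_norm, ← Complex.ofReal_sub]
  have h2 := hi.comp_lipschitz (g := fun r : ℝ => (r : ℂ)) fun x y => by simp [dist_eq_norm, ← Complex.ofReal_sub]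
  have e : (fun x => ((f x).re : ℂ) + Complex.I • ((f x).im : ℂ)) = f := funext fun x => by
    rw [smul_eq_mul, mul_comm, Complex.re_add_im]
  rw [← e]
  exact h1.fun_add (h2.const_smul Complex.I)

theorem ae_uIcc_iff {p : ℝ → Prop} :
    (∀ᵐ x, x ∈ Set.uIcc 0 Real.pi → p x) ↔ ∀ᵐ x ∂μI, p x := by
  rw [μI, ae_restrict_iff' measurableSet_Icc, Set.uIcc_of_le Real.pi_pos.le]

theorem ae_hasDerivAt_of_ac {f : ℝ → ℂ} (hf : AbsolutelyContinuousOnInterval f 0 Real.pi) :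
    ∀ᵐ x ∂μI, HasDerivAt f (deriv f x) x := by
  filter_upwards [ae_uIcc_iff.mp (hf.comp_lipschitz dist_re_le).ae_differentiableAt,
    ae_uIcc_iff.mp (hf.comp_lipschitz dist_im_le).ae_differentiableAt] with x hr hi
  have := hr.hasDerivAt.ofReal_comp.add (hi.hasDerivAt.ofReal_comp.mul_const Complex.I)
  have e : (fun y => ((f y).re : ℂ)) + (fun y => ((f y).im : ℂ) * Complex.I) = f :=
    funext fun y => Complex.re_add_im _
  rw [e] at this
  exact this.differentiableAt.hasDerivAt

/-- The fundamental theorem of calculus for absolutely continuous complex functions. -/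
theorem integral_eq_sub_of_ac {f f' : ℝ → ℂ} (hf : AbsolutelyContinuousOnInterval f 0 Real.pi)
    (hd : ∀ᵐ x ∂μI, HasDerivAt f (f' x) x) (hi : IntervalIntegrable f' volume 0 Real.pi) :
    ∫ x in (0 : ℝ)..Real.pi, f' x = f Real.pi - f 0 := by
  have hc : ∀ (L : ℂ →L[ℝ] ℝ), (∀ x y, dist (L x) (L y) ≤ dist x y) →
      L (∫ x in (0 : ℝ)..Real.pi, f' x) = L (f Real.pi) - L (f 0) := by
    intro L hL
    rw [← L.intervalIntegral_comp_comm hi, ← (hf.comp_lipschitz hL).integral_deriv_eq_sub]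
    refine intervalIntegral.integral_congr_ae_restrict ?_
    rw [Set.uIoc_of_le Real.pi_pos.le]
    refine ae_Ioc_iff.mpr (hd.mono fun x hx => ?_)
    exact ((L.hasFDerivAt.comp_hasDerivAt x hx).deriv).symm
  refine Complex.ext ?_ ?_
  · simpa using hc Complex.reCLM dist_re_le
  · simpa using hc Complex.imCLM dist_im_le

theorem integral_by_parts_of_ac {y d d' : ℝ → ℂ}
    (hy : AbsolutelyContinuousOnInterval y 0 Real.pi) (hy' : MemLp (deriv y) 2 μI)
    (hd : ∀ x, HasDerivAt d (d' x) x) (hd' : Continuous d') :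
    ∫ x in (0 : ℝ)..Real.pi, (deriv y x * d x + y x * d' x) =
      y Real.pi * d Real.pi - y 0 * d 0 := by
  have hdc : Continuous d := continuous_iff_continuousAt.mpr fun x => (hd x).continuousAt
  have hac : AbsolutelyContinuousOnInterval d 0 Real.pi := by
    refine ContDiffOn.absolutelyContinuousOnInterval (ContDiff.contDiffOn ?_)
    refine contDiff_one_iff_deriv.mpr ⟨fun x => (hd x).differentiableAt, ?_⟩
    rwa [show deriv d = d' from funext fun x => (hd x).deriv]
  refine integral_eq_sub_of_ac (f := fun x => y x * d x) (hy.fun_smul hac) ?_ ?_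
  · filter_upwards [ae_hasDerivAt_of_ac hy] with x hx using hx.mul (hd x)
  · exact ((intervalIntegrable_of_memLp hy').mul_continuousOn hdc.continuousOn).add
      ((hy.continuousOn.mul hd'.continuousOn).intervalIntegrable)

theorem ac_integral {f : ℝ → ℂ} (hf : Integrable f) :
    AbsolutelyContinuousOnInterval (fun x => ∫ s in (0 : ℝ)..x, f s) 0 Real.pi := by
  have h : ∀ L : ℂ →L[ℝ] ℝ, AbsolutelyContinuousOnInterval
      (fun x => L (∫ s in (0 : ℝ)..x, f s)) 0 Real.pi := fun L => by
    simp_rw [← fun x => L.intervalIntegral_comp_comm (hf.intervalIntegrable (a := 0) (b := x))]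
    exact (L.integrable_comp hf).intervalIntegrable.absolutelyContinuousOnInterval_intervalIntegral
      (by simp)
  exact .of_re_im (h Complex.reCLM) (h Complex.imCLM)

/-- The linear equation `y' = μ y + f` on `[0, π]`. -/
theorem exists_ac_solution (μ : ℂ) {f : ℝ → ℂ} (hf : MemLp f 2 μI) :
    ∃ K : ℂ, ∀ c : ℂ, ∃ y : ℝ → ℂ, AbsolutelyContinuousOnInterval y 0 Real.pi ∧ y 0 = c ∧
      y Real.pi = Complex.exp (μ * Real.pi) * (c + K) ∧
      ∀ᵐ x ∂μI, HasDerivAt y (μ * y x + f x) x := by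
  -- Variation of constants. Cutting off outside [0, π] makes the integrand integrable on the whole
  -- line.
  set g : ℝ → ℂ := (Set.Icc 0 Real.pi).indicator fun s => Complex.exp (-(μ * s)) * f s with hg
  have hgi : Integrable g := by
    have : MemLp (fun s : ℝ => f s * Complex.exp (-(μ * s))) 2 μI :=
      memLp_mul_continuous hf (by fun_prop)
    refine IntegrableOn.integrable_indicator ?_ measurableSet_Icc
    refine Integrable.congr (this.integrable (by norm_num)) (ae_of_all _ fun s => ?_)
    exact mul_comm _ _
  have hexp : ∀ x : ℝ, HasDerivAt (fun x : ℝ => Complex.exp (μ * x)) (Complex.exp (μ * x) * μ) x :=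
    fun x => by simpa using (((hasDerivAt_id x).ofReal_comp.const_mul μ).cexp)
  -- K is independent of the initial value c. Boundary conditions thus become linear equations in
  -- the initial values.
  refine ⟨∫ s in (0 : ℝ)..Real.pi, g s, fun c =>
    ⟨fun x => Complex.exp (μ * x) * (c + ∫ s in (0 : ℝ)..x, g s), ?_, by simp, rfl, ?_⟩⟩
  · have h1 : AbsolutelyContinuousOnInterval (fun x : ℝ => Complex.exp (μ * x)) 0 Real.pi := by
      refine ContDiffOn.absolutelyContinuousOnInterval (ContDiff.contDiffOn ?_)
      refine contDiff_one_iff_deriv.mpr ⟨fun x => (hexp x).differentiableAt, ?_⟩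
      rw [show deriv (fun x : ℝ => Complex.exp (μ * x)) = fun x : ℝ => Complex.exp (μ * x) * μ from
        funext fun x => (hexp x).deriv]
      fun_prop
    have h2 : AbsolutelyContinuousOnInterval (fun _ : ℝ => c) 0 Real.pi :=
      ContDiffOn.absolutelyContinuousOnInterval contDiffOn_const
    exact h1.fun_smul (h2.fun_add (ac_integral hgi))
  · filter_upwards [ae_uIcc_iff.mp (hgi.intervalIntegrable (a := 0) (b := Real.pi)).ae_hasDerivAt_integral,
      ae_mem_Icc] with x hx hmem
    have hd := (hexp x).mul ((hx 0 (by simp)).const_add c)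
    refine HasDerivAt.congr_deriv (f' := _) hd ?_
    have hgx : g x = Complex.exp (-(μ * x)) * f x := by rw [hg, Set.indicator_of_mem hmem]
    have he : Complex.exp (μ * x) * Complex.exp (-(μ * x)) = 1 := by
      rw [← Complex.exp_add, add_neg_cancel, Complex.exp_zero]
    rw [hgx]
    linear_combination f x * he

/-! ### Boundary conditions -/

theorem mulVec_eq_zero_iff (M : Matrix (Fin 2) (Fin 4) ℂ) (hM : IsRegular M) (v : Fin 4 → ℂ) :
    M.mulVec v = 0 ↔ v 0 + bcb M * v 1 + bca M * v 2 = 0 ∧ bcd M * v 1 + bcc M * v 2 + v 3 = 0 := by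
  have h1 : normalized M = (cols M 0 3)⁻¹ * M := rfl
  have h2 : M = cols M 0 3 * normalized M := by
    rw [h1, ← Matrix.mul_assoc, Matrix.mul_nonsing_inv _ (isUnit_iff_ne_zero.mpr hM.1),
      Matrix.one_mul]
  have h3 : M.mulVec v = 0 ↔ (normalized M).mulVec v = 0 := by
    constructor <;> intro h
    · rw [h1, ← Matrix.mulVec_mulVec, h, Matrix.mulVec_zero]
    · rw [h2, ← Matrix.mulVec_mulVec, h, Matrix.mulVec_zero]
  obtain ⟨n1, n2, n3, n4⟩ := normalized_cols M hM
  rw [h3, funext_iff, Fin.forall_fin_two]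
  simp [Matrix.mulVec, dotProduct, Fin.sum_univ_four, n1, n2, n3, n4, bca, bcb, bcc, bcd]

/-- `z₁ = exp (iπτ₁)`. -/
def RootData.z₁ (D : RootData) : ℂ := Complex.exp (Complex.I * Real.pi * D.τ₁)

/-- `z₂ = exp (iπτ₂)`. -/
def RootData.z₂ (D : RootData) : ℂ := Complex.exp (Complex.I * Real.pi * D.τ₂)

theorem disc_eq_zero {M : Matrix (Fin 2) (Fin 4) ℂ} {D : RootData} (h : D.IsAssociated M) :
    (bcb M - bcc M) ^ 2 + 4 * bca M * bcd M = 0 := by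
  by_contra hh
  exact h.2.1 ((isStrictlyRegular_iff M h.1).mpr hh)

/-- The root functions satisfy the boundary condition. -/
theorem rootFun_bc {M : Matrix (Fin 2) (Fin 4) ℂ} {D : RootData} (hD : D.IsFor M) :
    D.α₁ * D.z₁ + bcb M * D.α₁ + bca M * D.α₂ = 0 ∧
    D.α₂ * D.z₁ + bcd M * D.α₁ + bcc M * D.α₂ = 0 ∧
    D.β₁ * D.z₂ + bcb M * (D.β₁ - D.κ * Real.pi * D.α₁) + bca M * D.β₂ = 0 ∧
    (D.β₂ + D.κ * Real.pi * D.α₂) * D.z₂ + bcd M * (D.β₁ - D.κ * Real.pi * D.α₁) +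
      bcc M * D.β₂ = 0 := by
  rcases hD with ⟨-, hk, -, -, -, -, ea, eb⟩ | ⟨-, ⟨hb, ha, hd⟩, hk, ht, hz, -⟩ | h
  · have a0 := congrFun ea 0; have a1 := congrFun ea 1
    have b0 := congrFun eb 0; have b1 := congrFun eb 1
    simp [Matrix.mulVec, dotProduct, Fin.sum_univ_two] at a0 a1 b0 b1
    simp only [RootData.z₁, RootData.z₂, hk]
    refine ⟨?_, ?_, ?_, ?_⟩
    · linear_combination a0
    · linear_combination a1
    · linear_combination b0
    · linear_combination b1
  · simp only [RootData.z₁, RootData.z₂, ← ht, hz, hk, ha, hd, hb]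
    refine ⟨?_, ?_, ?_, ?_⟩ <;> ring
  -- Failure of strict regularity means that the discriminant vanishes, so -(b + c)/2 is a double
  -- root; the identities that are not formal are multiples of this.
  · have hdisc := disc_eq_zero h
    obtain ⟨-, -, -, hk, ht, hz, h⟩ := h
    simp only [RootData.z₁, RootData.z₂, ← ht, hz, hk]
    rcases h with ⟨ha, r1, r2, r3, r4⟩ | ⟨ha, r1, r2, r3, r4⟩
    · have hb : bcb M = bcc M := by
        rw [ha] at hdisc
        have : (bcb M - bcc M) ^ 2 = 0 := by linear_combination hdisc
        exact sub_eq_zero.mp (pow_eq_zero_iff (two_ne_zero) |>.mp this)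
      rw [r1, r2, r3, r4, ha, hb]
      refine ⟨?_, ?_, ?_, ?_⟩ <;> ring
    · rw [r1, r2, r3, r4]
      refine ⟨?_, ?_, ?_, ?_⟩
      · ring
      · linear_combination hdisc / 4
      · ring
      · linear_combination -(Real.pi : ℂ) * hdisc / 4

/-- The characteristic polynomial of the free operator. -/
theorem char_eq {M : Matrix (Fin 2) (Fin 4) ℂ} {D : RootData} (hD : D.IsFor M) (Z : ℂ) :
    (Z + bcb M) * (Z + bcc M) - bca M * bcd M = (Z - D.z₁) * (Z - D.z₂) := by
  rcases hD with hs | ⟨-, ⟨hb, ha, hd⟩, hk, ht, hz, -⟩ | h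
  · obtain ⟨r1, r2, r3, r4⟩ := rootFun_bc (Or.inl hs)
    obtain ⟨-, hk, hz, -, ha, hb, -, -⟩ := hs
    -- A nontrivial solution (p, q) of the homogeneous system forces its determinant to vanish.
    have hroot : ∀ z p q : ℂ, ![p, q] ≠ 0 → p * z + bcb M * p + bca M * q = 0 →
        q * z + bcd M * p + bcc M * q = 0 → (z + bcb M) * (z + bcc M) - bca M * bcd M = 0 := by
      intro z p q hpq e1 e2
      by_cases hp : p = 0
      · have hq : q ≠ 0 := fun hq => hpq (by simp [hp, hq])
        refine (mul_eq_zero.mp (?_ : q * _ = 0)).resolve_left hq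
        linear_combination (z + bcb M) * e2 - bcd M * e1
      · refine (mul_eq_zero.mp (?_ : p * _ = 0)).resolve_left hp
        linear_combination (z + bcc M) * e1 - bca M * e2
    rw [hk] at r3 r4
    have p1 := hroot D.z₁ _ _ ha r1 r2
    have p2 := hroot D.z₂ _ _ hb (by linear_combination r3) (by linear_combination r4)
    -- Subtracting the equations of the two distinct roots gives their sum; one root and the sum
    -- determine the quadratic polynomial.
    have hsum : D.z₁ + D.z₂ + bcb M + bcc M = 0 := by
      refine (mul_eq_zero.mp (?_ : (D.z₁ - D.z₂) * _ = 0)).resolve_left (sub_ne_zero.mpr hz)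
      linear_combination p1 - p2
    linear_combination p1 + (Z - D.z₁) * hsum
  · simp only [RootData.z₁, RootData.z₂, ← ht, hz, ha, hb]
    ring
  · have hdisc := disc_eq_zero h
    obtain ⟨-, -, -, hk, ht, hz, -⟩ := h
    simp only [RootData.z₁, RootData.z₂, ← ht, hz]
    linear_combination -hdisc / 4

/-- Associated functions occur only for coinciding exponents, which allows τ₁ and τ₂ to be exchanged
in every term containing κ. -/
theorem kappa_mul_sub {M : Matrix (Fin 2) (Fin 4) ℂ} {D : RootData} (hD : D.IsFor M) :
    D.κ = 0 ∨ D.τ₁ = D.τ₂ := by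
  rcases hD with h | h | h
  exacts [Or.inl h.2.1, Or.inl h.2.2.1, Or.inr h.2.2.2.2.1]

theorem dualConj_zero_left (D : RootData) (ν : Fin 2) (n : ℤ) :
    dualConj D ν (2 * n) 0 0 = ![(D.β₂ + D.κ * D.α₂ * Real.pi) / D.Δ * D.z₁⁻¹,
      -D.α₂ / D.Δ * D.z₂⁻¹] ν := by
  rw [dualConj_zero_eq]
  fin_cases ν
  · simp [dualConj, RootData.z₁, ← Complex.exp_neg, mul_right_comm]
  · simp [dualConj, RootData.z₂, ← Complex.exp_neg, mul_right_comm]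

theorem dualConj_one_left (D : RootData) (ν : Fin 2) (n : ℤ) :
    dualConj D ν (2 * n) 0 1 = ![-(D.β₁ - D.κ * D.α₁ * Real.pi) / D.Δ, D.α₁ / D.Δ] ν := by
  rw [dualConj_one_eq]
  fin_cases ν <;> simp [dualConj]

theorem dualConj_zero_right (D : RootData) (ν : Fin 2) (n : ℤ) :
    dualConj D ν (2 * n) Real.pi 0 = ![D.β₂ / D.Δ, -D.α₂ / D.Δ] ν := by
  rw [dualConj_zero_eq, exp_two_int_pi]
  fin_cases ν <;> simp [dualConj]

theorem dualConj_one_right (D : RootData) (ν : Fin 2) (n : ℤ) :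
    dualConj D ν (2 * n) Real.pi 1 = ![-D.β₁ / D.Δ * D.z₁⁻¹, D.α₁ / D.Δ * D.z₂⁻¹] ν := by
  rw [dualConj_one_eq, Complex.exp_neg, exp_two_int_pi]
  fin_cases ν
  · simp [dualConj, RootData.z₁, ← Complex.exp_neg, mul_right_comm]
  · simp [dualConj, RootData.z₂, ← Complex.exp_neg, mul_right_comm]

/-- The dual functions satisfy the adjoint boundary condition. -/
theorem dualConj_bc {M : Matrix (Fin 2) (Fin 4) ℂ} {D : RootData} (hD : D.IsFor M)
    (ν : Fin 2) (n : ℤ) :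
    dualConj D ν (2 * n) Real.pi 0 + bcb M * dualConj D ν (2 * n) 0 0 +
      bcd M * dualConj D ν (2 * n) Real.pi 1 = 0 ∧
    bca M * dualConj D ν (2 * n) 0 0 + bcc M * dualConj D ν (2 * n) Real.pi 1 +
      dualConj D ν (2 * n) 0 1 = 0 := by
  obtain ⟨r1, r2, r3, r4⟩ := rootFun_bc hD
  have hΔ := D.Δ_ne_zero M hD
  have hz1 : D.z₁ ≠ 0 := Complex.exp_ne_zero _
  have hz2 : D.z₂ ≠ 0 := Complex.exp_ne_zero _
  have hz : D.κ = 0 ∨ D.z₁ = D.z₂ := (kappa_mul_sub hD).imp_right fun h => by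
    rw [RootData.z₁, RootData.z₂, h]
  rw [dualConj_zero_left, dualConj_zero_right, dualConj_one_left, dualConj_one_right]
  -- The columns of Φ₁ are the boundary values (y₁(0), y₂(π)) of the root functions for index 0,
  -- those of Φ₀ the values (y₁(π), y₂(0)); the boundary condition reads Φ₁ = -BΦ₀. The
  -- corresponding values of the dual functions form the rows of the inverse matrices Ψ₁ and Ψ₀, so
  -- inverting gives Ψ₀ = -Ψ₁B, the adjoint condition.
  set B : Matrix (Fin 2) (Fin 2) ℂ := !![bcb M, bca M; bcd M, bcc M]
  set Φ₀ : Matrix (Fin 2) (Fin 2) ℂ := !![D.α₁, D.β₁ - D.κ * Real.pi * D.α₁; D.α₂, D.β₂]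
  set Φ₁ : Matrix (Fin 2) (Fin 2) ℂ :=
    !![D.α₁ * D.z₁, D.β₁ * D.z₂; D.α₂ * D.z₁, (D.β₂ + D.κ * Real.pi * D.α₂) * D.z₂]
  set Ψ₀ : Matrix (Fin 2) (Fin 2) ℂ :=
    !![D.β₂ / D.Δ, -(D.β₁ - D.κ * D.α₁ * Real.pi) / D.Δ; -D.α₂ / D.Δ, D.α₁ / D.Δ] with hΨ₀
  set Ψ₁ : Matrix (Fin 2) (Fin 2) ℂ :=
    !![(D.β₂ + D.κ * D.α₂ * Real.pi) / D.Δ * D.z₁⁻¹, -D.β₁ / D.Δ * D.z₁⁻¹;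
      -D.α₂ / D.Δ * D.z₂⁻¹, D.α₁ / D.Δ * D.z₂⁻¹] with hΨ₁
  have hB : Φ₁ = -(B * Φ₀) := by
    ext i j
    fin_cases i <;> fin_cases j <;> simp [Φ₁, B, Φ₀]
    · linear_combination r1
    · linear_combination r3
    · linear_combination r2
    · linear_combination r4
  have h0 : Φ₀ * Ψ₀ = 1 := by
    ext i j
    fin_cases i <;> fin_cases j <;>
      simp [Φ₀, Ψ₀, Matrix.mul_apply, Fin.sum_univ_two] <;> field_simp <;>
      simp only [RootData.Δ] <;> ring
  have h1 : Ψ₁ * Φ₁ = 1 := by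
    ext i j
    fin_cases i <;> fin_cases j <;>
      simp [Φ₁, Ψ₁, Matrix.mul_apply, Fin.sum_univ_two] <;> field_simp <;>
      simp only [RootData.Δ] <;> ring
  have hΨ : Ψ₀ = -(Ψ₁ * B) := by
    calc Ψ₀ = Ψ₁ * Φ₁ * Ψ₀ := by rw [h1, Matrix.one_mul]
      _ = -(Ψ₁ * B * (Φ₀ * Ψ₀)) := by
          rw [hB]
          simp only [Matrix.mul_neg, Matrix.neg_mul, Matrix.mul_assoc]
      _ = -(Ψ₁ * B) := by rw [h0, Matrix.mul_one]
  have e0 := congrFun (congrFun hΨ ν) 0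
  have e1 := congrFun (congrFun hΨ ν) 1
  fin_cases ν <;>
    simp [Ψ₀, Ψ₁, B] at e0 e1 ⊢ <;>
    exact ⟨by linear_combination e0, by linear_combination e1⟩

/-! ### The free operator -/

/-- `τ₁` or `τ₂`. -/
def RootData.τ (D : RootData) (ν : Fin 2) : ℂ := ![D.τ₁, D.τ₂] ν

/-- The coupling of the dual functions: `κ` for the first, `0` for the second. -/
def RootData.κ' (D : RootData) (ν : Fin 2) : ℂ := ![D.κ, 0] ν

/-- Differentiating the polynomial factor of the first dual function produces κ times the second: in
the dual system the first function is the associated one and the second the eigenfunction. -/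
theorem hasDerivAt_dualConj_zero {M : Matrix (Fin 2) (Fin 4) ℂ} {D : RootData} (hD : D.IsFor M)
    (ν : Fin 2) (n : ℤ) (x : ℝ) :
    HasDerivAt (fun x => dualConj D ν (2 * n) x 0)
      (Complex.I * (2 * n + D.τ ν) * dualConj D ν (2 * n) x 0 +
        D.κ' ν * dualConj D 1 (2 * n) x 0) x := by
  have hx : HasDerivAt (fun x : ℝ => (x : ℂ)) 1 x := (hasDerivAt_id x).ofReal_comp
  have hk := kappa_mul_sub hD
  fin_cases ν
  · have h := (((((((hx.const_sub (Real.pi : ℂ)).const_mul (D.κ * D.α₂)).const_add D.β₂).div_const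
      D.Δ).mul ((hx.const_sub (Real.pi : ℂ)).const_mul (Complex.I * D.τ₁)).neg.cexp)).mul
      (hx.const_mul (Complex.I * ((2 * n : ℤ) : ℂ))).cexp)
    refine HasDerivAt.congr_deriv (f' := _) h ?_
    rcases hk with hk | hk
    · simp [dualConj, RootData.τ, RootData.κ', hk]
      ring
    · simp [dualConj, RootData.τ, RootData.κ', hk]
      ring
  · have h := (((hx.const_sub (Real.pi : ℂ)).const_mul (Complex.I * D.τ₂)).neg.cexp.const_mul
      (-D.α₂ / D.Δ)).mul (hx.const_mul (Complex.I * ((2 * n : ℤ) : ℂ))).cexp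
    refine HasDerivAt.congr_deriv (f' := _) h ?_
    simp [dualConj, RootData.τ, RootData.κ']
    ring

theorem hasDerivAt_dualConj_one {M : Matrix (Fin 2) (Fin 4) ℂ} {D : RootData} (hD : D.IsFor M)
    (ν : Fin 2) (n : ℤ) (x : ℝ) :
    HasDerivAt (fun x => dualConj D ν (2 * n) x 1)
      (-(Complex.I * (2 * n + D.τ ν) * dualConj D ν (2 * n) x 1 +
        D.κ' ν * dualConj D 1 (2 * n) x 1)) x := by
  have hx : HasDerivAt (fun x : ℝ => (x : ℂ)) 1 x := (hasDerivAt_id x).ofReal_comp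
  have hk := kappa_mul_sub hD
  fin_cases ν
  · have h := (((((((hx.const_sub (Real.pi : ℂ)).const_mul (D.κ * D.α₁)).const_sub D.β₁).neg.div_const
      D.Δ).mul (hx.const_mul (Complex.I * D.τ₁)).neg.cexp)).mul
      (hx.const_mul (Complex.I * ((2 * n : ℤ) : ℂ))).neg.cexp)
    refine HasDerivAt.congr_deriv (f' := _) h ?_
    rcases hk with hk | hk
    · simp [dualConj, RootData.τ, RootData.κ', hk]
      ring
    · simp [dualConj, RootData.τ, RootData.κ', hk]
      ring
  · have h := ((hx.const_mul (Complex.I * D.τ₂)).neg.cexp.const_mul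
      (D.α₁ / D.Δ)).mul (hx.const_mul (Complex.I * ((2 * n : ℤ) : ℂ))).neg.cexp
    refine HasDerivAt.congr_deriv (f' := _) h ?_
    simp [dualConj, RootData.τ, RootData.κ']
    ring

/-- The coefficients of `L⁰ u` in terms of those of `u`. -/
theorem coef_of_diracRel {M : Matrix (Fin 2) (Fin 4) ℂ} (hM : IsRegular M) {D : RootData}
    (hD : D.IsFor M) {u w : H} (h : DiracRel M 0 0 u w) (ν : Fin 2) (n : ℤ) :
    coef D w ν (2 * n) =
      (2 * n + D.τ ν) * coef D u ν (2 * n) - Complex.I * D.κ' ν * coef D u 1 (2 * n) := by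
  obtain ⟨y₁, y₂, ac₁, ac₂, m₁, m₂, hbc, hu, hw⟩ := h
  obtain ⟨b1, b2⟩ := (mulVec_eq_zero_iff M hM _).mp hbc
  simp only [Matrix.cons_val_zero, Matrix.cons_val_one, Matrix.cons_val] at b1 b2
  obtain ⟨c1, c2⟩ := dualConj_bc hD ν n
  have d0 := hasDerivAt_dualConj_zero hD ν n
  have d1 := hasDerivAt_dualConj_one hD ν n
  have k0 := continuous_dualConj D ν (2 * n) 0
  have k1 := continuous_dualConj D ν (2 * n) 1
  have k0' := continuous_dualConj D 1 (2 * n) 0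
  have k1' := continuous_dualConj D 1 (2 * n) 1
  have p1 := integral_by_parts_of_ac ac₁ m₁ d0 (by fun_prop)
  have p2 := integral_by_parts_of_ac ac₂ m₂ d1 (by fun_prop)
  have cu : ∀ η, coef D u η (2 * n) = pairing (fun x => ![y₁ x, y₂ x]) (dualConj D η (2 * n)) :=
    fun η => pairing_congr (by filter_upwards [hu] with x hx; simpa using hx)
  have cw : coef D w ν (2 * n) = pairing (fun x => ![Complex.I * deriv y₁ x, -(Complex.I * deriv y₂ x)])
      (dualConj D ν (2 * n)) :=
    pairing_congr (by filter_upwards [hw] with x hx; simpa using hx)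
  have I1 : ∀ {g : ℝ → ℂ}, Continuous g → IntervalIntegrable (fun x => y₁ x * g x) volume 0 Real.pi :=
    fun hg => (ac₁.continuousOn.mul hg.continuousOn).intervalIntegrable
  have I2 : ∀ {g : ℝ → ℂ}, Continuous g → IntervalIntegrable (fun x => y₂ x * g x) volume 0 Real.pi :=
    fun hg => (ac₂.continuousOn.mul hg.continuousOn).intervalIntegrable
  have J1 := (intervalIntegrable_of_memLp m₁).mul_continuousOn k0.continuousOn
  have J2 := (intervalIntegrable_of_memLp m₂).mul_continuousOn k1.continuousOn
  rw [intervalIntegral.integral_add J1 (I1 (by fun_prop))] at p1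
  rw [intervalIntegral.integral_add J2 (I2 (by fun_prop))] at p2
  have q1 : ∫ x in (0 : ℝ)..Real.pi, y₁ x * (Complex.I * (2 * n + D.τ ν) * dualConj D ν (2 * n) x 0 +
        D.κ' ν * dualConj D 1 (2 * n) x 0) =
      Complex.I * (2 * n + D.τ ν) * (∫ x in (0 : ℝ)..Real.pi, y₁ x * dualConj D ν (2 * n) x 0) +
        D.κ' ν * ∫ x in (0 : ℝ)..Real.pi, y₁ x * dualConj D 1 (2 * n) x 0 := by
    rw [← intervalIntegral.integral_const_mul, ← intervalIntegral.integral_const_mul,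
      ← intervalIntegral.integral_add ((I1 k0).const_mul _) ((I1 k0').const_mul _)]
    exact intervalIntegral.integral_congr fun x _ => by ring
  have q2 : ∫ x in (0 : ℝ)..Real.pi, y₂ x * -(Complex.I * (2 * n + D.τ ν) * dualConj D ν (2 * n) x 1 +
        D.κ' ν * dualConj D 1 (2 * n) x 1) =
      -(Complex.I * (2 * n + D.τ ν)) * (∫ x in (0 : ℝ)..Real.pi, y₂ x * dualConj D ν (2 * n) x 1) -
        D.κ' ν * ∫ x in (0 : ℝ)..Real.pi, y₂ x * dualConj D 1 (2 * n) x 1 := by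
    rw [← intervalIntegral.integral_const_mul, ← intervalIntegral.integral_const_mul,
      ← intervalIntegral.integral_sub ((I2 k1).const_mul _) ((I2 k1').const_mul _)]
    exact intervalIntegral.integral_congr fun x _ => by ring
  have q3 : ∫ x in (0 : ℝ)..Real.pi, (Complex.I * deriv y₁ x * dualConj D ν (2 * n) x 0 +
        -(Complex.I * deriv y₂ x) * dualConj D ν (2 * n) x 1) =
      Complex.I * (∫ x in (0 : ℝ)..Real.pi, deriv y₁ x * dualConj D ν (2 * n) x 0) -
        Complex.I * ∫ x in (0 : ℝ)..Real.pi, deriv y₂ x * dualConj D ν (2 * n) x 1 := by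
    rw [← intervalIntegral.integral_const_mul, ← intervalIntegral.integral_const_mul,
      ← intervalIntegral.integral_sub (J1.const_mul _) (J2.const_mul _)]
    exact intervalIntegral.integral_congr fun x _ => by ring
  rw [cw, cu, cu]
  simp only [pairing, Matrix.cons_val_zero, Matrix.cons_val_one, Matrix.cons_val_fin_one]
  rw [q3, intervalIntegral.integral_add (I1 k0) (I2 k1),
    intervalIntegral.integral_add (I1 k0') (I2 k1')]
  rw [q1] at p1
  rw [q2] at p2
  have hI := Complex.I_mul_I
  -- The boundary terms of the integration by parts cancel: they are a combination of the boundary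
  -- conditions for y and the adjoint ones for the dual functions.
  have hb : y₁ Real.pi * dualConj D ν (2 * n) Real.pi 0 - y₁ 0 * dualConj D ν (2 * n) 0 0 -
      (y₂ Real.pi * dualConj D ν (2 * n) Real.pi 1 - y₂ 0 * dualConj D ν (2 * n) 0 1) = 0 := by
    linear_combination y₁ Real.pi * c1 + y₂ 0 * c2 - dualConj D ν (2 * n) 0 0 * b1 -
      dualConj D ν (2 * n) Real.pi 1 * b2
  linear_combination (1 / Real.pi : ℂ) * (Complex.I * p1 - Complex.I * p2 + Complex.I * hb -
    (2 * n + D.τ ν) * ((∫ x in (0 : ℝ)..Real.pi, y₁ x * dualConj D ν (2 * n) x 0) +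
      ∫ x in (0 : ℝ)..Real.pi, y₂ x * dualConj D ν (2 * n) x 1) * hI)

/-- Solvability of `z u - L⁰ u = F` away from the zeros of the characteristic determinant. -/
theorem exists_diracRel_free {M : Matrix (Fin 2) (Fin 4) ℂ} (hM : IsRegular M) {D : RootData}
    (hD : D.IsFor M) {z : ℂ} (h1 : Complex.exp (Complex.I * Real.pi * z) ≠ D.z₁)
    (h2 : Complex.exp (Complex.I * Real.pi * z) ≠ D.z₂) (F : H) :
    ∃ u, DiracRel M 0 0 u (z • u - F) := by
  obtain ⟨K₁, s₁⟩ := exists_ac_solution (-(Complex.I * z)) ((memLp_apply F 0).const_mul Complex.I)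
  obtain ⟨K₂, s₂⟩ := exists_ac_solution (Complex.I * z) ((memLp_apply F 1).const_mul (-Complex.I))
  set Z := Complex.exp (Complex.I * Real.pi * z) with hZ
  have hZ0 : Z ≠ 0 := Complex.exp_ne_zero _
  have eZ : Complex.exp (Complex.I * z * Real.pi) = Z := by rw [hZ]; ring_nf
  have eZ' : Complex.exp (-(Complex.I * z) * Real.pi) = Z⁻¹ := by
    rw [hZ, ← Complex.exp_neg]; ring_nf
  have hdet : (Z + bcb M) * (Z + bcc M) - bca M * bcd M ≠ 0 := by
    rw [char_eq hD]
    exact mul_ne_zero (sub_ne_zero.mpr h1) (sub_ne_zero.mpr h2)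
  -- C₁ and C₂ are the initial values y₁(0) and y₂(0). The first boundary equation is multiplied by
  -- Z, and the determinant of the system is then the characteristic polynomial at Z.
  obtain ⟨C₁, C₂, hC₁, hC₂⟩ : ∃ C₁ C₂ : ℂ, (Z + bcb M) * C₁ + bca M * Z * C₂ = -(bcb M * K₁) ∧
      bcd M * Z⁻¹ * C₁ + (Z + bcc M) * C₂ = -(bcd M * Z⁻¹ * K₁ + Z * K₂) := by
    generalize -(bcb M * K₁) = r₁
    generalize -(bcd M * Z⁻¹ * K₁ + Z * K₂) = r₂
    obtain ⟨E, hE⟩ : ∃ E, E = (Z + bcb M) * (Z + bcc M) - bca M * bcd M := ⟨_, rfl⟩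
    rw [← hE] at hdet
    refine ⟨(r₁ * (Z + bcc M) - bca M * Z * r₂) / E,
      ((Z + bcb M) * r₂ - bcd M * Z⁻¹ * r₁) / E, ?_, ?_⟩
    · field_simp
      rw [hE]
      ring
    · field_simp
      rw [hE]
      ring
  obtain ⟨y₁, ac₁, y10, y11, d₁⟩ := s₁ C₁
  obtain ⟨y₂, ac₂, y20, y21, d₂⟩ := s₂ C₂
  rw [eZ'] at y11
  rw [eZ] at y21
  have cm : ∀ {y : ℝ → ℂ}, AbsolutelyContinuousOnInterval y 0 Real.pi → MemLp y 2 μI := by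
    intro y hy
    have hc := hy.continuousOn
    rw [Set.uIcc_of_le Real.pi_pos.le] at hc
    obtain ⟨C, hC⟩ := isCompact_Icc.exists_bound_of_continuousOn hc
    refine MemLp.of_bound (hc.aestronglyMeasurable measurableSet_Icc) C ?_
    filter_upwards [ae_mem_Icc] with x hx using hC x hx
  have md₁ : MemLp (deriv y₁) 2 μI := by
    refine (memLp_congr_ae ?_).mpr (((cm ac₁).const_mul (-(Complex.I * z))).add
      ((memLp_apply F 0).const_mul Complex.I))
    filter_upwards [d₁] with x hx using hx.deriv
  have md₂ : MemLp (deriv y₂) 2 μI := by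
    refine (memLp_congr_ae ?_).mpr (((cm ac₂).const_mul (Complex.I * z)).add
      ((memLp_apply F 1).const_mul (-Complex.I)))
    filter_upwards [d₂] with x hx using hx.deriv
  have hu := pairH_ae (cm ac₁) (cm ac₂)
  refine ⟨pairH (cm ac₁) (cm ac₂), y₁, y₂, ac₁, ac₂, md₁, md₂, ?_, hu, ?_⟩
  · rw [mulVec_eq_zero_iff M hM]
    simp only [Matrix.cons_val_zero, Matrix.cons_val_one, Matrix.cons_val]
    rw [y11, y21, y10, y20]
    constructor
    · linear_combination Z⁻¹ * hC₁ - (C₁ + bca M * C₂) * mul_inv_cancel₀ hZ0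
    · linear_combination hC₂
  · filter_upwards [hu, d₁, d₂, Lp.coeFn_sub (z • pairH (cm ac₁) (cm ac₂)) F,
      Lp.coeFn_smul z (pairH (cm ac₁) (cm ac₂))] with x hx e₁ e₂ hs hm
    rw [hs, Pi.sub_apply, PiLp.sub_apply, PiLp.sub_apply, hm, Pi.smul_apply, PiLp.smul_apply,
      PiLp.smul_apply, hx.1, hx.2, e₁.deriv, e₂.deriv]
    simp only [Pi.zero_apply, zero_mul, add_zero, smul_eq_mul]
    constructor
    · linear_combination (z * y₁ x - F x 0) * Complex.I_mul_I
    · linear_combination (z * y₂ x - F x 1) * Complex.I_mul_I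

/-- Perturbation of `L⁰` by the potential. -/
theorem diracRel_iff {M : Matrix (Fin 2) (Fin 4) ℂ} {D : RootData} {P Q : ℝ → ℂ}
    (hP : MemLp P 2 μI) (hQ : MemLp Q 2 μI) (a : X) (w : H) :
    DiracRel M P Q (synthL D a) w ↔ DiracRel M 0 0 (synthL D a) (w - potL D hP hQ a) := by
  have hs : ∀ᵐ x ∂μI, (w - potL D hP hQ a) x 0 = w x 0 - P x * synth D a 1 x ∧
      (w - potL D hP hQ a) x 1 = w x 1 - Q x * synth D a 0 x := by
    filter_upwards [Lp.coeFn_sub w (potL D hP hQ a), potL_ae D hP hQ a] with x h1 h2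
    rw [h1, Pi.sub_apply, PiLp.sub_apply, PiLp.sub_apply, h2.1, h2.2]
    exact ⟨rfl, rfl⟩
  constructor
  · rintro ⟨y₁, y₂, ac₁, ac₂, m₁, m₂, hbc, hu, hw⟩
    refine ⟨y₁, y₂, ac₁, ac₂, m₁, m₂, hbc, hu, ?_⟩
    filter_upwards [hu, hw, hs, synthL_ae D a] with x hu hw hs ha
    rw [hs.1, hs.2, hw.1, hw.2, ← ha.1, ← ha.2, hu.1, hu.2]
    simp
  · rintro ⟨y₁, y₂, ac₁, ac₂, m₁, m₂, hbc, hu, hw⟩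
    refine ⟨y₁, y₂, ac₁, ac₂, m₁, m₂, hbc, hu, ?_⟩
    filter_upwards [hu, hw, hs, synthL_ae D a] with x hu hw hs ha
    rw [hs.1, hs.2, ← ha.1, ← ha.2, hu.1, hu.2] at hw
    simp only [Pi.zero_apply, zero_mul, add_zero] at hw
    exact ⟨by linear_combination hw.1, by linear_combination hw.2⟩

/-- The image of an element of the domain under the full operator differs from the image under the
free one by an element of `L²`. -/
theorem exists_diracRel_sub {M : Matrix (Fin 2) (Fin 4) ℂ} {P Q : ℝ → ℂ}
    (hP : MemLp P 2 μI) (hQ : MemLp Q 2 μI) {u w : H} (h : DiracRel M P Q u w) :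
    ∃ v, DiracRel M 0 0 u (w - v) := by
  obtain ⟨y₁, y₂, ac₁, ac₂, m₁, m₂, hbc, hu, hw⟩ := h
  have hm : ∀ {f y : ℝ → ℂ}, MemLp f 2 μI → AbsolutelyContinuousOnInterval y 0 Real.pi →
      MemLp (fun x => f x * y x) 2 μI := by
    intro f y hf hy
    have hc := hy.continuousOn
    rw [Set.uIcc_of_le Real.pi_pos.le] at hc
    obtain ⟨C, hC⟩ := isCompact_Icc.exists_bound_of_continuousOn hc
    refine MemLp.of_le_mul (c := C) hf (hf.1.mul (hc.aestronglyMeasurable measurableSet_Icc)) ?_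
    filter_upwards [ae_mem_Icc] with x hx
    rw [norm_mul, mul_comm]
    exact mul_le_mul_of_nonneg_right (hC x hx) (norm_nonneg _)
  refine ⟨pairH (hm hP ac₂) (hm hQ ac₁), y₁, y₂, ac₁, ac₂, m₁, m₂, hbc, hu, ?_⟩
  filter_upwards [hw, Lp.coeFn_sub w (pairH (hm hP ac₂) (hm hQ ac₁)),
    pairH_ae (hm hP ac₂) (hm hQ ac₁)] with x hw hs hp
  rw [hs, Pi.sub_apply, PiLp.sub_apply, PiLp.sub_apply, hp.1, hp.2, hw.1, hw.2]
  simp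

/-! ### Resolvents in terms of coefficients -/

/-- The real part of the centre of the contours. -/
def RootData.center (D : RootData) : ℝ := ((D.τ₁ + D.τ₂) / 2).re

/-- `z` is separated from the spectrum `{2n + τ_ν}` of the free operator, with the constant `K`. -/
def IsSep (D : RootData) (K : ℝ) (z : ℂ) : Prop :=
  ∀ (n : ℤ) (ν : Fin 2), 1 + |z.re - D.center - 2 * n| + |z.im| ≤ K * ‖z - 2 * n - D.τ ν‖

theorem IsSep.norm_pos {D : RootData} {K : ℝ} {z : ℂ} (h : IsSep D K z) (n : ℤ) (ν : Fin 2) :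
    0 < ‖z - 2 * n - D.τ ν‖ := by
  refine norm_pos_iff.mpr fun h0 => ?_
  have h1 := h n ν
  rw [h0, norm_zero, mul_zero] at h1
  have := abs_nonneg (z.re - D.center - 2 * n)
  have := abs_nonneg z.im
  linarith

theorem IsSep.pos {D : RootData} {K : ℝ} {z : ℂ} (h : IsSep D K z) : 0 < K := by
  have h0 := h.norm_pos 0 0
  have h1 := h 0 0
  have := abs_nonneg (z.re - D.center - 2 * (0 : ℤ))
  have := abs_nonneg z.im
  exact pos_of_mul_pos_left (by linarith) h0.le

theorem IsSep.norm_inv_le {D : RootData} {K : ℝ} {z : ℂ} (h : IsSep D K z) (n : ℤ) (ν : Fin 2) :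
    ‖(z - 2 * n - D.τ ν)⁻¹‖ ≤ K * (1 + |z.re - D.center - 2 * n| + |z.im|)⁻¹ := by
  rw [norm_inv, ← div_eq_mul_inv, le_div_iff₀ (by positivity), inv_mul_le_iff₀ (h.norm_pos n ν),
    mul_comm _ K]
  exact h n ν

theorem IsSep.exp_ne {D : RootData} {K : ℝ} {z : ℂ} (h : IsSep D K z) (ν : Fin 2) :
    Complex.exp (Complex.I * Real.pi * z) ≠ Complex.exp (Complex.I * Real.pi * D.τ ν) := by
  intro he
  obtain ⟨k, hk⟩ := Complex.exp_eq_exp_iff_exists_int.mp he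
  have : z - 2 * k - D.τ ν = 0 := by
    have hI : Complex.I * Real.pi ≠ 0 := by simp [Real.pi_ne_zero]
    refine (mul_eq_zero.mp (?_ : Complex.I * Real.pi * (z - 2 * k - D.τ ν) = 0)).resolve_left hI
    linear_combination hk
  have h1 := h.norm_pos k ν
  rw [this, norm_zero] at h1
  exact h1.false

/-- The inverse of the `n`-th diagonal block of `z - L⁰`. -/
def blockInv (D : RootData) (z : ℂ) (n : ℤ) : (Fin 2 → ℂ) →ₗ[ℂ] (Fin 2 → ℂ) where
  toFun v := ![(z - 2 * n - D.τ 0)⁻¹ * (v 0 - Complex.I * D.κ * ((z - 2 * n - D.τ 1)⁻¹ * v 1)),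
    (z - 2 * n - D.τ 1)⁻¹ * v 1]
  map_add' v w := by
    ext i; fin_cases i <;> simp <;> ring
  map_smul' c v := by
    ext i; fin_cases i <;> simp <;> ring

/-- The constant in the bound for `blockInv`. -/
def blockConst (D : RootData) (K : ℝ) : ℝ := K + K * (‖D.κ‖ * K)

theorem norm_blockInv_le {D : RootData} {K : ℝ} {z : ℂ} (h : IsSep D K z) (n : ℤ) (v : Fin 2 → ℂ) :
    ‖blockInv D z n v‖ ≤
      blockConst D K * (1 + |z.re - D.center - 2 * n| + |z.im|)⁻¹ * ‖v‖ := by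
  have hK := h.pos
  set w := (1 + |z.re - D.center - 2 * n| + |z.im|)⁻¹ with hw
  have hw0 : 0 ≤ w := by positivity
  have hw1 : w ≤ 1 := inv_le_one_of_one_le₀ (by
    have := abs_nonneg (z.re - D.center - 2 * n)
    have := abs_nonneg z.im
    linarith)
  have h0 := h.norm_inv_le n 0
  have h1 := h.norm_inv_le n 1
  rw [← hw] at h0 h1
  have v0 := norm_le_pi_norm v 0
  have v1 := norm_le_pi_norm v 1
  have e1 : ‖(z - 2 * n - D.τ 1)⁻¹ * v 1‖ ≤ K * w * ‖v‖ := by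
    rw [norm_mul]; gcongr
  refine (pi_norm_le_iff_of_nonneg (by unfold blockConst; positivity)).mpr fun i => ?_
  fin_cases i
  · change ‖(z - 2 * n - D.τ 0)⁻¹ * (v 0 - Complex.I * D.κ * ((z - 2 * n - D.τ 1)⁻¹ * v 1))‖ ≤ _
    -- The coupling term contains two inverse factors; one is bounded through w ≤ 1, so that the
    -- block remains of first order in w.
    have e2 : ‖v 0 - Complex.I * D.κ * ((z - 2 * n - D.τ 1)⁻¹ * v 1)‖ ≤
        ‖v‖ + ‖D.κ‖ * (K * 1 * ‖v‖) := by
      refine (norm_sub_le _ _).trans (add_le_add v0 ?_)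
      rw [norm_mul, norm_mul, Complex.norm_I, one_mul]
      refine mul_le_mul_of_nonneg_left (e1.trans ?_) (norm_nonneg _)
      gcongr
    calc _ ≤ K * w * (‖v‖ + ‖D.κ‖ * (K * 1 * ‖v‖)) := by rw [norm_mul]; gcongr
      _ = _ := by rw [blockConst]; ring
  · refine e1.trans ?_
    have : 0 ≤ K * (‖D.κ‖ * K) := by positivity
    rw [blockConst]
    gcongr
    linarith

theorem enorm_blockInv_le {D : RootData} {K : ℝ} {z : ℂ} (h : IsSep D K z) (n : ℤ)
    (v : Fin 2 → ℂ) :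
    ‖blockInv D z n v‖ₑ ≤
      ENNReal.ofReal (blockConst D K) * (wt (z.re - D.center) z.im n * ‖v‖ₑ) := by
  have hK := h.pos
  have hb : 0 ≤ blockConst D K := by unfold blockConst; positivity
  rw [wt, ← ofReal_norm, ← ofReal_norm, ← ENNReal.ofReal_mul (by positivity),
    ← ENNReal.ofReal_mul hb, ← mul_assoc]
  exact ENNReal.ofReal_le_ofReal (norm_blockInv_le h n v)

/-- A constant in Bessel's inequality for the system of root functions. -/
def besselConst (D : RootData) : ℝ≥0∞ := (exists_ellTwo_coefL_le D).choose

theorem besselConst_ne_top (D : RootData) : besselConst D ≠ ⊤ :=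
  (exists_ellTwo_coefL_le D).choose_spec.1

theorem ellTwo_coefL_le (D : RootData) (F : H) :
    ellTwo (fun n : ℤ => ‖coefL D n F‖ₑ) ≤ besselConst D * ‖F‖ₑ :=
  (exists_ellTwo_coefL_le D).choose_spec.2 F

theorem tsum_enorm_blockInv_le {D : RootData} {K : ℝ} {z : ℂ} (h : IsSep D K z) (F : H) :
    ∑' n, ‖blockInv D z n (coefL D n F)‖ₑ ≤ ENNReal.ofReal (blockConst D K) *
      ∑' n, wt (z.re - D.center) z.im n * ‖coefL D n F‖ₑ := by
  rw [← ENNReal.tsum_mul_left]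
  exact ENNReal.tsum_le_tsum fun n => enorm_blockInv_le h n _

/-- The constant in the bound for `freeRes`. -/
def freeConst (D : RootData) (K : ℝ) : ℝ≥0∞ :=
  ENNReal.ofReal (blockConst D K) * (2 * besselConst D)

theorem freeConst_ne_top (D : RootData) (K : ℝ) : freeConst D K ≠ ⊤ :=
  ENNReal.mul_ne_top (by simp) (ENNReal.mul_ne_top (by simp) (besselConst_ne_top D))

/-- Cauchy–Schwarz and Bessel. This is why the free resolvent maps L² into ℓ¹, with norm O((1 +
|t|)^(-1/2)). -/
theorem tsum_enorm_blockInv_le' {D : RootData} {K : ℝ} {z : ℂ} (h : IsSep D K z) (F : H) :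
    ∑' n, ‖blockInv D z n (coefL D n F)‖ₑ ≤ freeConst D K * decay z.im * ‖F‖ₑ := by
  refine (tsum_enorm_blockInv_le h F).trans ?_
  calc _ ≤ ENNReal.ofReal (blockConst D K) * (2 * decay z.im * (besselConst D * ‖F‖ₑ)) := by
        gcongr
        exact (tsum_wt_mul_le _ _ _).trans (by gcongr; exact ellTwo_coefL_le D F)
    _ = _ := by rw [freeConst]; ring

theorem decay_le_one (t : ℝ) : decay t ≤ 1 := by
  rw [decay, ← ENNReal.ofReal_one]
  exact ENNReal.ofReal_le_ofReal (Real.rpow_le_one_of_one_le_of_nonpos (by simp) (by norm_num))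

theorem memlp_one_of_tsum_enorm {a : ℤ → Fin 2 → ℂ} (h : ∑' n, ‖a n‖ₑ ≠ ⊤) : Memℓp a 1 := by
  refine memℓp_gen ?_
  have : Summable fun n => ‖a n‖₊ := ENNReal.tsum_coe_ne_top_iff_summable.mp h
  simpa using NNReal.summable_coe.mpr this

theorem memlp_blockInv {D : RootData} {K : ℝ} {z : ℂ} (h : IsSep D K z) (F : H) :
    Memℓp (fun n => blockInv D z n (coefL D n F)) 1 := by
  refine memlp_one_of_tsum_enorm (ne_top_of_le_ne_top ?_ (tsum_enorm_blockInv_le' h F))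
  exact ENNReal.mul_ne_top (ENNReal.mul_ne_top (freeConst_ne_top D K)
    (ne_top_of_le_ne_top ENNReal.one_ne_top (decay_le_one _))) enorm_ne_top

open Classical in
/-- The coefficients of `(z - L⁰)⁻¹ F`, as a bounded operator into `ℓ¹`. -/
def freeRes (D : RootData) (z : ℂ) : H →L[ℂ] X :=
  if h : ∃ K, IsSep D K z then
    clmOfEnorm (C := freeConst D h.choose)
      { toFun := fun F => ⟨fun n => blockInv D z n (coefL D n F), memlp_blockInv h.choose_spec F⟩
        map_add' := fun F G => by
          ext n : 2
          change blockInv D z n (coefL D n (F + G)) =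
            blockInv D z n (coefL D n F) + blockInv D z n (coefL D n G)
          rw [map_add, map_add]
        map_smul' := fun c F => by
          ext n : 2
          change blockInv D z n (coefL D n (c • F)) = c • blockInv D z n (coefL D n F)
          rw [map_smul, map_smul] }
      (freeConst_ne_top D h.choose) fun F => by
        rw [enorm_X]
        refine (tsum_enorm_blockInv_le' h.choose_spec F).trans ?_
        gcongr
        exact mul_le_of_le_one_right' (decay_le_one _)
  else 0

/-- The constant chosen in the definition enters only the proof of boundedness. The coefficients do
not depend on it, so later bounds hold with any admissible K. -/
theorem freeRes_apply {D : RootData} {K : ℝ} {z : ℂ} (h : IsSep D K z) (F : H) (n : ℤ) :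
    freeRes D z F n = blockInv D z n (coefL D n F) := by
  rw [freeRes, dif_pos ⟨K, h⟩]
  rfl

theorem enorm_freeRes_le {D : RootData} {K : ℝ} {z : ℂ} (h : IsSep D K z) (F : H) :
    ‖freeRes D z F‖ₑ ≤ ENNReal.ofReal (blockConst D K) *
      ∑' n, wt (z.re - D.center) z.im n * ‖coefL D n F‖ₑ := by
  rw [enorm_X]
  simp_rw [freeRes_apply h]
  exact tsum_enorm_blockInv_le h F

theorem enorm_freeRes_le' {D : RootData} {K : ℝ} {z : ℂ} (h : IsSep D K z) (F : H) :
    ‖freeRes D z F‖ₑ ≤ freeConst D K * decay z.im * ‖F‖ₑ := by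
  rw [enorm_X]
  simp_rw [freeRes_apply h]
  exact tsum_enorm_blockInv_le' h F

theorem blockInv_eq {D : RootData} {K : ℝ} {z : ℂ} (h : IsSep D K z) {n : ℤ} {u F : Fin 2 → ℂ}
    (h0 : (z - 2 * n - D.τ 0) * u 0 + Complex.I * D.κ * u 1 = F 0)
    (h1 : (z - 2 * n - D.τ 1) * u 1 = F 1) : blockInv D z n F = u := by
  have n0 := norm_pos_iff.mp (h.norm_pos n 0)
  have n1 := norm_pos_iff.mp (h.norm_pos n 1)
  have e1 : (z - 2 * n - D.τ 1)⁻¹ * F 1 = u 1 := by rw [← h1, inv_mul_cancel_left₀ n1]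
  ext i
  fin_cases i
  · change (z - 2 * n - D.τ 0)⁻¹ * (F 0 - Complex.I * D.κ * ((z - 2 * n - D.τ 1)⁻¹ * F 1)) = u 0
    rw [e1, inv_mul_eq_iff_eq_mul₀ n0]
    linear_combination -h0
  · exact e1

/-- The equation determines the coefficients of u, which gives uniqueness and the formula;
solvability comes from the differential equation. That the series lies in the domain is not checked
directly: it must coincide with the solution. -/
theorem isResolventAt_free {M : Matrix (Fin 2) (Fin 4) ℂ} (hM : IsRegular M) {D : RootData}
    (hD : D.IsFor M) {K : ℝ} {z : ℂ} (h : IsSep D K z) :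
    IsResolventAt M 0 0 z ((synthL D).comp (freeRes D z)) := by
  have hΔ := D.Δ_ne_zero M hD
  have key : ∀ F u : H, DiracRel M 0 0 u (z • u - F) → u = synthL D (freeRes D z F) := by
    intro F u hr
    refine eq_of_coefL_eq D hΔ fun n => ?_
    rw [coefL_synthL D hΔ, freeRes_apply h, eq_comm]
    have hc := fun ν => coef_of_diracRel hM hD hr ν n
    simp only [← coefL_apply, map_sub, map_smul, Pi.sub_apply, Pi.smul_apply, smul_eq_mul] at hc
    refine blockInv_eq h ?_ ?_
    · have := hc 0
      simp only [RootData.κ', Matrix.cons_val_zero] at this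
      linear_combination this
    · have := hc 1
      simp only [RootData.κ', Matrix.cons_val_one, Matrix.cons_val_fin_one] at this
      linear_combination this
  intro F u
  refine ⟨fun hu => ?_, key F u⟩
  obtain ⟨u', hu'⟩ := exists_diracRel_free hM hD (h.exp_ne 0) (h.exp_ne 1) F
  rwa [hu, ContinuousLinearMap.comp_apply, ← key F u' hu']

/-- A resolvent is unique, so the choice made in `resolv` is immaterial. -/
theorem resolv_eq {M : Matrix (Fin 2) (Fin 4) ℂ} {P Q : ℝ → ℂ} {z : ℂ} {R : H →L[ℂ] H}
    (h : IsResolventAt M P Q z R) : resolv M P Q z = R := by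
  have hex : ∃ R : H →L[ℂ] H, IsResolventAt M P Q z R := ⟨R, h⟩
  rw [resolv, dif_pos hex]
  ext1 F
  exact (h F _).mpr ((hex.choose_spec F _).mp rfl)

/-- The operator `V (z - L⁰)⁻¹`. -/
def potRes (D : RootData) {P Q : ℝ → ℂ} (hP : MemLp P 2 μI) (hQ : MemLp Q 2 μI) (z : ℂ) : H →L[ℂ] H :=
  (potL D hP hQ).comp (freeRes D z)

/-- The formula (z - L)⁻¹ = R⁰(1 - VR⁰)⁻¹, in which only VR⁰ has to be bounded on L². -/
theorem isResolventAt_pert {M : Matrix (Fin 2) (Fin 4) ℂ} (hM : IsRegular M) {D : RootData}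
    (hD : D.IsFor M) {P Q : ℝ → ℂ} (hP : MemLp P 2 μI) (hQ : MemLp Q 2 μI) {K : ℝ} {z : ℂ}
    (h : IsSep D K z) (hu : IsUnit (1 - potRes D hP hQ z)) :
    IsResolventAt M P Q z
      ((synthL D).comp ((freeRes D z).comp (Ring.inverse (1 - potRes D hP hQ z)))) := by
  have hΔ := D.Δ_ne_zero M hD
  have h0 := isResolventAt_free hM hD h
  set S := Ring.inverse (1 - potRes D hP hQ z)
  have s1 : ∀ F, S F - potL D hP hQ (freeRes D z (S F)) = F := fun F => by
    exact congrArg (fun A : H →L[ℂ] H => A F) (Ring.mul_inverse_cancel _ hu)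
  have s2 : ∀ G, S (G - potL D hP hQ (freeRes D z G)) = G := fun G => by
    exact congrArg (fun A : H →L[ℂ] H => A G) (Ring.inverse_mul_cancel _ hu)
  intro F u
  simp only [ContinuousLinearMap.comp_apply]
  constructor
  · intro he
    have h1 := (h0 (S F) u).mp he
    rw [he, diracRel_iff hP hQ]
    rw [he] at h1
    convert h1 using 1
    linear_combination (norm := module) s1 F
  · intro hr
    -- Every u in the domain is first written as R⁰ of some element of L². It then has an absolutely
    -- convergent expansion a, and Vu is given by `potL`.
    obtain ⟨v, hv⟩ := exists_diracRel_sub hP hQ hr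
    rw [sub_sub] at hv
    have h1 : u = synthL D (freeRes D z (F + v)) := (h0 _ _).mpr hv
    set a := freeRes D z (F + v) with ha
    rw [h1, diracRel_iff hP hQ, sub_sub] at hr
    have h2 : synthL D a = synthL D (freeRes D z (F + potL D hP hQ a)) := (h0 _ _).mpr hr
    have h3 : a = freeRes D z (F + potL D hP hQ a) := by
      ext n : 2
      rw [← coefL_synthL D hΔ, h2, coefL_synthL D hΔ]
    -- For G = F + Va one has R⁰G = u and G - VR⁰G = F, hence SF = G.
    have h4 := s2 (F + potL D hP hQ a)
    rw [← h3, add_sub_cancel_right] at h4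
    rw [h4, ← h3, h1]

/-! ### Estimates away from the spectrum -/

/-- A bound for the imaginary parts of `τ₁`, `τ₂`. -/
def RootData.imBound (D : RootData) : ℝ := |D.τ₁.im| + |D.τ₂.im|

theorem RootData.imBound_nonneg (D : RootData) : 0 ≤ D.imBound := by
  unfold RootData.imBound; positivity

/-- The normalization |Re τ₁ - Re τ₂| ≤ 1 is used here: the lines at odd distance from the centre
stay at least 1/2 away from the spectrum. -/
theorem abs_re_tau_sub_center_le {M : Matrix (Fin 2) (Fin 4) ℂ} {D : RootData} (hD : D.IsFor M)
    (ν : Fin 2) : |(D.τ ν).re - D.center| ≤ 1 / 2 := by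
  have h : |D.τ₁.re - D.τ₂.re| ≤ 1 := by
    rcases hD with h | h | h
    · exact h.2.2.2.1
    · simp [h.2.2.2.1]
    · simp [h.2.2.2.2.1]
  have hc : D.center = (D.τ₁.re + D.τ₂.re) / 2 := by
    rw [RootData.center, Complex.div_re]
    simp [Complex.normSq_ofNat]
    ring
  rw [abs_le] at h ⊢
  rw [hc]
  fin_cases ν
  · change -(1 / 2) ≤ D.τ₁.re - _ ∧ D.τ₁.re - _ ≤ _
    constructor <;> linarith [h.1, h.2]
  · change -(1 / 2) ≤ D.τ₂.re - _ ∧ D.τ₂.re - _ ≤ _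
    constructor <;> linarith [h.1, h.2]

/-- The separation constant on the lines `Re z = center + odd` and on the half-planes
`|Im z| ≥ 2 imBound + 1`. -/
def RootData.sepConst (D : RootData) : ℝ := 6 + 2 * D.imBound

/-- With d the distance to the spectral point, the left side is at most 2d + 3/2 + `imBound`, and d
≥ 1/2 in both cases absorbs the constants. -/
theorem isSep_of_odd_or_im {M : Matrix (Fin 2) (Fin 4) ℂ} {D : RootData} (hD : D.IsFor M) {z : ℂ}
    (h : (∃ j : ℤ, z.re - D.center = 2 * j + 1) ∨ 2 * D.imBound + 1 ≤ |z.im|) :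
    IsSep D D.sepConst z := by
  intro n ν
  have hB := D.imBound_nonneg
  have hre := Complex.abs_re_le_norm (z - 2 * n - D.τ ν)
  have him := Complex.abs_im_le_norm (z - 2 * n - D.τ ν)
  have e1 : (z - 2 * n - D.τ ν).re = (z.re - D.center - 2 * n) - ((D.τ ν).re - D.center) := by
    simp
    ring
  have e2 : (z - 2 * n - D.τ ν).im = z.im - (D.τ ν).im := by simp
  have ht : |(D.τ ν).im| ≤ D.imBound := by
    unfold RootData.imBound
    fin_cases ν
    · exact le_add_of_nonneg_right (abs_nonneg _)
    · exact le_add_of_nonneg_left (abs_nonneg _)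
  rw [e1] at hre
  rw [e2] at him
  have h1 := (abs_sub_abs_le_abs_sub (z.re - D.center - 2 * n) ((D.τ ν).re - D.center)).trans hre
  have h2 := (abs_sub_abs_le_abs_sub z.im (D.τ ν).im).trans him
  have h3 := abs_re_tau_sub_center_le hD ν
  set d := ‖z - 2 * n - D.τ ν‖
  rw [RootData.sepConst]
  rcases h with ⟨j, hj⟩ | h
  · have hs : 1 ≤ |z.re - D.center - 2 * n| := by
      have : z.re - D.center - 2 * n = ((2 * (j - n) + 1 : ℤ) : ℝ) := by push_cast; linarith
      rw [this, ← Int.cast_abs]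
      exact_mod_cast Int.one_le_abs (by omega)
    have hd : 1 / 2 ≤ d := by linarith
    nlinarith
  · have hd : 1 / 2 ≤ d := by linarith
    nlinarith

/-- The distance from z₀ to the spectrum is at least 1/K, so a displacement of 1/(2K) at most halves
it. Openness is needed to differentiate `freeRes`, which has a default value at points that are not
separated. -/
theorem IsSep.eventually {D : RootData} {K : ℝ} {z₀ : ℂ} (h : IsSep D K z₀) :
    ∀ᶠ z in 𝓝 z₀, IsSep D (2 * (K + 1)) z := by
  have hK := h.pos
  filter_upwards [Metric.closedBall_mem_nhds z₀ (show 0 < 1 / (2 * K) by positivity)] with z hz n ν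
  rw [Metric.mem_closedBall, dist_eq_norm] at hz
  have h0 := h n ν
  have hr := (Complex.abs_re_le_norm (z - z₀)).trans hz
  have hi := (Complex.abs_im_le_norm (z - z₀)).trans hz
  rw [Complex.sub_re] at hr
  rw [Complex.sub_im] at hi
  have e : z₀ - 2 * n - D.τ ν = (z - 2 * n - D.τ ν) - (z - z₀) := by ring
  have hn : ‖z₀ - 2 * n - D.τ ν‖ ≤ ‖z - 2 * n - D.τ ν‖ + 1 / (2 * K) := by
    rw [e]; exact (norm_sub_le _ _).trans (by gcongr)
  have hl : 1 / K ≤ ‖z₀ - 2 * n - D.τ ν‖ := by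
    rw [div_le_iff₀ hK, mul_comm]
    have := abs_nonneg (z₀.re - D.center - 2 * n)
    have := abs_nonneg z₀.im
    linarith
  have e2 : 1 / K = 2 * (1 / (2 * K)) := by field_simp
  rw [e2] at hl
  have a1 : |z.re - D.center - 2 * n| ≤ |z₀.re - D.center - 2 * n| + |z.re - z₀.re| := by
    rw [show z.re - D.center - 2 * n = (z₀.re - D.center - 2 * n) + (z.re - z₀.re) by ring]
    exact abs_add_le _ _
  have a2 : |z.im| ≤ |z₀.im| + |z.im - z₀.im| := by
    conv_lhs => rw [show z.im = z₀.im + (z.im - z₀.im) by ring]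
    exact abs_add_le _ _
  set ε := 1 / (2 * K)
  set d₀ := ‖z₀ - 2 * n - D.τ ν‖
  set d := ‖z - 2 * n - D.τ ν‖
  have h5 : d₀ ≤ 2 * d := by linarith
  calc _ ≤ (K + 1) * d₀ := by linarith
    _ ≤ (K + 1) * (2 * d) := by gcongr
    _ = _ := by ring

/-- Hilbert's identity R⁰(z₀) = R⁰(z) + (z - z₀)R⁰(z₀)R⁰(z) on the level of coefficients, verified
block by block. -/
theorem freeRes_resolvent_identity {D : RootData} (hΔ : D.Δ ≠ 0) {K₀ K : ℝ} {z₀ z : ℂ}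
    (h₀ : IsSep D K₀ z₀) (h : IsSep D K z) :
    (1 + (z - z₀) • (freeRes D z₀).comp (synthL D)).comp (freeRes D z) = freeRes D z₀ := by
  ext1 F
  ext n : 2
  set a := freeRes D z F with ha
  change (a + (z - z₀) • freeRes D z₀ (synthL D a)) n = freeRes D z₀ F n
  rw [lp.coeFn_add, Pi.add_apply, lp.coeFn_smul, Pi.smul_apply, freeRes_apply h₀, freeRes_apply h₀,
    coefL_synthL D hΔ, eq_comm, ← map_smul]
  have n0 := norm_pos_iff.mp (h.norm_pos n 0)
  have n1 := norm_pos_iff.mp (h.norm_pos n 1)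
  have hF : coefL D n F = ![(z - 2 * n - D.τ 0) * a n 0 + Complex.I * D.κ * a n 1,
      (z - 2 * n - D.τ 1) * a n 1] := by
    have a0 : a n 0 = (z - 2 * n - D.τ 0)⁻¹ *
        (coefL D n F 0 - Complex.I * D.κ * ((z - 2 * n - D.τ 1)⁻¹ * coefL D n F 1)) := by
      rw [ha, freeRes_apply h]; rfl
    have a1 : a n 1 = (z - 2 * n - D.τ 1)⁻¹ * coefL D n F 1 := by
      rw [ha, freeRes_apply h]; rfl
    ext i
    fin_cases i
    · simp [a0, a1, n0]
    · simp [a1, n1]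
  rw [← sub_eq_iff_eq_add, ← map_sub, hF]
  refine blockInv_eq h₀ ?_ ?_
  · simp
    ring
  · simp
    ring

/-- Hilbert's identity is solved for R⁰(z): the operator applied to it is affine in z and equals 1
at z₀, so its inverse is holomorphic nearby. -/
theorem differentiableAt_freeRes {D : RootData} (hΔ : D.Δ ≠ 0) {K : ℝ} {z₀ : ℂ} (h : IsSep D K z₀) :
    DifferentiableAt ℂ (freeRes D) z₀ := by
  set A : ℂ → X →L[ℂ] X := fun z => 1 + (z - z₀) • (freeRes D z₀).comp (synthL D) with hA
  have dA : DifferentiableAt ℂ A z₀ := by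
    refine (differentiableAt_const _).add (DifferentiableAt.smul_const ?_ _)
    exact differentiableAt_id.sub_const _
  have A0 : A z₀ = 1 := by simp [hA]
  have hu : ∀ᶠ z in 𝓝 z₀, IsUnit (A z) := by
    have : {B : X →L[ℂ] X | IsUnit B} ∈ 𝓝 (A z₀) := by
      rw [A0]
      exact Units.isOpen.mem_nhds isUnit_one
    exact dA.continuousAt this
  have he : ∀ᶠ z in 𝓝 z₀, freeRes D z = (Ring.inverse (A z)).comp (freeRes D z₀) := by
    filter_upwards [hu, h.eventually] with z hz hs
    rw [← freeRes_resolvent_identity hΔ h hs, ← ContinuousLinearMap.comp_assoc]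
    change _ = (Ring.inverse (A z) * A z).comp _
    rw [Ring.inverse_mul_cancel _ hz]
    rfl
  refine DifferentiableAt.congr_of_eventuallyEq ?_ he
  have hi : DifferentiableAt ℂ (fun z => Ring.inverse (A z)) z₀ := by
    have h1 : IsUnit (A z₀) := by rw [A0]; exact isUnit_one
    exact (differentiableAt_inverse (𝕜 := ℂ) h1).comp z₀ dA
  exact hi.clm_comp (differentiableAt_const _)

theorem differentiableAt_potRes {D : RootData} (hΔ : D.Δ ≠ 0) {P Q : ℝ → ℂ} (hP : MemLp P 2 μI)
    (hQ : MemLp Q 2 μI) {K : ℝ} {z₀ : ℂ} (h : IsSep D K z₀) :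
    DifferentiableAt ℂ (potRes D hP hQ) z₀ :=
  (differentiableAt_const _).clm_comp (differentiableAt_freeRes hΔ h)

/-! ### Norm bounds for VR⁰ and R⁰VR⁰ at separated points. -/

theorem enorm_clm_le {E G : Type*} [NormedAddCommGroup E] [NormedSpace ℂ E] [NormedAddCommGroup G]
    [NormedSpace ℂ G] {A : E →L[ℂ] G} {C : ℝ≥0∞} (h : ∀ x, ‖A x‖ₑ ≤ C * ‖x‖ₑ) : ‖A‖ₑ ≤ C := by
  by_cases hC : C = ⊤
  · simp [hC]
  rw [← ofReal_norm, ← ENNReal.ofReal_toReal hC]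
  refine ENNReal.ofReal_le_ofReal (A.opNorm_le_bound ENNReal.toReal_nonneg fun x => ?_)
  have := h x
  rwa [← ofReal_norm, ← ofReal_norm, ← ENNReal.ofReal_toReal hC,
    ← ENNReal.ofReal_mul ENNReal.toReal_nonneg, ENNReal.ofReal_le_ofReal_iff (by positivity)] at this

/-- The sequence `r` on the even integers, indexed by all integers. -/
def rEnn (D : RootData) (P Q : ℝ → ℂ) (m : ℤ) : ℝ≥0∞ := ENNReal.ofReal (rSeq D P Q (2 * m))

/-- Small for large |Im z| only. Near the real axis it gives mere boundedness, and the square of VR⁰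
has to be used. -/
theorem enorm_potRes_le {D : RootData} {P Q : ℝ → ℂ} (hP : MemLp P 2 μI)
    (hQ : MemLp Q 2 μI) {K : ℝ} {z : ℂ} (h : IsSep D K z) :
    ‖potRes D hP hQ z‖ₑ ≤ ‖potL D hP hQ‖ₑ * freeConst D K * decay z.im := by
  refine enorm_clm_le fun F => ?_
  refine ((potL D hP hQ).le_opENorm (freeRes D z F)).trans ?_
  rw [mul_assoc, mul_assoc, ← mul_assoc (freeConst D K)]
  exact mul_le_mul_right (enorm_freeRes_le' h F) _

/-- The bound for the coefficients of `R⁰ V R⁰ F` as a double sum. -/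
theorem enorm_freeRes_potRes_le {D : RootData} {P Q : ℝ → ℂ} (hP : MemLp P 2 μI)
    (hQ : MemLp Q 2 μI) {K : ℝ} {z : ℂ} (h : IsSep D K z) (F : H) :
    ‖freeRes D z (potRes D hP hQ z F)‖ₑ ≤ 2 * ENNReal.ofReal (blockConst D K) ^ 2 *
      ∑' j, wt (z.re - D.center) z.im j * ∑' k, rEnn D P Q (j + k) *
        (wt (z.re - D.center) z.im k * ‖coefL D k F‖ₑ) := by
  refine (enorm_freeRes_le h _).trans ?_
  set C := ENNReal.ofReal (blockConst D K)
  set W := wt (z.re - D.center) z.im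
  have h1 : ∀ n, ‖coefL D n (potRes D hP hQ z F)‖ₑ ≤
      2 * C * ∑' k, rEnn D P Q (n + k) * (W k * ‖coefL D k F‖ₑ) := fun n => by
    have e := enorm_coefL_potL_le D hP hQ n (freeRes D z F)
    simp_rw [freeRes_apply h] at e
    refine e.trans ?_
    rw [mul_assoc, ← ENNReal.tsum_mul_left (a := C)]
    refine mul_le_mul_right (ENNReal.tsum_le_tsum fun k => ?_) _
    rw [mul_left_comm C]
    exact mul_le_mul_right (enorm_blockInv_le h k _) _
  calc _ ≤ C * ∑' n, W n * (2 * C * ∑' k, rEnn D P Q (n + k) * (W k * ‖coefL D k F‖ₑ)) := by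
        gcongr with n
        exact h1 n
    _ = _ := by
        simp_rw [mul_left_comm (W _)]
        rw [ENNReal.tsum_mul_left]
        ring

/-! ### Decay of the second-order term -/

theorem exists_of_eventually_cocompact {p : ℝ → Prop} (h : ∀ᶠ x in cocompact ℝ, p x) :
    ∃ r : ℝ, ∀ x, r ≤ |x| → p x := by
  rw [← Metric.cobounded_eq_cocompact] at h
  obtain ⟨r, -, hr⟩ := hasBasis_cobounded_norm.eventually_iff.mp h
  exact ⟨r, fun x hx => hr hx⟩

theorem tendsto_decay : Tendsto decay (cocompact ℝ) (𝓝 0) := by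
  have := tendsto_one_add_abs_rpow (show (0 : ℝ) < 1 / 2 by norm_num) 0
  simp only [Int.cast_zero, mul_zero, sub_zero] at this
  exact this

theorem measurable_decay : Measurable decay := by
  unfold decay; fun_prop

theorem measurable_wt (x : ℝ) (k : ℤ) : Measurable fun t => wt x t k := by
  unfold wt; fun_prop

/-- The double sum which controls `R⁰ V R⁰ F`. -/
def dblSum (r g : ℤ → ℝ≥0∞) (x t : ℝ) : ℝ≥0∞ :=
  ∑' j, wt x t j * ∑' k, r (j + k) * (wt x t k * g k)

theorem wt_le_rpow (x t : ℝ) (k : ℤ) : wt x t k ≤ ENNReal.ofReal ((1 + |x - 2 * k|) ^ (-1 : ℝ)) := by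
  rw [Real.rpow_neg_one, wt]
  refine ENNReal.ofReal_le_ofReal (inv_anti₀ (by positivity) ?_)
  exact le_add_of_nonneg_right (abs_nonneg t)

/-- All decay in t is given up in exchange for a pointwise bound with weight of exponent 1, for
which r in ℓ² is enough. It controls (VR⁰)² on far vertical lines. -/
theorem dblSum_le (r g : ℤ → ℝ≥0∞) (x t : ℝ) :
    dblSum r g x t ≤
      4 * ellTwo g * ∑' m, r m * ENNReal.ofReal ((1 + |2 * x - 2 * m|) ^ (-1 : ℝ)) := by
  refine (tsum_tsum_le_right x t r g).trans ?_
  refine mul_le_mul_right (ENNReal.tsum_le_tsum fun m => mul_le_mul_right ?_ _) _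
  exact (mul_le_of_le_one_left' (decay_le_one t)).trans (wt_le_rpow _ _ _)

/-- Tonelli's theorem; integration in t turns the weight into the inverse square root of the
distance. -/
theorem lintegral_tsum_decay_mul_wt_le (s : ℤ → ℝ≥0∞) (x : ℝ) :
    ∫⁻ t, ∑' k, s k * (decay t * wt x t k) ≤ ENNReal.ofReal (4 * Real.pi) *
      ∑' k, s k * ENNReal.ofReal ((1 + |x - 2 * k|) ^ (-(1 / 2) : ℝ)) := by
  have hm : ∀ k, Measurable fun t => decay t * wt x t k := fun k =>
    measurable_decay.mul (measurable_wt x k)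
  rw [lintegral_tsum fun k => ((hm k).const_mul _).aemeasurable, ← ENNReal.tsum_mul_left]
  refine ENNReal.tsum_le_tsum fun k => ?_
  rw [lintegral_const_mul _ (hm k), mul_left_comm]
  exact mul_le_mul_right (lintegral_decay_mul_wt_le x k) _

theorem lintegral_dblSum_le_left (r g : ℤ → ℝ≥0∞) (x : ℝ) (hr : ellTwo r ≠ ⊤) :
    ∫⁻ t, dblSum r g x t ≤ 2 * ellTwo r * (ENNReal.ofReal (4 * Real.pi) *
      ∑' k, g k * ENNReal.ofReal ((1 + |x - 2 * k|) ^ (-(1 / 2) : ℝ))) := by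
  refine (lintegral_mono fun t => tsum_tsum_le_left x t r g).trans ?_
  rw [lintegral_const_mul' _ _ (ENNReal.mul_ne_top (by simp) hr)]
  exact mul_le_mul_right (lintegral_tsum_decay_mul_wt_le g x) _

theorem lintegral_dblSum_le_right (r g : ℤ → ℝ≥0∞) (x : ℝ) (hg : ellTwo g ≠ ⊤) :
    ∫⁻ t, dblSum r g x t ≤ 4 * ellTwo g * (ENNReal.ofReal (4 * Real.pi) *
      ∑' k, r k * ENNReal.ofReal ((1 + |2 * x - 2 * k|) ^ (-(1 / 2) : ℝ))) := by
  refine (lintegral_mono fun t => tsum_tsum_le_right x t r g).trans ?_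
  rw [lintegral_const_mul' _ _ (ENNReal.mul_ne_top (by simp) hg)]
  exact mul_le_mul_right (lintegral_tsum_decay_mul_wt_le r (2 * x)) _

theorem tendsto_two_mul_cocompact : Tendsto (fun x : ℝ => 2 * x) (cocompact ℝ) (cocompact ℝ) :=
  (Homeomorph.mulLeft₀ (2 : ℝ) two_ne_zero).isClosedEmbedding.tendsto_cocompact

/-- A sequence `s` is admissible if its convolution with `(1 + |k|)^(-1/2)` tends to zero. -/
def IsAdmissible (s : ℤ → ℝ≥0∞) : Prop :=
  Tendsto (fun x : ℝ => ∑' k, s k * ENNReal.ofReal ((1 + |x - 2 * k|) ^ (-(1 / 2) : ℝ)))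
    (cocompact ℝ) (𝓝 0)

/-- The exponent conjugate to p exceeds 2 precisely when p < 2, which makes the inverse square root
summable to that power. -/
theorem InEllP.isAdmissible {p : ℝ} {s : ℤ → ℝ} (h : InEllP p s) (h1 : 1 < p) (h2 : p < 2) :
    IsAdmissible fun n => ENNReal.ofReal |s (2 * n)| := by
  have hpq := Real.HolderConjugate.conjExponent h1
  refine tendsto_tsum_of_ellP hpq ?_ _ ?_
  · rw [Real.conjExponent, ← mul_div_assoc, lt_div_iff₀ (by linarith)]
    linarith
  · have := h.tsum_ofReal_ne_top
    simpa only [ENNReal.ofReal_rpow_of_nonneg (abs_nonneg _) (zero_le_one.trans h1.le)] using this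

/-- At p = 2 the dual sum of the inverse square root diverges logarithmically; the factor log^δ with
δ > 1 repairs this. -/
theorem InLogEllTwo.isAdmissible {δ : ℝ} {s : ℤ → ℝ} (h : InLogEllTwo δ s) (h1 : 1 < δ) :
    IsAdmissible fun n => ENNReal.ofReal |s (2 * n)| := by
  refine tendsto_tsum_of_log h1 _ ?_
  have := h.tsum_ofReal_ne_top
  simpa only [ENNReal.ofReal_rpow_of_nonneg (abs_nonneg _) zero_le_two, Real.rpow_two,
    ← ENNReal.ofReal_mul (sq_nonneg |_|)] using this

theorem tendsto_const_mul_zero {α : Type*} {l : Filter α} {f : α → ℝ≥0∞} (h : Tendsto f l (𝓝 0))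
    {c : ℝ≥0∞} (hc : c ≠ ⊤) : Tendsto (fun x => c * f x) l (𝓝 0) := by
  simpa using ENNReal.Tendsto.const_mul h (Or.inr hc)

/-- Conditions on F enter through the estimate that keeps g, conditions on the potential through the
one that keeps r; the other sequence needs only its finite ℓ² norm. -/
theorem tendsto_lintegral_dblSum {r g : ℤ → ℝ≥0∞} (hr : ellTwo r ≠ ⊤) (hg : ellTwo g ≠ ⊤)
    (h : IsAdmissible g ∨ IsAdmissible r) :
    Tendsto (fun x => ∫⁻ t, dblSum r g x t) (cocompact ℝ) (𝓝 0) := by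
  rcases h with h | h
  · refine tendsto_of_tendsto_of_tendsto_of_le_of_le tendsto_const_nhds ?_ (fun _ => zero_le)
      fun x => lintegral_dblSum_le_left r g x hr
    exact tendsto_const_mul_zero (tendsto_const_mul_zero h ENNReal.ofReal_ne_top)
      (ENNReal.mul_ne_top ENNReal.ofNat_ne_top hr)
  · refine tendsto_of_tendsto_of_tendsto_of_le_of_le tendsto_const_nhds ?_ (fun _ => zero_le)
      fun x => lintegral_dblSum_le_right r g x hg
    exact tendsto_const_mul_zero (tendsto_const_mul_zero (h.comp tendsto_two_mul_cocompact)
      ENNReal.ofReal_ne_top) (ENNReal.mul_ne_top ENNReal.ofNat_ne_top hg)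

/-- Inversion of `1 - T` when `T²` is small. -/
theorem isUnit_one_sub_of_sq {T : H →L[ℂ] H} (h : ‖T * T‖ ≤ 1 / 2) :
    IsUnit (1 - T) ∧ ‖Ring.inverse (1 - T)‖ ≤ 2 * (1 + ‖T‖) := by
  have hu : IsUnit (1 - T) := by
    have h1 : IsUnit (1 - T * T) := isUnit_one_sub_of_norm_lt_one (by linarith)
    -- A factor of an invertible product of commuting elements is invertible.
    have h2 : 1 - T * T = (1 - T) * (1 + T) := by noncomm_ring
    rw [h2] at h1
    refine ((Commute.isUnit_mul_iff ?_).mp h1).1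
    change (1 - T) * (1 + T) = (1 + T) * (1 - T)
    noncomm_ring
  refine ⟨hu, ?_⟩
  set S := Ring.inverse (1 - T)
  have e : (1 - T) * S = 1 := Ring.mul_inverse_cancel _ hu
  -- Iterating S = 1 + TS once brings in T², whose smallness lets the last term be absorbed into the
  -- left side of the norm estimate.
  have e1 : S = 1 + T + T * T * S := by
    have e2 : S = 1 + T * S := by linear_combination (norm := noncomm_ring) e
    calc S = 1 + T * S := e2
      _ = 1 + T * (1 + T * S) := congrArg (fun A => 1 + T * A) e2
      _ = _ := by noncomm_ring
  have n1 : ‖(1 : H →L[ℂ] H)‖ ≤ 1 := ContinuousLinearMap.norm_id_le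
  have : ‖S‖ ≤ 1 + ‖T‖ + 1 / 2 * ‖S‖ := by
    calc ‖S‖ = ‖1 + T + T * T * S‖ := by rw [← e1]
      _ ≤ ‖(1 : H →L[ℂ] H)‖ + ‖T‖ + ‖T * T‖ * ‖S‖ :=
        (norm_add_le _ _).trans (add_le_add (norm_add_le _ _) (norm_mul_le _ _))
      _ ≤ _ := by gcongr
  linarith

/-- The points which are far from the real axis or lie on one of the far vertical lines. -/
def IsFar (D : RootData) (T₀ J : ℝ) (z : ℂ) : Prop :=
  T₀ ≤ |z.im| ∨ ∃ j : ℤ, J ≤ |(2 * j + 1 : ℝ)| ∧ z.re - D.center = 2 * j + 1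

theorem norm_le_half_of_enorm {E : Type*} [NormedAddCommGroup E] {a : E} (h : ‖a‖ₑ ≤ 1 / 2) :
    ‖a‖ ≤ 1 / 2 := by
  rw [← ofReal_norm, show (1 / 2 : ℝ≥0∞) = ENNReal.ofReal (1 / 2) by
    rw [ENNReal.ofReal_div_of_pos two_pos]; simp] at h
  exact (ENNReal.ofReal_le_ofReal_iff (by norm_num)).mp h

/-- Far from the real axis VR⁰ itself is small; on far vertical lines (VR⁰)² = V(R⁰VR⁰) is small by
`dblSum_le`. Both are operator bounds, so the thresholds do not depend on F. -/
theorem exists_isFar {M : Matrix (Fin 2) (Fin 4) ℂ} {D : RootData} (hD : D.IsFor M)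
    {P Q : ℝ → ℂ} (hP : MemLp P 2 μI) (hQ : MemLp Q 2 μI) :
    ∃ T₀ J : ℝ, 0 < T₀ ∧ ∀ z, IsFar D T₀ J z →
      IsSep D D.sepConst z ∧ ‖potRes D hP hQ z * potRes D hP hQ z‖ ≤ 1 / 2 := by
  set K := D.sepConst
  have hpot : ‖potL D hP hQ‖ₑ ≠ ⊤ := enorm_ne_top
  have hA : ‖potL D hP hQ‖ₑ * freeConst D K ≠ ⊤ := ENNReal.mul_ne_top hpot (freeConst_ne_top D K)
  have hhalf : (0 : ℝ≥0∞) < 1 / 2 := by simp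
  obtain ⟨T₁, hT₁⟩ := exists_of_eventually_cocompact (p := fun t =>
      ‖potL D hP hQ‖ₑ * freeConst D K * decay t ≤ 1 / 2) (by
    have := ENNReal.Tendsto.const_mul tendsto_decay (Or.inr hA)
    rw [mul_zero] at this
    exact this.eventually_le_const hhalf)
  set C : ℝ≥0∞ := ‖potL D hP hQ‖ₑ * (2 * ENNReal.ofReal (blockConst D K) ^ 2 * (4 * besselConst D))
    with hC
  have hC' : C ≠ ⊤ := ENNReal.mul_ne_top hpot (ENNReal.mul_ne_top (ENNReal.mul_ne_top (by simp)
    (ENNReal.pow_ne_top (by simp))) (ENNReal.mul_ne_top (by simp) (besselConst_ne_top D)))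
  have hr : ∑' m, rEnn D P Q m ^ (2 : ℝ) ≠ ⊤ := fun h => by
    have := ellTwo_rSeq_ne_top D hP hQ
    rw [ellTwo] at this
    change (∑' m, rEnn D P Q m ^ (2 : ℝ)) ^ (1 / (2 : ℝ)) ≠ ⊤ at this
    rw [h] at this
    exact this (ENNReal.top_rpow_of_pos (by norm_num))
  -- Exponent 1 leaves room: with p = q = 2 the condition is 1 · 2 > 1, so nothing beyond r in ℓ² is
  -- required.
  have hΨ := (tendsto_tsum_of_ellP Real.HolderConjugate.two_two (show (1 : ℝ) < 1 * 2 by norm_num)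
    (rEnn D P Q) hr).comp tendsto_two_mul_cocompact
  obtain ⟨J, hJ⟩ := exists_of_eventually_cocompact (p := fun x =>
      C * ∑' m, rEnn D P Q m * ENNReal.ofReal ((1 + |2 * x - 2 * m|) ^ (-1 : ℝ)) ≤ 1 / 2) (by
    have := ENNReal.Tendsto.const_mul hΨ (Or.inr hC')
    rw [mul_zero] at this
    exact this.eventually_le_const hhalf)
  refine ⟨max T₁ (2 * D.imBound + 1), J,
    lt_max_of_lt_right (by linarith [D.imBound_nonneg]), fun z hz => ?_⟩
  have hs : IsSep D K z := by
    refine isSep_of_odd_or_im hD ?_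
    rcases hz with hz | ⟨j, -, hz⟩
    exacts [Or.inr ((le_max_right _ _).trans hz), Or.inl ⟨j, hz⟩]
  refine ⟨hs, ?_⟩
  rcases hz with hz | ⟨j, hj, hz⟩
  · have h1 : ‖potRes D hP hQ z‖ ≤ 1 / 2 := norm_le_half_of_enorm
      ((enorm_potRes_le hP hQ hs).trans (hT₁ _ ((le_max_left _ _).trans hz)))
    calc _ ≤ ‖potRes D hP hQ z‖ * ‖potRes D hP hQ z‖ := norm_mul_le _ _
      _ ≤ (1 / 2) * (1 / 2) := by gcongr
      _ ≤ 1 / 2 := by norm_num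
  · refine norm_le_half_of_enorm ((enorm_clm_le fun F => ?_).trans (hJ (z.re - D.center) ?_))
    · refine ((potL D hP hQ).le_opENorm (freeRes D z (potRes D hP hQ z F))).trans ?_
      refine (mul_le_mul_right ((enorm_freeRes_potRes_le hP hQ hs F).trans
        (mul_le_mul_right ((dblSum_le _ _ _ _).trans (mul_le_mul_left (mul_le_mul_right
          (ellTwo_coefL_le D F) _) _)) _)) _).trans (le_of_eq ?_)
      rw [hC]
      ring
    · rw [hz]; exact hj

/-! ### Integrals over the boundaries of rectangles -/

section Contour

variable {E G : Type*} [NormedAddCommGroup E] [NormedSpace ℂ E] [NormedAddCommGroup G]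
  [NormedSpace ℂ G]

/-- The integral of `f` over the boundary of `[l, r] × [s, s']`. -/
def rectInt (l r s s' : ℝ) (f : ℂ → E) : E :=
  (∫ x in l..r, f ((x : ℂ) + (s : ℂ) * Complex.I))
    - (∫ x in l..r, f ((x : ℂ) + (s' : ℂ) * Complex.I))
    + Complex.I • (∫ t in s..s', f ((r : ℂ) + (t : ℂ) * Complex.I))
    - Complex.I • (∫ t in s..s', f ((l : ℂ) + (t : ℂ) * Complex.I))

/-- The lines which contain the sides of the rectangle `[l, r] × [s, s']`. -/
def sideLines (l r s s' : ℝ) : Set ℂ := {z | z.im = s ∨ z.im = s' ∨ z.re = l ∨ z.re = r}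

theorem sideLines_mem (l r s s' u : ℝ) :
    (u : ℂ) + (s : ℂ) * Complex.I ∈ sideLines l r s s' ∧
    (u : ℂ) + (s' : ℂ) * Complex.I ∈ sideLines l r s s' ∧
    (l : ℂ) + (u : ℂ) * Complex.I ∈ sideLines l r s s' ∧
    (r : ℂ) + (u : ℂ) * Complex.I ∈ sideLines l r s s' := by
  simp [sideLines]

theorem rectInt_congr {l r s s' : ℝ} {f g : ℂ → E} (h : ∀ z ∈ sideLines l r s s', f z = g z) :
    rectInt l r s s' f = rectInt l r s s' g := by
  have h' := fun u => sideLines_mem l r s s' u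
  simp only [rectInt, h _ (h' _).1, h _ (h' _).2.1, h _ (h' _).2.2.1, h _ (h' _).2.2.2]

theorem continuous_of_sideLines {F : Type*} [NormedAddCommGroup F] {l r s s' : ℝ} {f : ℂ → F}
    (h : ∀ z ∈ sideLines l r s s', ContinuousAt f z) :
    (Continuous fun u : ℝ => f ((u : ℂ) + (s : ℂ) * Complex.I)) ∧
    (Continuous fun u : ℝ => f ((u : ℂ) + (s' : ℂ) * Complex.I)) ∧
    (Continuous fun u : ℝ => f ((l : ℂ) + (u : ℂ) * Complex.I)) ∧
    (Continuous fun u : ℝ => f ((r : ℂ) + (u : ℂ) * Complex.I)) := by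
  have h' := fun u => sideLines_mem l r s s' u
  refine ⟨?_, ?_, ?_, ?_⟩ <;> refine continuous_iff_continuousAt.mpr fun u => ?_
  · exact ContinuousAt.comp' (f := fun u : ℝ => (u : ℂ) + (s : ℂ) * Complex.I) (h _ (h' u).1)
      (by fun_prop)
  · exact ContinuousAt.comp' (f := fun u : ℝ => (u : ℂ) + (s' : ℂ) * Complex.I) (h _ (h' u).2.1)
      (by fun_prop)
  · exact ContinuousAt.comp' (f := fun u : ℝ => (l : ℂ) + (u : ℂ) * Complex.I) (h _ (h' u).2.2.1)
      (by fun_prop)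
  · exact ContinuousAt.comp' (f := fun u : ℝ => (r : ℂ) + (u : ℂ) * Complex.I) (h _ (h' u).2.2.2)
      (by fun_prop)

theorem rectInt_map [CompleteSpace E] [CompleteSpace G] (L : E →L[ℂ] G) {l r s s' : ℝ} {f : ℂ → E}
    (h : ∀ z ∈ sideLines l r s s', ContinuousAt f z) :
    rectInt l r s s' (fun z => L (f z)) = L (rectInt l r s s' f) := by
  obtain ⟨c1, c2, c3, c4⟩ := continuous_of_sideLines h
  simp only [rectInt, map_sub, map_add, map_smul]
  rw [← L.intervalIntegral_comp_comm (c1.intervalIntegrable _ _),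
    ← L.intervalIntegral_comp_comm (c2.intervalIntegrable _ _),
    ← L.intervalIntegral_comp_comm (c3.intervalIntegrable _ _),
    ← L.intervalIntegral_comp_comm (c4.intervalIntegrable _ _)]

theorem rectInt_sub {l r s s' : ℝ} {f g : ℂ → E}
    (hf : ∀ z ∈ sideLines l r s s', ContinuousAt f z)
    (hg : ∀ z ∈ sideLines l r s s', ContinuousAt g z) :
    rectInt l r s s' (fun z => f z - g z) = rectInt l r s s' f - rectInt l r s s' g := by
  obtain ⟨c1, c2, c3, c4⟩ := continuous_of_sideLines hf
  obtain ⟨d1, d2, d3, d4⟩ := continuous_of_sideLines hg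
  simp only [rectInt]
  rw [intervalIntegral.integral_sub (c1.intervalIntegrable _ _) (d1.intervalIntegrable _ _),
    intervalIntegral.integral_sub (c2.intervalIntegrable _ _) (d2.intervalIntegrable _ _),
    intervalIntegral.integral_sub (c3.intervalIntegrable _ _) (d3.intervalIntegrable _ _),
    intervalIntegral.integral_sub (c4.intervalIntegrable _ _) (d4.intervalIntegrable _ _)]
  module

theorem rectInt_add_adjacent {l r s s' s'' : ℝ} {f : ℂ → E}
    (hl : Continuous fun u : ℝ => f ((l : ℂ) + (u : ℂ) * Complex.I))
    (hr : Continuous fun u : ℝ => f ((r : ℂ) + (u : ℂ) * Complex.I)) :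
    rectInt l r s s' f + rectInt l r s' s'' f = rectInt l r s s'' f := by
  simp only [rectInt]
  rw [← intervalIntegral.integral_add_adjacent_intervals (hl.intervalIntegrable s s')
    (hl.intervalIntegrable s' s''), ← intervalIntegral.integral_add_adjacent_intervals
    (hr.intervalIntegrable s s') (hr.intervalIntegrable s' s'')]
  module

theorem rectInt_eq_zero [CompleteSpace E] {l r s s' : ℝ} {f : ℂ → E}
    (h : ∀ z : ℂ, z.im ∈ Set.uIcc s s' → DifferentiableAt ℂ f z) : rectInt l r s s' f = 0 := by
  have := Complex.integral_boundary_rect_eq_zero_of_differentiableOn f ⟨l, s⟩ ⟨r, s'⟩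
    fun z hz => (h z hz.2).differentiableWithinAt
  simpa [rectInt] using this

/-- The integral over the boundary of `[l, r] × [-T, T]` does not depend on `T`. -/
theorem rectInt_eq_of_le [CompleteSpace E] {l r T T' : ℝ} (hT' : T ≤ T') {f : ℂ → E}
    (h : ∀ z : ℂ, T ≤ |z.im| → DifferentiableAt ℂ f z)
    (hl : Continuous fun u : ℝ => f ((l : ℂ) + (u : ℂ) * Complex.I))
    (hr : Continuous fun u : ℝ => f ((r : ℂ) + (u : ℂ) * Complex.I)) :
    rectInt l r (-T') T' f = rectInt l r (-T) T f := by
  rw [← rectInt_add_adjacent (s' := -T) hl hr, ← rectInt_add_adjacent (s := -T) (s' := T) hl hr,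
    rectInt_eq_zero (s := -T') fun z hz => ?_, rectInt_eq_zero (s := T) fun z hz => ?_, zero_add,
    add_zero]
  · rw [Set.uIcc_of_le hT', Set.mem_Icc] at hz
    exact h z (hz.1.trans (le_abs_self _))
  · rw [Set.uIcc_of_le (by linarith), Set.mem_Icc] at hz
    exact h z (by rw [le_abs]; right; linarith)

theorem enorm_intervalIntegral_le {f : ℝ → E} {a b : ℝ} (hab : a ≤ b) :
    ‖∫ x in a..b, f x‖ₑ ≤ ∫⁻ x in Set.Ioc a b, ‖f x‖ₑ := by
  rw [intervalIntegral.integral_of_le hab]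
  exact enorm_integral_le_lintegral_enorm _

theorem enorm_rectInt_le {l r s s' : ℝ} (hlr : l ≤ r) (hs : s ≤ s') {f : ℂ → E} {B : ℝ≥0∞}
    (h : ∀ x : ℝ, ‖f ((x : ℂ) + (s : ℂ) * Complex.I)‖ₑ ≤ B)
    (h' : ∀ x : ℝ, ‖f ((x : ℂ) + (s' : ℂ) * Complex.I)‖ₑ ≤ B) :
    ‖rectInt l r s s' f‖ₑ ≤ 2 * ENNReal.ofReal (r - l) * B +
      ((∫⁻ t : ℝ, ‖f ((r : ℂ) + (t : ℂ) * Complex.I)‖ₑ) +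
        ∫⁻ t : ℝ, ‖f ((l : ℂ) + (t : ℂ) * Complex.I)‖ₑ) := by
  have hor : ∀ σ : ℝ, (∀ x : ℝ, ‖f ((x : ℂ) + (σ : ℂ) * Complex.I)‖ₑ ≤ B) →
      ‖∫ x in l..r, f ((x : ℂ) + (σ : ℂ) * Complex.I)‖ₑ ≤ ENNReal.ofReal (r - l) * B := fun σ hσ => by
    refine (enorm_intervalIntegral_le hlr).trans ((lintegral_mono fun x => hσ x).trans ?_)
    rw [lintegral_const, Measure.restrict_apply_univ, Real.volume_Ioc, mul_comm]
  have ver : ∀ ρ : ℝ, ‖Complex.I • ∫ t in s..s', f ((ρ : ℂ) + (t : ℂ) * Complex.I)‖ₑ ≤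
      ∫⁻ t : ℝ, ‖f ((ρ : ℂ) + (t : ℂ) * Complex.I)‖ₑ := fun ρ => by
    rw [enorm_smul, ← ofReal_norm Complex.I, Complex.norm_I, ENNReal.ofReal_one, one_mul]
    exact (enorm_intervalIntegral_le hs).trans (setLIntegral_le_lintegral _ _)
  refine (enorm_sub_le.trans (add_le_add ((enorm_add_le _ _).trans (add_le_add
    (enorm_sub_le.trans (add_le_add (hor s h) (hor s' h'))) (ver r))) (ver l))).trans (le_of_eq ?_)
  ring

/-- If `f` is holomorphic and decays for large imaginary parts, then the integral over the boundary
of `[l, r] × [-T, T]` is controlled by the integrals over the vertical lines. -/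
theorem enorm_rectInt_le_of_decay [CompleteSpace E] {l r T : ℝ} (hlr : l ≤ r) (hT : 0 ≤ T)
    {f : ℂ → E} (h : ∀ z : ℂ, T ≤ |z.im| → DifferentiableAt ℂ f z)
    (hl : Continuous fun u : ℝ => f ((l : ℂ) + (u : ℂ) * Complex.I))
    (hr : Continuous fun u : ℝ => f ((r : ℂ) + (u : ℂ) * Complex.I)) {B : ℝ≥0∞} (hB : B ≠ ⊤)
    (hf : ∀ z : ℂ, T ≤ |z.im| → ‖f z‖ₑ ≤ B * decay z.im) :
    ‖rectInt l r (-T) T f‖ₑ ≤ (∫⁻ t : ℝ, ‖f ((r : ℂ) + (t : ℂ) * Complex.I)‖ₑ) +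
      ∫⁻ t : ℝ, ‖f ((l : ℂ) + (t : ℂ) * Complex.I)‖ₑ := by
  set V := (∫⁻ t : ℝ, ‖f ((r : ℂ) + (t : ℂ) * Complex.I)‖ₑ) +
      ∫⁻ t : ℝ, ‖f ((l : ℂ) + (t : ℂ) * Complex.I)‖ₑ
  -- The integral is the same for every larger height T', and the contribution of the horizontal
  -- sides vanishes as T' → ∞.
  have hlim : Tendsto (fun T' : ℝ => 2 * ENNReal.ofReal (r - l) * (B * decay T') + V) atTop
      (𝓝 V) := by
    have h1 : Tendsto decay atTop (𝓝 0) := tendsto_decay.mono_left atTop_le_cocompact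
    have h2 := tendsto_const_mul_zero (tendsto_const_mul_zero h1 hB)
      (c := 2 * ENNReal.ofReal (r - l)) (ENNReal.mul_ne_top (by simp) (by simp))
    simpa using h2.add_const V
  refine ge_of_tendsto hlim ?_
  filter_upwards [eventually_ge_atTop T] with T' hT'
  rw [← rectInt_eq_of_le hT' h hl hr]
  have hT0 : 0 ≤ T' := hT.trans hT'
  refine enorm_rectInt_le hlr (by linarith) (fun x => ?_) fun x => ?_
  · refine (hf _ ?_).trans (le_of_eq ?_)
    · simpa [abs_of_nonneg hT0] using hT'
    · simp [decay]
  · refine (hf _ ?_).trans (le_of_eq ?_)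
    · simpa [abs_of_nonneg hT0] using hT'
    · simp [decay]

end Contour

/-! ### Equiconvergence -/

theorem isFar_of_mem_sideLines {D : RootData} {T₀ J T l r : ℝ} {n : ℕ} (hT₀ : T₀ ≤ T)
    (hJ : J ≤ 2 * n + 1) (hl : l = D.center - (2 * n + 1)) (hr : r = D.center + (2 * n + 1)) {z : ℂ}
    (hz : z ∈ sideLines l r (-T) T) : IsFar D T₀ J z := by
  rcases hz with h | h | h | h
  · left; rw [h, abs_neg]; exact hT₀.trans (le_abs_self T)
  · left; rw [h]; exact hT₀.trans (le_abs_self T)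
  -- The left side lies at -(2n + 1) = 2(-n - 1) + 1 from the centre.
  · refine Or.inr ⟨-n - 1, ?_, ?_⟩
    · push_cast
      rw [show (2 * (-(n : ℝ) - 1) + 1) = -(2 * n + 1) by ring, abs_neg]
      exact hJ.trans (le_abs_self _)
    · push_cast
      rw [h, hl]; ring
  · refine Or.inr ⟨n, ?_, ?_⟩
    · push_cast
      exact hJ.trans (le_abs_self _)
    · push_cast
      rw [h, hr]; ring

theorem frontier_rect_subset (D : RootData) (N : ℕ) (T : ℝ) :
    frontier (rect D N T) ⊆ sideLines (D.center - (N + 1)) (D.center + (N + 1)) (-T) T := by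
  have e : rect D N T = {z : ℂ | |z.re - D.center| < N + 1} ∩ {z : ℂ | |z.im| < T} := rfl
  have h0 : (0 : ℝ) ≤ N + 1 := by positivity
  rw [e]
  intro z hz
  rcases frontier_inter_subset _ _ hz with ⟨h, -⟩ | ⟨-, h⟩
  · have h1 : |z.re - D.center| = N + 1 :=
      frontier_lt_subset_eq (f := fun z : ℂ => |z.re - D.center|) (by fun_prop) (by fun_prop) h
    rcases (abs_eq h0).mp h1 with h2 | h2
    · exact Or.inr (Or.inr (Or.inr (by linarith)))
    · exact Or.inr (Or.inr (Or.inl (by linarith)))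
  · have h1 : |z.im| = T :=
      frontier_lt_subset_eq (f := fun z : ℂ => |z.im|) (by fun_prop) (by fun_prop) h
    rcases (abs_eq (h1 ▸ abs_nonneg _)).mp h1 with h2 | h2
    · exact Or.inr (Or.inl h2)
    · exact Or.inl h2

/-- A contour integral of `synthL ∘ f`, where `f` is bounded by the double sum, tends to zero. -/
theorem tendsto_supNorm_contour {D : RootData} {T₀ J : ℝ} (hT₀ : 0 < T₀) {f : ℂ → X}
    (hd : ∀ z, IsFar D T₀ J z → DifferentiableAt ℂ f z) {r g : ℤ → ℝ≥0∞} {B C : ℝ≥0∞}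
    (hB : B ≠ ⊤) (hC : C ≠ ⊤) (hf : ∀ z, IsFar D T₀ J z → ‖f z‖ₑ ≤ B * decay z.im)
    (hg : ∀ z, IsFar D T₀ J z → ‖f z‖ₑ ≤ C * dblSum r g (z.re - D.center) z.im)
    (h : Tendsto (fun x => ∫⁻ t, dblSum r g x t) (cocompact ℝ) (𝓝 0)) :
    Tendsto (fun q : ℕ × ℝ => supNorm (contour D (2 * q.1) q.2 fun z => synthL D (f z)))
      (atTop ×ˢ 𝓟 (Set.Ici T₀)) (𝓝 0) := by
  set c : ℂ := 1 / (2 * Real.pi * Complex.I) with hc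
  set C₁ : ℝ≥0∞ := ENNReal.ofReal (2 * rootBound D) * ‖c‖ₑ with hC₁
  set x : ℕ → ℝ := fun n => 2 * n + 1 with hx
  have hx1 : Tendsto x atTop atTop := (tendsto_natCast_atTop_atTop.const_mul_atTop
    two_pos).atTop_add tendsto_const_nhds
  have t1 := h.comp (hx1.mono_right atTop_le_cocompact)
  have t2 := h.comp ((tendsto_neg_atTop_atBot.comp hx1).mono_right atBot_le_cocompact)
  have t3 : Tendsto (fun n => C₁ * (C * ((∫⁻ t, dblSum r g (x n) t) +
      ∫⁻ t, dblSum r g (-x n) t))) atTop (𝓝 0) := by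
    refine tendsto_const_mul_zero (tendsto_const_mul_zero ?_ hC)
      (ENNReal.mul_ne_top ENNReal.ofReal_ne_top enorm_ne_top)
    simpa using t1.add t2
  -- The majorant depends on n only; this gives the uniformity in T.
  refine tendsto_of_tendsto_of_tendsto_of_le_of_le' tendsto_const_nhds (t3.comp tendsto_fst)
    (Eventually.of_forall fun _ => zero_le) ?_
  filter_upwards [prod_mem_prod (hx1.eventually_ge_atTop J) (mem_principal_self (Set.Ici T₀))]
    with ⟨n, T⟩ ⟨hn, hT⟩
  simp only [Set.mem_ofPred_eq, Set.mem_Ici] at hn hT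
  set l : ℝ := D.center - (((2 * n : ℕ) : ℝ) + 1) with hl
  set ρ : ℝ := D.center + (((2 * n : ℕ) : ℝ) + 1) with hρ
  have hl' : l = D.center - (2 * n + 1) := by rw [hl]; push_cast; ring
  have hρ' : ρ = D.center + (2 * n + 1) := by rw [hρ]; push_cast; ring
  have far : ∀ z ∈ sideLines l ρ (-T) T, IsFar D T₀ J z := fun z hz =>
    isFar_of_mem_sideLines hT hn hl' hρ' hz
  have far' : ∀ z : ℂ, T ≤ |z.im| → IsFar D T₀ J z := fun z hz => Or.inl (hT.trans hz)
  have cont : ∀ z ∈ sideLines l ρ (-T) T, ContinuousAt f z := fun z hz =>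
    (hd z (far z hz)).continuousAt
  obtain ⟨-, -, k3, k4⟩ := continuous_of_sideLines cont
  -- The integral is taken in ℓ¹, before the expansion, since its value has to be estimated there.
  have e : contour D (2 * n) T (fun z => synthL D (f z)) = synthL D (c • rectInt l ρ (-T) T f) := by
    rw [map_smul, ← rectInt_map _ cont]
    rfl
  have hlρ : l ≤ ρ := by
    rw [hl', hρ']
    have : (0 : ℝ) ≤ n := n.cast_nonneg
    linarith
  have hv : ∀ y : ℝ, (∀ u : ℝ, IsFar D T₀ J ((y : ℂ) + (u : ℂ) * Complex.I)) →
      ∫⁻ t : ℝ, ‖f ((y : ℂ) + (t : ℂ) * Complex.I)‖ₑ ≤ C * ∫⁻ t, dblSum r g (y - D.center) t := by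
    intro y hy
    rw [← lintegral_const_mul' _ _ hC]
    refine lintegral_mono fun t => (hg _ (hy t)).trans (le_of_eq ?_)
    simp
  have h1 := hv ρ fun u => far _ (sideLines_mem l ρ (-T) T u).2.2.2
  have h2 := hv l fun u => far _ (sideLines_mem l ρ (-T) T u).2.2.1
  rw [show ρ - D.center = x n by rw [hρ']; ring] at h1
  rw [show l - D.center = -x n by rw [hl']; ring] at h2
  change supNorm (contour D (2 * n) T fun z => synthL D (f z)) ≤ C₁ * (C * (_ + _))
  rw [e]
  refine (supNorm_synthL_le D _).trans ?_
  rw [enorm_smul, hC₁, mul_assoc, mul_add C]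
  refine mul_le_mul_right (mul_le_mul_right ?_ _) _
  exact (enorm_rectInt_le_of_decay hlρ (hT₀.le.trans hT) (fun z hz => hd z (far' z hz)) k3 k4 hB
    fun z hz => hf z (far' z hz)).trans (add_le_add h1 h2)

/-- The coefficients of `(z - L)⁻¹ F - (z - L⁰)⁻¹ F`. -/
def resDiff (D : RootData) {P Q : ℝ → ℂ} (hP : MemLp P 2 μI) (hQ : MemLp Q 2 μI) (F : H) (z : ℂ) :
    X :=
  freeRes D z (Ring.inverse (1 - potRes D hP hQ z) F) - freeRes D z F

/-- With T = VR⁰ and S = (1 - T)⁻¹ one has SF = F + TF + ST²F, so the difference of the resolvents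
is R⁰TF + R⁰ST(TF). Since T(TF) = V(R⁰TF), both terms are bounded by the ℓ¹ norm of R⁰VR⁰F and no
Neumann series has to be summed. -/
theorem enorm_resDiff_le {D : RootData} {P Q : ℝ → ℂ} (hP : MemLp P 2 μI) (hQ : MemLp Q 2 μI)
    {K : ℝ} {z : ℂ} (hs : IsSep D K z)
    (h : ‖potRes D hP hQ z * potRes D hP hQ z‖ ≤ 1 / 2) (F : H) :
    ‖resDiff D hP hQ F z‖ₑ ≤ (1 + freeConst D K *
      (2 * (1 + ‖potL D hP hQ‖ₑ * freeConst D K)) * ‖potL D hP hQ‖ₑ) *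
        ‖freeRes D z (potRes D hP hQ z F)‖ₑ := by
  obtain ⟨hu, hS⟩ := isUnit_one_sub_of_sq h
  set T := potRes D hP hQ z with hT
  set S := Ring.inverse (1 - T)
  have e : S F = F + T F + S (T (T F)) := by
    have e1 : S * (1 - T) = 1 := Ring.inverse_mul_cancel _ hu
    have e2 : ∀ G, S G - S (T G) = G := fun G => by
      rw [← map_sub]; exact congrArg (fun A : H →L[ℂ] H => A G) e1
    have h1 := e2 F
    have h2 := e2 (T F)
    linear_combination (norm := module) h1 + h2
  have hS' : ‖S‖ₑ ≤ 2 * (1 + ‖potL D hP hQ‖ₑ * freeConst D K) := by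
    have hn : ‖T‖ₑ ≤ ‖potL D hP hQ‖ₑ * freeConst D K :=
      (enorm_potRes_le hP hQ hs).trans (mul_le_of_le_one_right' (decay_le_one _))
    calc ‖S‖ₑ = ENNReal.ofReal ‖S‖ := (ofReal_norm _).symm
      _ ≤ ENNReal.ofReal (2 * (1 + ‖T‖)) := ENNReal.ofReal_le_ofReal hS
      _ = 2 * (1 + ‖T‖ₑ) := by
        rw [ENNReal.ofReal_mul zero_le_two, ENNReal.ofReal_add zero_le_one (norm_nonneg _),
          ofReal_norm]
        simp
      _ ≤ _ := by gcongr
  have e3 : resDiff D hP hQ F z = freeRes D z (T F) + freeRes D z (S (T (T F))) := by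
    change freeRes D z (S F) - freeRes D z F = _
    rw [e, map_add, map_add]
    abel
  have b : ‖freeRes D z (S (T (T F)))‖ₑ ≤ freeConst D K *
      (2 * (1 + ‖potL D hP hQ‖ₑ * freeConst D K)) * ‖potL D hP hQ‖ₑ * ‖freeRes D z (T F)‖ₑ := by
    have b1 : ‖T (T F)‖ₑ ≤ ‖potL D hP hQ‖ₑ * ‖freeRes D z (T F)‖ₑ :=
      (potL D hP hQ).le_opENorm (freeRes D z (T F))
    calc _ ≤ freeConst D K * decay z.im * ‖S (T (T F))‖ₑ := enorm_freeRes_le' hs _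
      _ ≤ freeConst D K * 1 * (‖S‖ₑ * ‖T (T F)‖ₑ) := by
        gcongr
        · exact decay_le_one _
        · exact S.le_opENorm _
      _ ≤ freeConst D K * 1 * ((2 * (1 + ‖potL D hP hQ‖ₑ * freeConst D K)) *
          (‖potL D hP hQ‖ₑ * ‖freeRes D z (T F)‖ₑ)) := by gcongr
      _ = _ := by ring
  rw [e3, add_mul, one_mul]
  exact (enorm_add_le _ _).trans (add_le_add le_rfl b)

theorem differentiableAt_inverse_potRes {D : RootData} (hΔ : D.Δ ≠ 0) {P Q : ℝ → ℂ}
    (hP : MemLp P 2 μI) (hQ : MemLp Q 2 μI) {K : ℝ} {z : ℂ} (hs : IsSep D K z)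
    (hu : IsUnit (1 - potRes D hP hQ z)) :
    DifferentiableAt ℂ (fun z => Ring.inverse (1 - potRes D hP hQ z)) z := by
  have h : DifferentiableAt ℂ (fun z => 1 - potRes D hP hQ z) z :=
    (differentiableAt_const _).fun_sub (differentiableAt_potRes hΔ hP hQ hs)
  exact DifferentiableAt.comp (g := Ring.inverse) z (differentiableAt_inverse (𝕜 := ℂ) hu) h

/-- The side lines of the rectangle `R_{NT}`. -/
def rectLines (D : RootData) (N : ℕ) (T : ℝ) : Set ℂ :=
  sideLines (D.center - (N + 1)) (D.center + (N + 1)) (-T) T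

theorem contour_congr {D : RootData} {N : ℕ} {T : ℝ} {f g : ℂ → H}
    (h : ∀ z ∈ rectLines D N T, f z = g z) : contour D N T f = contour D N T g :=
  congrArg (fun u : H => (1 / (2 * Real.pi * Complex.I) : ℂ) • u) (rectInt_congr h)

theorem contour_sub {D : RootData} {N : ℕ} {T : ℝ} {f g : ℂ → H}
    (hf : ∀ z ∈ rectLines D N T, ContinuousAt f z) (hg : ∀ z ∈ rectLines D N T, ContinuousAt g z) :
    contour D N T (fun z => f z - g z) = contour D N T f - contour D N T g :=
  (congrArg (fun u : H => (1 / (2 * Real.pi * Complex.I) : ℂ) • u) (rectInt_sub hf hg)).trans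
    (smul_sub _ _ _)

end Dirac1D

end

open Dirac1D
theorem proposition2
    (M : Matrix (Fin 2) (Fin 4) ℂ) (hM : IsRegular M)
    (P Q : ℝ → ℂ) (hP : MemLp P 2 μI) (hQ : MemLp Q 2 μI)
    (D : RootData) (hD : D.IsFor M) :
    ∃ (N₀ : ℕ) (T₀ : ℝ), 0 < T₀ ∧
      (∀ N : ℕ, N₀ ≤ N → Even N → ∀ T : ℝ, T₀ ≤ T →
        frontier (rect D N T) ⊆ resSet M 0 0 ∩ resSet M P Q) ∧
      ∀ F : H,
        ((∃ p : ℝ, 1 < p ∧ p < 2 ∧ InEllP p (gSeq D F)) ∨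
         (∃ p : ℝ, 1 < p ∧ p < 2 ∧ InEllP p (rSeq D P Q)) ∨
         (∃ δ : ℝ, 1 < δ ∧ InLogEllTwo δ (gSeq D F)) ∨
         (∃ δ : ℝ, 1 < δ ∧ InLogEllTwo δ (rSeq D P Q))) →
        Tendsto (fun q : ℕ × ℝ => supNorm (AN M P Q D (2 * q.1) q.2 F))
            (atTop ×ˢ 𝓟 (Set.Ici T₀)) (𝓝 0) ∧
        Tendsto (fun q : ℕ × ℝ => supNorm (SN M P Q D (2 * q.1) q.2 F - SN₀ M D (2 * q.1) q.2 F))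
            (atTop ×ˢ 𝓟 (Set.Ici T₀)) (𝓝 0) := by
  obtain ⟨T₀, J, hT₀, hfar⟩ := exists_isFar hD hP hQ
  have hΔ := D.Δ_ne_zero M hD
  set K := D.sepConst
  have res₀ : ∀ z, IsFar D T₀ J z → IsResolventAt M 0 0 z ((synthL D).comp (freeRes D z)) :=
    fun z hz => isResolventAt_free hM hD (hfar z hz).1
  have unit : ∀ z, IsFar D T₀ J z → IsUnit (1 - potRes D hP hQ z) := fun z hz =>
    (isUnit_one_sub_of_sq (hfar z hz).2).1
  have res : ∀ z, IsFar D T₀ J z → IsResolventAt M P Q z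
      ((synthL D).comp ((freeRes D z).comp (Ring.inverse (1 - potRes D hP hQ z)))) :=
    fun z hz => isResolventAt_pert hM hD hP hQ (hfar z hz).1 (unit z hz)
  -- For N = 2n the vertical sides lie at ±(2n + 1) from the centre, so N ≥ J makes them far.
  refine ⟨⌈J⌉₊, T₀, hT₀, fun N hN hE T hT z hz => ?_, fun F hF => ?_⟩
  · obtain ⟨n, rfl⟩ := hE
    have hJ : J ≤ 2 * n + 1 := by
      have := (Nat.le_ceil J).trans (Nat.cast_le.mpr hN)
      push_cast at this
      linarith
    have h := isFar_of_mem_sideLines hT hJ (by push_cast; ring) (by push_cast; ring)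
      (frontier_rect_subset D _ T hz)
    exact ⟨⟨_, res₀ z h⟩, ⟨_, res z h⟩⟩
  have dF : ∀ G : H, ∀ z, IsFar D T₀ J z → DifferentiableAt ℂ (fun z => freeRes D z G) z :=
    fun G z hz => (differentiableAt_freeRes hΔ (hfar z hz).1).clm_apply (differentiableAt_const _)
  have dS : ∀ z, IsFar D T₀ J z →
      DifferentiableAt ℂ (fun z => freeRes D z (Ring.inverse (1 - potRes D hP hQ z) F)) z :=
    fun z hz => (differentiableAt_freeRes hΔ (hfar z hz).1).clm_apply
      ((differentiableAt_inverse_potRes hΔ hP hQ (hfar z hz).1 (unit z hz)).clm_apply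
        (differentiableAt_const _))
  have dA : ∀ z, IsFar D T₀ J z →
      DifferentiableAt ℂ (fun z => freeRes D z (potRes D hP hQ z F)) z :=
    fun z hz => (differentiableAt_freeRes hΔ (hfar z hz).1).clm_apply
      ((differentiableAt_potRes hΔ hP hQ (hfar z hz).1).clm_apply (differentiableAt_const _))
  have hr := ellTwo_rSeq_ne_top D hP hQ
  have hg : ellTwo (fun n : ℤ => ‖coefL D n F‖ₑ) ≠ ⊤ := ne_top_of_le_ne_top
    (ENNReal.mul_ne_top (besselConst_ne_top D) enorm_ne_top) (ellTwo_coefL_le D F)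
  have eg : (fun n : ℤ => ENNReal.ofReal |gSeq D F (2 * n)|) = fun n => ‖coefL D n F‖ₑ := by
    funext n
    rw [gSeq_eq_norm, abs_norm, ofReal_norm]
  have er : (fun n : ℤ => ENNReal.ofReal |rSeq D P Q (2 * n)|) = rEnn D P Q := by
    funext n
    rw [abs_of_nonneg ((norm_nonneg _).trans (norm_wSeq_le_rSeq D P Q 0 0 _)), rEnn]
  -- The four conditions are used only through this alternative.
  have hadm : IsAdmissible (fun n : ℤ => ‖coefL D n F‖ₑ) ∨ IsAdmissible (rEnn D P Q) := by
    rw [← eg, ← er]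
    rcases hF with ⟨p, h1, h2, h⟩ | ⟨p, h1, h2, h⟩ | ⟨δ, h1, h⟩ | ⟨δ, h1, h⟩
    exacts [Or.inl (h.isAdmissible h1 h2), Or.inr (h.isAdmissible h1 h2),
      Or.inl (h.isAdmissible h1), Or.inr (h.isAdmissible h1)]
  have hlim := tendsto_lintegral_dblSum (r := rEnn D P Q) hr hg hadm
  have hpot : ‖potL D hP hQ‖ₑ ≠ ⊤ := enorm_ne_top
  have hfc := freeConst_ne_top D K
  set B₁ : ENNReal := freeConst D K * (‖potL D hP hQ‖ₑ * freeConst D K) * ‖F‖ₑ with hB₁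
  set C₁ : ENNReal := 2 * ENNReal.ofReal (blockConst D K) ^ 2
  set C₂ : ENNReal := 1 + freeConst D K *
    (2 * (1 + ‖potL D hP hQ‖ₑ * freeConst D K)) * ‖potL D hP hQ‖ₑ
  have hB₁' : B₁ ≠ ⊤ := ENNReal.mul_ne_top
    (ENNReal.mul_ne_top hfc (ENNReal.mul_ne_top hpot hfc)) enorm_ne_top
  have hC₁ : C₁ ≠ ⊤ := ENNReal.mul_ne_top (by simp) (ENNReal.pow_ne_top (by simp))
  have hC₂ : C₂ ≠ ⊤ := ENNReal.add_ne_top.mpr ⟨by simp, ENNReal.mul_ne_top (ENNReal.mul_ne_top hfc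
    (ENNReal.mul_ne_top (by simp) (ENNReal.add_ne_top.mpr ⟨by simp, ENNReal.mul_ne_top hpot hfc⟩)))
    hpot⟩
  have b1 : ∀ z, IsFar D T₀ J z →
      ‖freeRes D z (potRes D hP hQ z F)‖ₑ ≤ B₁ * decay z.im := fun z hz => by
    have hs := (hfar z hz).1
    calc _ ≤ freeConst D K * decay z.im * ‖potRes D hP hQ z F‖ₑ := enorm_freeRes_le' hs _
      _ ≤ freeConst D K * decay z.im * ((‖potL D hP hQ‖ₑ * freeConst D K * 1) * ‖F‖ₑ) := by
        refine mul_le_mul_right (((potRes D hP hQ z).le_opENorm F).trans ?_) _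
        refine mul_le_mul_left ((enorm_potRes_le hP hQ hs).trans ?_) _
        exact mul_le_mul_right (decay_le_one _) _
      _ = _ := by rw [hB₁]; ring
  have b2 : ∀ z, IsFar D T₀ J z → ‖freeRes D z (potRes D hP hQ z F)‖ₑ ≤
      C₁ * dblSum (rEnn D P Q) (fun n => ‖coefL D n F‖ₑ) (z.re - D.center) z.im := fun z hz =>
    enorm_freeRes_potRes_le hP hQ (hfar z hz).1 F
  have b3 : ∀ z, IsFar D T₀ J z → ‖resDiff D hP hQ F z‖ₑ ≤
      C₂ * ‖freeRes D z (potRes D hP hQ z F)‖ₑ := fun z hz =>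
    enorm_resDiff_le hP hQ (hfar z hz).1 (hfar z hz).2 F
  have tA := tendsto_supNorm_contour hT₀ dA hB₁' hC₁ b1 b2 hlim
  have tS := tendsto_supNorm_contour (f := resDiff D hP hQ F) hT₀
    (fun z hz => (dS z hz).sub (dF F z hz)) (ENNReal.mul_ne_top hC₂ hB₁')
    (ENNReal.mul_ne_top hC₂ hC₁)
    (fun z hz => (b3 z hz).trans (by rw [mul_assoc]; exact mul_le_mul_right (b1 z hz) _))
    (fun z hz => (b3 z hz).trans (by rw [mul_assoc]; exact mul_le_mul_right (b2 z hz) _)) hlim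
  -- The resolvents are given by the coefficient formulas only at far points; eventually the whole
  -- contour consists of such points.
  have ev : ∀ᶠ q : ℕ × ℝ in atTop ×ˢ 𝓟 (Set.Ici T₀), ∀ z ∈ rectLines D (2 * q.1) q.2,
      IsFar D T₀ J z := by
    filter_upwards [prod_mem_prod (eventually_ge_atTop ⌈J⌉₊) (mem_principal_self (Set.Ici T₀))]
      with q hq z hz
    refine isFar_of_mem_sideLines (n := q.1) hq.2 ?_ (by push_cast; ring) (by push_cast; ring) hz
    have h1 := (Nat.le_ceil J).trans (Nat.cast_le.mpr hq.1)
    have h2 : (0 : ℝ) ≤ q.1 := q.1.cast_nonneg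
    linarith
  refine ⟨tA.congr' ?_, tS.congr' ?_⟩
  · filter_upwards [ev] with q hq
    refine congrArg supNorm (contour_congr fun z hz => ?_)
    have h := hq z hz
    rw [resolv₀, resolv_eq (res₀ z h)]
    simp only [ContinuousLinearMap.comp_apply]
    rw [mulV_synthL D hP hQ]
    rfl
  · filter_upwards [ev] with q hq
    have c1 : ∀ z ∈ rectLines D (2 * q.1) q.2, ContinuousAt
        (fun z => synthL D (freeRes D z (Ring.inverse (1 - potRes D hP hQ z) F))) z := fun z hz =>
      (synthL D).continuous.continuousAt.comp (dS z (hq z hz)).continuousAt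
    have c2 : ∀ z ∈ rectLines D (2 * q.1) q.2,
        ContinuousAt (fun z => synthL D (freeRes D z F)) z := fun z hz =>
      (synthL D).continuous.continuousAt.comp (dF F z (hq z hz)).continuousAt
    have e1 : SN M P Q D (2 * q.1) q.2 F = contour D (2 * q.1) q.2 fun z =>
        synthL D (freeRes D z (Ring.inverse (1 - potRes D hP hQ z) F)) :=
      contour_congr fun z hz => by rw [resolv_eq (res z (hq z hz))]; rfl
    have e2 : SN₀ M D (2 * q.1) q.2 F = contour D (2 * q.1) q.2 fun z =>
        synthL D (freeRes D z F) :=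
      contour_congr fun z hz => by rw [resolv₀, resolv_eq (res₀ z (hq z hz))]; rfl
    rw [e1, e2, ← contour_sub c1 c2]
    exact congrArg supNorm (contour_congr fun z _ => map_sub _ _ _)
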